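/- **Theorem 4.1.** Let $H$ be a separable complex Hilbert space, with $(f\otimes g)v=\langle v,g\rangle f$ for $f,g,v\in H$, and let $|||A|||_2=(\sum_i\|Ae_i\|^2)^{1/2}$ ($(e_i)$ any orthonormal basis) be the Hilbert–Schmidt norm on the space $S_2(H)$ of Hilbert–Schmidt operators. For a random element $Y$ of $H$, respectively of $S_2(H)$, put $\|Y\|_{\mathbb H,q}=(\mathbb E\|Y\|_H^q)^{1/q}$, respectively $\|Y\|_{S_2,q}=(\mathbb E|||Y|||_2^q)^{1/q}$. Let $(\epsilon_t)_{t\in\mathbb Z}$ be an i.i.d. sequence in a measurable space $S$, $(\epsilon'_t)_{t\in\mathbb Z}$ an independent copy of it, $g$ a measurable $H$-valued function, and $X_t=g(\epsilon_t,\epsilon_{t-1},\dots)$. Put $\mathcal G_t=\sigma(\epsilon_t,\epsilon_{t-1},\dots)$, $P_0=\mathbb E[\cdot\mid\mathcal G_0]-\mathbb E[\cdot\mid\mathcal G_{-1}]$, let $\mathcal G_{t,\{0\}}$ be the $\sigma$-algebra defined like $\mathcal G_t$ but with $\epsilon_0$ replaced by $\epsilon_0'$, and put $\nu_{\mathbb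 H,q}(X_t)=\|X_t-\mathbb E[X_t\mid\mathcal G_{t,\{0\}}]\|_{\mathbb H,q}$. Let $2\le p<\infty$ and suppose that $\mathbb E X_t=0$, $\mathbb E\|X_t\|_H^{2p}<\infty$ and $\sum_{j\ge0}\nu_{\mathbb H,2p}(X_j)<\infty$. Let $w:\mathbb R\to\mathbb R$ be even, bounded, continuous except at finitely many points, with $\lim_{x\to0}w(x)=w(0)=1$, such that $\kappa=\int_{-\infty}^{\infty}w^2(x)\,dx<\infty$, $\lim_{b\downarrow0}b\sum_{h\in\mathbb Z}w^2(bh)=\kappa$, and $\sup_{0<b\le1}b\sum_{|h|\ge M/b}w^2(bh)\to0$ as $M\to\infty$. Put $C_h=\mathbb E(X_h\otimes X_0)$, $$\mathcal F^\lambda=\frac1{2\pi}\sum_{h\in\mathbb Z}C_he^{-i\lambda h},\qquad \hat{\mathcal F}^\lambda_T=\frac1{2\pi T}\sum_{s,t=1}^T w(b_T(t-s))\,e^{i\lambda(t-s)}\,(X_s\otimes X_t).$$ Then $\sum_h|||C_h|||_2<\infty$, so that $\mathcal F^\lambda\in S_2(H)$ is well defined, and for every real sequence $(b_T)$ with $b_T\to0$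 and $b_TT\to\infty$ as $T\to\infty$: (i) $\sup_{\lambda\in[0,\pi]}\|\hat{\mathcal F}^\lambda_T-\mathcal F^\lambda\|^2_{S_2,p}\to0$. (ii) If, in addition, $\sum_{h\in\mathbb Z}h\|P_0(X_h)\|_{\mathbb H,2}<\infty$ and $|w(x)-1|=O(|x|)$ as $x\to0$, then $\|\hat{\mathcal F}^\lambda_T-\mathcal F^\lambda\|^2_{S_2,p}=O\big(\frac1{b_TT}+b_T^2\big)$ uniformly in $\lambda\in[0,\pi]$. -/

import Mathlib

open MeasureTheory ProbabilityTheory Filter Topology Set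
open scoped ENNReal

noncomputable section

namespace SpectralDensity

section HilbertSchmidt

variable {H : Type*} [NormedAddCommGroup H] [InnerProductSpace ℂ H] [CompleteSpace H]

/-- An index set and a choice of complete orthonormal system of `H`. -/
def onbIndex (H : Type*) [NormedAddCommGroup H] [InnerProductSpace ℂ H] [CompleteSpace H] :
    Set H :=
  (exists_hilbertBasis ℂ H).choose

/-- A fixed orthonormal basis of `H`. -/
def onb (H : Type*) [NormedAddCommGroup H] [InnerProductSpace ℂ H] [CompleteSpace H] :
    HilbertBasis (onbIndex H) ℂ H :=
  (exists_hilbertBasis ℂ H).choose_spec.choose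

/-- The Hilbert–Schmidt norm `(∑ᵢ ‖A eᵢ‖²)^(1/2)` of a bounded operator, with value `∞` if `A` is
not a Hilbert–Schmidt operator.  It does not depend on the orthonormal basis, see
`hsNorm_eq_of_hilbertBasis`. -/
def hsNorm (A : H →L[ℂ] H) : ℝ≥0∞ :=
  (∑' i, ‖A (onb H i)‖ₑ ^ 2) ^ (1 / 2 : ℝ)

theorem tsum_enorm_inner_sq {ι : Type*} (b : HilbertBasis ι ℂ H) (x : H) :
    ∑' i, ‖inner ℂ (b i) x‖ₑ ^ 2 = ‖x‖ₑ ^ 2 := by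
  have h := b.hasSum_inner_mul_inner x x
  have h2 : HasSum (fun i => ‖inner ℂ (b i) x‖ ^ 2) (‖x‖ ^ 2) := by
    have h3 := Complex.hasSum_re h
    convert h3 using 1
    · funext i
      rw [← inner_conj_symm x (b i), ← Complex.normSq_eq_conj_mul_self, Complex.ofReal_re,
        Complex.normSq_eq_norm_sq]
    · exact norm_sq_eq_re_inner (𝕜 := ℂ) x
  have h4 : ∀ i, ‖inner ℂ (b i) x‖ₑ ^ 2 = ENNReal.ofReal (‖inner ℂ (b i) x‖ ^ 2) := fun i => by
    rw [ENNReal.ofReal_pow (norm_nonneg _), ofReal_norm]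
  rw [tsum_congr h4, ← ENNReal.ofReal_tsum_of_nonneg (fun i => by positivity) h2.summable,
    h2.tsum_eq, ENNReal.ofReal_pow (norm_nonneg _), ofReal_norm]

theorem tsum_enorm_apply_sq {ι κ : Type*} (b : HilbertBasis ι ℂ H) (c : HilbertBasis κ ℂ H)
    (A : H →L[ℂ] H) :
    ∑' i, ‖A (b i)‖ₑ ^ 2 = ∑' j, ‖ContinuousLinearMap.adjoint A (c j)‖ₑ ^ 2 := by
  simp_rw [← tsum_enorm_inner_sq c (A _), ← tsum_enorm_inner_sq b (ContinuousLinearMap.adjoint A _)]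
  rw [ENNReal.tsum_comm]
  refine tsum_congr fun j => tsum_congr fun i => ?_
  rw [ContinuousLinearMap.adjoint_inner_right, ← inner_conj_symm, RCLike.enorm_conj]

theorem hsNorm_eq_of_hilbertBasis {ι : Type*} (b : HilbertBasis ι ℂ H) (A : H →L[ℂ] H) :
    hsNorm A = (∑' i, ‖A (b i)‖ₑ ^ 2) ^ (1 / 2 : ℝ) := by
  rw [hsNorm, tsum_enorm_apply_sq (onb H) (onb H) A, tsum_enorm_apply_sq b (onb H) A]

/-- The norm `‖Y‖_{S₂,p} = (E |||Y|||₂ ^ p)^(1/p)` of a random operator. -/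
def hsLpNorm {Ω : Type*} [MeasurableSpace Ω] (p : ℝ) (Y : Ω → H →L[ℂ] H) (P : Measure Ω) :
    ℝ≥0∞ :=
  (∫⁻ ω, hsNorm (Y ω) ^ p ∂P) ^ (1 / p)

end HilbertSchmidt

section TimeSeries

variable {Ω S H : Type*} [MeasurableSpace Ω] [MeasurableSpace S]
  [NormedAddCommGroup H] [InnerProductSpace ℂ H] [CompleteSpace H]

/-- `ε` is an i.i.d. sequence and `ε'` is an independent copy of it. -/
structure IsIIDWithCopy (ε ε' : ℤ → Ω → S) (P : Measure Ω) : Prop where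
  measurable : ∀ t, Measurable (ε t)
  measurable_copy : ∀ t, Measurable (ε' t)
  indep : iIndepFun ε P
  identDistrib : ∀ t, IdentDistrib (ε t) (ε 0) P P
  copy_law : IdentDistrib (fun ω t => ε' t ω) (fun ω t => ε t ω) P P
  copy_indep : IndepFun (fun ω t => ε t ω) (fun ω t => ε' t ω) P

/-- The causal process `X_t = g(ε_t, ε_{t-1}, …)`. -/
def causalProcess (g : (ℕ → S) → H) (ε : ℤ → Ω → S) (t : ℤ) (ω : Ω) : H :=
  g fun k => ε (t - k) ω

/-- The `σ`-algebra `σ(ε_t, ε_{t-1}, …)`. -/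
abbrev pastSigma (ε : ℤ → Ω → S) (t : ℤ) : MeasurableSpace Ω :=
  ⨆ s : ℤ, ⨆ _ : s ≤ t, MeasurableSpace.comap (ε s) inferInstance

open Classical in
/-- The innovations with those at times in `I` replaced by the independent copy. -/
def coupled (ε ε' : ℤ → Ω → S) (I : Set ℤ) (t : ℤ) : Ω → S :=
  if t ∈ I then ε' t else ε t

/-- The projection `P_k(Y) = E[Y | 𝒢_k] - E[Y | 𝒢_{k-1}]`, where `𝒢_k = σ(ε_k, ε_{k-1}, …)`. -/
def proj (ε : ℤ → Ω → S) (P : Measure Ω) (k : ℤ) (Y : Ω → H) : Ω → H :=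
  P[Y | pastSigma ε k] - P[Y | pastSigma ε (k - 1)]

/-- The physical dependence coefficient `ν_q(X_t) = ‖X_t - E[X_t | 𝒢_{t,{0}}]‖_q`. -/
def depCoeff (ε ε' : ℤ → Ω → S) (P : Measure Ω) (q : ℝ) (X : ℤ → Ω → H) (t : ℤ) : ℝ≥0∞ :=
  eLpNorm (X t - P[X t | pastSigma (coupled ε ε' {0}) t]) (ENNReal.ofReal q) P

/-- The process is centered, lies in `L^q`, and has summable dependence coefficients
`∑_{j ≥ 0} ν_q(X_j) < ∞`. -/
structure DependenceCondition (ε ε' : ℤ → Ω → S) (P : Measure Ω) (q : ℝ) (X : ℤ → Ω → H) :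
    Prop where
  memLp : ∀ t, MemLp (X t) (ENNReal.ofReal q) P
  centered : ∀ t, ∫ ω, X t ω ∂P = 0
  summable : ∑' j : ℕ, depCoeff ε ε' P q X j < ∞

/-- The lag-`h` covariance operator `C_h = E (X_h ⊗ X_0)` of a centered stationary process, where
`(f ⊗ g) v = ⟨v, g⟩ f`. -/
def lagCov (P : Measure Ω) (X : ℤ → Ω → H) (h : ℤ) : H →L[ℂ] H :=
  ∫ ω, InnerProductSpace.rankOne ℂ (X h ω) (X 0 ω) ∂P

/-- The spectral density operator `(2π)⁻¹ ∑_{h ∈ ℤ} C_h e^{-iλh}`. -/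
def specDensity (P : Measure Ω) (X : ℤ → Ω → H) (lam : ℝ) : H →L[ℂ] H :=
  (1 / (2 * Real.pi : ℂ)) • ∑' h : ℤ, Complex.exp (-(Complex.I * lam * h)) • lagCov P X h

/-- The lag-window estimator
`(2πT)⁻¹ ∑_{s,t=1}^T w(b (t-s)) e^{iλ(t-s)} (X_s ⊗ X_t)` with bandwidth `b`. -/
def lagWindowEst (w : ℝ → ℝ) (b : ℝ) (X : ℤ → Ω → H) (T : ℕ) (lam : ℝ) (ω : Ω) : H →L[ℂ] H :=
  (1 / (2 * Real.pi * T : ℂ)) • ∑ s ∈ Finset.Icc (1 : ℤ) T, ∑ t ∈ Finset.Icc (1 : ℤ) T,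
    ((w (b * ((t : ℝ) - s)) : ℂ) * Complex.exp (Complex.I * lam * ((t : ℂ) - s))) •
      InnerProductSpace.rankOne ℂ (X s ω) (X t ω)

end TimeSeries

/-- The assumptions on the lag window.  The value `w 0 = 1` says that `w` is continuous at `0`.
Sums of squares are taken in `[0, ∞]`, so that their finiteness is part of the assertions. -/
structure IsLagWindow (w : ℝ → ℝ) : Prop where
  even : ∀ x, w (-x) = w x
  bounded : ∃ B, ∀ x, |w x| ≤ B
  zero : w 0 = 1
  tendsto_one : Tendsto w (𝓝[≠] 0) (𝓝 1)
  finite_discont : {x | ¬ ContinuousAt w x}.Finite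
  sq_finite : ∫⁻ x, ENNReal.ofReal (w x ^ 2) < ∞
  riemann : Tendsto (fun b : ℝ => ENNReal.ofReal b * ∑' h : ℤ, ENNReal.ofReal (w (b * h) ^ 2))
    (𝓝[>] 0) (𝓝 (∫⁻ x, ENNReal.ofReal (w x ^ 2)))
  tail : Tendsto (fun M : ℝ => ⨆ b ∈ Ioc (0 : ℝ) 1,
      ENNReal.ofReal b * ∑' h : {h : ℤ // M / b ≤ |(h : ℝ)|}, ENNReal.ofReal (w (b * h) ^ 2))
    atTop (𝓝 0)

end SpectralDensity

end

set_option linter.unusedSectionVars false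

namespace SpectralDensity

/-! ### Couplings of i.i.d. sequences: splicing, resampling and shifting. -/

section Laws

variable {S : Type*} [MeasurableSpace S] {ι κ : Type*}

/-! The error is the sum of a centred random part, the estimator minus its mean, and a deterministic
bias. Two changes of setting come first. The process is transported to the law of one i.i.d.
sequence indexed by lag, where conditioning on the past `n` steps back means averaging out the first
`n` coordinates (`lagExp`, `IsIIDWithCopy.condExp_eq`). Hilbert–Schmidt operators are replaced by
the square summable families of their values on an orthonormal basis (`HSSpace`), so that they too
form a Hilbert space.

Random part. For `2 ≤ q < ∞` the space of `L^q` functions with values in a Hilbert space is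
2-smooth: adding an increment orthogonal to the duality map of `M` raises the squared norm by at
most a constant times the squared norm of the increment (`eLpNorm_add_sq_le`). Summed over
martingale differences, this yields an Efron–Stein type inequality (`eLpNorm_sub_integral_sq_le`):
the squared norm of `f - E f` is controlled by the squared effects of resampling single coordinates.
Let `Θ` be the sum of the resampling effects for `g`. With Schur's test, a linear form in the `X_i`
with coefficients `α_i` has squared `L^{2p}` norm at most a constant times `Θ² ∑ |α_i|²`. Resampling
one coordinate of a quadratic form changes it by sums of products of an increment and a linear form
along a row or a column. Hölder's inequality from two `L^{2p}` factors to `L^p` and Schur's test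
then bound the squared norm of the centred form by a constant times `Θ⁴ T ∑_h w²(bh)`
(`eLpNorm_quadForm_sub_integral_sq_le`). Division by `T²` leaves the order `1/(bT)`. Finally `Θ` is
at most twice the sum of the dependence coefficients (`IsIIDWithCopy.resampleDist_le`).

Bias. Expanding in martingale differences and using orthogonality gives `|||C_h|||₂ ≤ ∑_n ‖P_0
X_{n+|h|}‖ ‖P_0 X_n‖`, which is summable in `h`, also with weight `|h|` under the hypothesis of
(ii). The mean of the estimator carries the factor `w(bh)` times the proportion of pairs at lag `h`,
so the bias is at most `∑_h (|w(bh) - 1| + min(1, |h|/T)) |||C_h|||₂` (`norm_bias_le`). Dominated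
convergence gives (i), and a linear bound on `|w - 1|` gives (ii). The frequency enters only through
factors of modulus one, so every bound is uniform in it. -/

theorem measurePreserving_reindex (μ : Measure S) [IsProbabilityMeasure μ] {f : κ → ι}
    (hf : Function.Injective f) :
    MeasurePreserving (fun (x : ι → S) j => x (f j)) (Measure.infinitePi fun _ => μ)
      (Measure.infinitePi fun _ => μ) :=
  ⟨by fun_prop, Measure.map_infinitePi_infinitePi_of_inj hf⟩

theorem measurePreserving_sumElim (μ : Measure S) [IsProbabilityMeasure μ] :
    MeasurePreserving (fun z : (ι → S) × (κ → S) => (Sum.elim z.1 z.2 : ι ⊕ κ → S))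
      ((Measure.infinitePi fun _ => μ).prod (Measure.infinitePi fun _ => μ))
      (Measure.infinitePi fun _ => μ) := by
  have hm : Measurable (fun z : (ι → S) × (κ → S) => (Sum.elim z.1 z.2 : ι ⊕ κ → S)) := by
    refine measurable_pi_iff.2 ?_
    rintro (i | i)
    · exact (measurable_pi_apply i).comp measurable_fst
    · exact (measurable_pi_apply i).comp measurable_snd
  refine ⟨hm, Measure.eq_infinitePi _ fun s t ht => ?_⟩
  rw [Measure.map_apply hm (MeasurableSet.pi s.countable_toSet fun i _ => ht i)]
  have : (fun z : (ι → S) × (κ → S) => (Sum.elim z.1 z.2 : ι ⊕ κ → S)) ⁻¹' (Set.pi s t)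
      = (Set.pi s.toLeft fun i => t (Sum.inl i)) ×ˢ (Set.pi s.toRight fun i => t (Sum.inr i)) := by
    ext z
    simp only [mem_preimage, Set.mem_pi, mem_prod, Finset.mem_coe, Finset.mem_toLeft,
      Finset.mem_toRight, Sum.forall, Sum.elim_inl, Sum.elim_inr]
  rw [this, Measure.prod_prod, Measure.infinitePi_pi _ fun i _ => ht _,
    Measure.infinitePi_pi _ fun i _ => ht _]
  conv_rhs => rw [← Finset.toLeft_disjSum_toRight (u := s), Finset.prod_disjSum]

theorem measurePreserving_reindex_sum (μ : Measure S) [IsProbabilityMeasure μ] {ι' : Type*}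
    {e : ι' → ι ⊕ κ} (he : Function.Injective e) :
    MeasurePreserving (fun (z : (ι → S) × (κ → S)) j => (Sum.elim z.1 z.2 : ι ⊕ κ → S) (e j))
      ((Measure.infinitePi fun _ => μ).prod (Measure.infinitePi fun _ => μ))
      (Measure.infinitePi fun _ => μ) :=
  (measurePreserving_reindex μ he).comp (measurePreserving_sumElim μ)

/-- The sequence `x` with its first `n` terms replaced by those of `y`. -/
def splice (n : ℕ) (x y : ℕ → S) : ℕ → S := fun k => if k < n then y k else x k

/-- The sequence `x` with its term number `n` replaced by that of `y`. -/
def resample (n : ℕ) (z : (ℕ → S) × (ℕ → S)) : ℕ → S := fun k => if k = n then z.2 k else z.1 k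

/-- The sequence `x` without its first `n` terms. -/
def lagShift (n : ℕ) (x : ℕ → S) : ℕ → S := fun k => x (k + n)

@[simp] theorem splice_zero (x y : ℕ → S) : splice 0 x y = x := by
  funext k; simp [splice]

theorem splice_of_le {m n : ℕ} (h : n ≤ m) (x y z : ℕ → S) :
    splice m (splice n x y) z = splice m x z := by
  funext k; simp only [splice]; split_ifs <;> first | rfl | omega

theorem lagShift_splice (h n : ℕ) (x y : ℕ → S) :
    lagShift h (splice (n + h) x y) = splice n (lagShift h x) (lagShift h y) := by
  funext k; simp only [splice, lagShift, Nat.add_lt_add_iff_right]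

theorem lagShift_resample_of_lt {n h : ℕ} (hn : n < h) (z : (ℕ → S) × (ℕ → S)) :
    lagShift h (resample n z) = lagShift h z.1 := by
  funext k
  have : k + h ≠ n := by omega
  simp [lagShift, resample, this]

theorem lagShift_resample (n h : ℕ) (z : (ℕ → S) × (ℕ → S)) :
    lagShift h (resample (n + h) z) = resample n (Prod.map (lagShift h) (lagShift h) z) := by
  funext k; simp [lagShift, resample]

theorem measurable_splice (n : ℕ) :
    Measurable fun z : (ℕ → S) × (ℕ → S) => splice n z.1 z.2 := by
  refine measurable_pi_iff.2 fun k => ?_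
  by_cases hk : k < n
  · simp only [splice, hk, if_true]; fun_prop
  · simp only [splice, hk, if_false]; fun_prop

theorem measurable_resample (n : ℕ) :
    Measurable (resample n : (ℕ → S) × (ℕ → S) → ℕ → S) := by
  refine measurable_pi_iff.2 fun k => ?_
  by_cases hk : k = n
  · simp only [resample, hk, if_true]; fun_prop
  · simp only [resample, hk, if_false]; fun_prop

theorem measurable_lagShift (n : ℕ) : Measurable (lagShift n : (ℕ → S) → ℕ → S) :=
  measurable_pi_iff.2 fun _ => measurable_pi_apply _

variable (μ : Measure S) [IsProbabilityMeasure μ]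

/-- The law of an i.i.d. sequence with marginal law `μ`. -/
noncomputable abbrev seqLaw (μ : Measure S) [IsProbabilityMeasure μ] : Measure (ℕ → S) :=
  Measure.infinitePi fun _ => μ

theorem measurePreserving_lagShift (n : ℕ) :
    MeasurePreserving (lagShift n) (seqLaw μ) (seqLaw μ) :=
  measurePreserving_reindex μ (f := fun k => k + n) (add_left_injective n)

theorem measurePreserving_splice (n : ℕ) :
    MeasurePreserving (fun z : (ℕ → S) × (ℕ → S) => splice n z.1 z.2)
      ((seqLaw μ).prod (seqLaw μ)) (seqLaw μ) := by
  have he : Function.Injective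
      (fun k : ℕ => if k < n then (Sum.inr k : ℕ ⊕ ℕ) else Sum.inl k) := by
    intro a b h
    simp only at h
    split_ifs at h <;> simp_all
  convert measurePreserving_reindex_sum μ he using 1
  funext z k
  simp only [splice]
  split_ifs <;> rfl

theorem measurePreserving_resample (n : ℕ) :
    MeasurePreserving (resample n) ((seqLaw μ).prod (seqLaw μ)) (seqLaw μ) := by
  have he : Function.Injective
      (fun k : ℕ => if k = n then (Sum.inr k : ℕ ⊕ ℕ) else Sum.inl k) := by
    intro a b h
    simp only at h
    split_ifs at h <;> simp_all
  convert measurePreserving_reindex_sum μ he using 1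
  funext z k
  simp only [resample]
  split_ifs <;> rfl

/-- A sequence and its modification at time `n`, read off a sequence with one extra term. -/
def resamplePair (n : ℕ) (ξ : Option ℕ → S) : (ℕ → S) × (ℕ → S) :=
  (fun k => ξ (some k), fun k => if k = n then ξ none else ξ (some k))

theorem measurable_resamplePair (n : ℕ) :
    Measurable (resamplePair n : (Option ℕ → S) → (ℕ → S) × (ℕ → S)) := by
  refine Measurable.prodMk (measurable_pi_iff.2 fun k => measurable_pi_apply _)
    (measurable_pi_iff.2 fun k => ?_)
  split_ifs <;> exact measurable_pi_apply _

/-- Two pairs of sequences that differ in one coordinate have the same law as soon as both are read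
off an i.i.d. family with one spare term. This reduces each coupling below to the injectivity of an
index map. -/
theorem map_pair_eq {α β : Type*} [MeasurableSpace α] [MeasurableSpace β] {P : Measure α}
    {Q : Measure β} {u v : α → ℕ → S} {u' v' : β → ℕ → S} {n : ℕ}
    {ξ : α → Option ℕ → S} {ξ' : β → Option ℕ → S}
    (hξ : MeasurePreserving ξ P (Measure.infinitePi fun _ => μ))
    (hξ' : MeasurePreserving ξ' Q (Measure.infinitePi fun _ => μ))
    (h : ∀ a, (u a, v a) = resamplePair n (ξ a)) (h' : ∀ b, (u' b, v' b) = resamplePair n (ξ' b)) :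
    IdentDistrib (fun a => (u a, v a)) (fun b => (u' b, v' b)) P Q := by
  have e : (fun a => (u a, v a)) = resamplePair n ∘ ξ := funext h
  have e' : (fun b => (u' b, v' b)) = resamplePair n ∘ ξ' := funext h'
  have hm := measurable_resamplePair (S := S) n
  rw [e, e']
  refine ⟨(hm.comp hξ.measurable).aemeasurable, (hm.comp hξ'.measurable).aemeasurable, ?_⟩
  rw [← Measure.map_map hm hξ.measurable, ← Measure.map_map hm hξ'.measurable, hξ.map_eq,
    hξ'.map_eq]

theorem measurePreserving_option_resample (n : ℕ) :
    MeasurePreserving (fun (z : (ℕ → S) × (ℕ → S)) (j : Option ℕ) => j.elim (z.2 n) z.1)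
      ((seqLaw μ).prod (seqLaw μ)) (Measure.infinitePi fun _ => μ) := by
  have he : Function.Injective
      (fun j : Option ℕ => j.elim (Sum.inr n : ℕ ⊕ ℕ) Sum.inl) := by
    rintro (_ | a) (_ | b) h <;> simp_all
  convert measurePreserving_reindex_sum μ he using 1
  funext z k
  cases k <;> rfl

/-- The two splices agree except at coordinate `n`, where one carries `x n` and the other the
independent `y n`. This turns a martingale difference into the effect of resampling one coordinate.
-/
theorem identDistrib_splice_pair (n : ℕ) :
    IdentDistrib (fun z : (ℕ → S) × (ℕ → S) => (splice n z.1 z.2, splice (n + 1) z.1 z.2))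
      (fun z => (z.1, resample n z)) ((seqLaw μ).prod (seqLaw μ))
      ((seqLaw μ).prod (seqLaw μ)) := by
  have he : Function.Injective (fun j : Option ℕ => j.elim (Sum.inr n : ℕ ⊕ ℕ)
      fun k => if k < n then Sum.inr k else Sum.inl k) := by
    rintro (_ | a) (_ | b) h <;> simp only [Option.elim] at h <;> (try split_ifs at h) <;>
      simp_all
  refine map_pair_eq μ (n := n) (measurePreserving_reindex_sum μ he)
    (measurePreserving_option_resample μ n) (fun z => ?_) (fun z => ?_)
  · refine Prod.ext ?_ ?_ <;> funext k <;> simp only [resamplePair, splice, Option.elim] <;>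
      grind
  · refine Prod.ext ?_ ?_ <;> funext k <;> simp only [resamplePair, resample, Option.elim]
    grind

/-- Resampling at `n` leaves `z.2 (n + 1)` unused, so that term can serve as a second independent
value for coordinate `n`. Together with `identDistrib_resample_swap` this provides three
exchangeable versions of one coordinate. -/
theorem identDistrib_resample_succ (n : ℕ) :
    IdentDistrib (fun z : (ℕ → S) × (ℕ → S) => (z.1, fun k => if k = n then z.2 (n + 1) else z.1 k))
      (fun z => (z.1, resample n z)) ((seqLaw μ).prod (seqLaw μ))
      ((seqLaw μ).prod (seqLaw μ)) := by
  refine map_pair_eq μ (n := n) (measurePreserving_option_resample μ (n + 1))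
    (measurePreserving_option_resample μ n) (fun z => ?_) (fun z => ?_)
  · refine Prod.ext ?_ ?_ <;> funext k <;> simp only [resamplePair, Option.elim]
  · refine Prod.ext ?_ ?_ <;> funext k <;> simp only [resamplePair, resample, Option.elim]
    grind

theorem identDistrib_resample_swap (n : ℕ) :
    IdentDistrib (fun z : (ℕ → S) × (ℕ → S) =>
        ((fun k => if k = n then z.2 (n + 1) else z.1 k : ℕ → S), resample n z))
      (fun z => (z.1, resample n z)) ((seqLaw μ).prod (seqLaw μ))
      ((seqLaw μ).prod (seqLaw μ)) := by
  have he : Function.Injective (fun j : Option ℕ => j.elim (Sum.inr n : ℕ ⊕ ℕ)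
      fun k => if k = n then Sum.inr (n + 1) else Sum.inl k) := by
    rintro (_ | a) (_ | b) h <;> simp only [Option.elim] at h <;> (try split_ifs at h) <;>
      simp_all
  refine map_pair_eq μ (n := n) (measurePreserving_reindex_sum μ he)
    (measurePreserving_option_resample μ n) (fun z => ?_) (fun z => ?_)
  · refine Prod.ext ?_ ?_ <;> funext k <;> simp only [resamplePair, resample, Option.elim] <;>
      grind
  · refine Prod.ext ?_ ?_ <;> funext k <;> simp only [resamplePair, resample, Option.elim]
    grind

end Laws

/-! ### Two-smoothness of `L^q` norms with values in a Hilbert space. -/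

section Smoothness

variable {K : Type*} [NormedAddCommGroup K] [InnerProductSpace ℂ K]

/-- The constant in the second order expansion of the `q`-th power of the norm. -/
noncomputable def smoothConst (q : ℝ) : ℝ :=
  (q / 2 + 9 * (q / 2) ^ 2) + ((3 * (q / 2) + 1) ^ q + q * ((3 * (q / 2)) ^ (q - 2) * (3 * (q / 2))))

theorem smoothConst_nonneg {q : ℝ} (hq : 2 ≤ q) : 0 ≤ smoothConst q := by
  unfold smoothConst; positivity

/-- Put `r = q / 2`. If `‖x‖ < 3r‖y‖`, the left side and the inner product term are bounded by
multiples of `‖y‖ ^ q`. Otherwise `‖x + y‖² = ‖x‖² (1 + δ)` with `|rδ| ≤ 1`, and `(1 + δ) ^ r ≤ exp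
(rδ) ≤ 1 + rδ + (rδ)²`; the linear term produces the inner product and the rest is of order `‖y‖²`.
-/
theorem norm_add_rpow_le {q : ℝ} (hq : 2 ≤ q) (x y : K) :
    ‖x + y‖ ^ q ≤ ‖x‖ ^ q + q * (‖x‖ ^ (q - 2) * RCLike.re (inner ℂ x y)) +
      smoothConst q * (‖x‖ ^ (q - 2) * ‖y‖ ^ 2 + ‖y‖ ^ q) := by
  obtain ⟨r, hr⟩ : ∃ r, r = q / 2 := ⟨_, rfl⟩
  have hr1 : 1 ≤ r := by rw [hr]; linarith
  have hqr : q = 2 * r := by rw [hr]; ring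
  obtain ⟨a, ha⟩ : ∃ a, a = ‖x‖ := ⟨_, rfl⟩
  obtain ⟨b, hb⟩ : ∃ b, b = ‖y‖ := ⟨_, rfl⟩
  obtain ⟨s, hs⟩ : ∃ s, s = RCLike.re (inner ℂ x y) := ⟨_, rfl⟩
  have ha0 : 0 ≤ a := ha ▸ norm_nonneg x
  have hb0 : 0 ≤ b := hb ▸ norm_nonneg y
  have hsab : |s| ≤ a * b := by
    rw [hs, ha, hb]; exact (RCLike.abs_re_le_norm _).trans (norm_inner_le_norm x y)
  have hexp : ‖x + y‖ ^ 2 = a ^ 2 + 2 * s + b ^ 2 := by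
    rw [ha, hb, hs]; exact norm_add_sq (𝕜 := ℂ) x y
  have hle : ‖x + y‖ ≤ a + b := by rw [ha, hb]; exact norm_add_le x y
  have hn0 := norm_nonneg (x + y)
  rw [← ha, ← hb, ← hs]
  have hC : smoothConst q = (r + 9 * r ^ 2) + ((3 * r + 1) ^ q + q * ((3 * r) ^ (q - 2) * (3 * r))) := by
    rw [smoothConst, hr]
  rcases lt_or_ge a (3 * r * b) with hab | hab
  · have hbpos : 0 < b := by
      by_contra h
      have : b = 0 := le_antisymm (not_lt.1 h) hb0
      rw [this] at hab; simp at hab; linarith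
    have e1 : b ^ (q - 2) * b ^ 2 = b ^ q := by
      rw [← Real.rpow_natCast b 2, ← Real.rpow_add hbpos]; norm_num
    have h1 : ‖x + y‖ ^ q ≤ (3 * r + 1) ^ q * b ^ q := by
      rw [← Real.mul_rpow (by positivity) hb0]
      exact Real.rpow_le_rpow hn0 (by linarith) (by linarith)
    have h2 : -(a ^ (q - 2) * s) ≤ ((3 * r) ^ (q - 2) * (3 * r)) * b ^ q := by
      calc -(a ^ (q - 2) * s) ≤ a ^ (q - 2) * (a * b) := by
            rw [← mul_neg]
            exact mul_le_mul_of_nonneg_left ((neg_le_abs s).trans hsab) (by positivity)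
        _ ≤ (3 * r * b) ^ (q - 2) * (3 * r * b * b) := by
            gcongr
        _ = ((3 * r) ^ (q - 2) * (3 * r)) * b ^ q := by
            rw [Real.mul_rpow (by positivity) hb0, ← e1]; ring
    have h3 : 0 ≤ a ^ q := by positivity
    have h4 : 0 ≤ (r + 9 * r ^ 2) * b ^ q := by positivity
    have h5 : 0 ≤ smoothConst q * (a ^ (q - 2) * b ^ 2) :=
      mul_nonneg (smoothConst_nonneg hq) (by positivity)
    have h6 := mul_le_mul_of_nonneg_left h2 (by linarith : 0 ≤ q)
    rw [mul_add, hC] at *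
    nlinarith
  · rcases ha0.eq_or_lt with ha1 | hapos
    · have hb1 : b = 0 := by
        rw [← ha1] at hab
        by_contra h
        have : 0 < b := lt_of_le_of_ne hb0 (Ne.symm h)
        have : 0 < 3 * r * b := by positivity
        linarith
      have hs1 : s = 0 := by rw [hb1, mul_zero] at hsab; exact abs_nonpos_iff.1 hsab
      have : ‖x + y‖ = 0 := by rw [← ha1, hb1] at hle; linarith
      rw [this, hb1, hs1, ← ha1, Real.zero_rpow (by linarith)]
      simp
    obtain ⟨δ, hδ⟩ : ∃ δ, δ = (2 * s + b ^ 2) / a ^ 2 := ⟨_, rfl⟩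
    have hδa : a ^ 2 * δ = 2 * s + b ^ 2 := by rw [hδ]; field_simp
    have hab' : 3 * b ≤ a := by nlinarith
    have hδ1 : a * |δ| ≤ 3 * b := by
      have : a ^ 2 * |δ| ≤ a * (3 * b) := by
        have h0 : a ^ 2 * |δ| = |2 * s + b ^ 2| := by
          rw [← hδa, abs_mul, abs_of_pos (pow_pos hapos 2)]
        rw [h0]
        refine (abs_add_le _ _).trans ?_
        rw [abs_mul, abs_two, abs_of_nonneg (sq_nonneg b)]
        nlinarith
      nlinarith
    have hδr : |r * δ| ≤ 1 := by
      rw [abs_mul, abs_of_pos (by linarith)]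
      have : a * (r * |δ|) ≤ a * 1 := by nlinarith
      exact le_of_mul_le_mul_left this hapos
    have hδsq : a ^ 2 * δ ^ 2 ≤ 9 * b ^ 2 := by
      rw [← sq_abs δ, ← mul_pow]
      calc (a * |δ|) ^ 2 ≤ (3 * b) ^ 2 := by gcongr
        _ = 9 * b ^ 2 := by ring
    have h1δ : 0 ≤ 1 + δ := by
      have : a ^ 2 * (1 + δ) = ‖x + y‖ ^ 2 := by rw [hexp, mul_add, hδa]; ring
      by_contra h
      nlinarith [sq_nonneg ‖x + y‖, pow_pos hapos 2]
    have hmain : (1 + δ) ^ r ≤ 1 + r * δ + (r * δ) ^ 2 := by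
      calc (1 + δ) ^ r ≤ Real.exp δ ^ r :=
            Real.rpow_le_rpow h1δ (by linarith [Real.add_one_le_exp δ]) (by linarith)
        _ = Real.exp (r * δ) := by rw [← Real.exp_mul, mul_comm]
        _ ≤ _ := by
          have := Real.abs_exp_sub_one_sub_id_le hδr
          linarith [(abs_le.1 this).2]
    have haq : a ^ q = a ^ (q - 2) * a ^ 2 := by
      rw [← Real.rpow_natCast a 2, ← Real.rpow_add hapos]; norm_num
    have hpow : ‖x + y‖ ^ q = a ^ q * (1 + δ) ^ r := by
      have : ‖x + y‖ ^ 2 = a ^ 2 * (1 + δ) := by rw [hexp, mul_add, hδa]; ring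
      rw [hqr, Real.rpow_mul hn0, Real.rpow_two, this, Real.mul_rpow (by positivity) h1δ,
        ← Real.rpow_two, ← Real.rpow_mul ha0]
    rw [hpow]
    have h7 : a ^ q * (1 + δ) ^ r ≤ a ^ q * (1 + r * δ + (r * δ) ^ 2) :=
      mul_le_mul_of_nonneg_left hmain (by positivity)
    have h8 : a ^ q * (1 + r * δ + (r * δ) ^ 2) =
        a ^ q + a ^ (q - 2) * (r * (a ^ 2 * δ) + r ^ 2 * (a ^ 2 * δ ^ 2)) := by rw [haq]; ring
    have h9 : a ^ (q - 2) * (r * (a ^ 2 * δ) + r ^ 2 * (a ^ 2 * δ ^ 2)) ≤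
        a ^ (q - 2) * (r * (2 * s + b ^ 2) + r ^ 2 * (9 * b ^ 2)) := by
      rw [hδa]; gcongr
    have h10 : 0 ≤ smoothConst q * b ^ q := mul_nonneg (smoothConst_nonneg hq) (by positivity)
    have h11 : (r + 9 * r ^ 2) * (a ^ (q - 2) * b ^ 2) ≤ smoothConst q * (a ^ (q - 2) * b ^ 2) := by
      refine mul_le_mul_of_nonneg_right ?_ (by positivity)
      rw [hC]
      have : 0 ≤ (3 * r + 1) ^ q + q * ((3 * r) ^ (q - 2) * (3 * r)) := by positivity
      linarith
    rw [hqr] at *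
    nlinarith

/-- With `c = a + (2C + 1) b`, each of `a ^ (r-1)` and `b ^ (r-1)` is at most `c ^ (r-1)`, which
factors out. Taken at `a = A²`, `b = B²`, `r = q / 2`, this converts an estimate of `q`-th powers
into one of squares of norms. -/
theorem rpow_add_mul_le {a b r C : ℝ} (ha : 0 ≤ a) (hb : 0 ≤ b) (hr : 1 ≤ r) (hC : 0 ≤ C) :
    a ^ r + C * (a ^ (r - 1) * b + b ^ r) ≤ (a + (2 * C + 1) * b) ^ r := by
  rcases hb.eq_or_lt with rfl | hb'
  · simp [Real.zero_rpow (by linarith : r ≠ 0)]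
  have hc : 0 < a + (2 * C + 1) * b := by positivity
  have split : ∀ u : ℝ, 0 < u → u ^ r = u ^ (r - 1) * u := fun u hu => by
    rw [Real.rpow_sub_one hu.ne']; field_simp
  have h1 : a ^ (r - 1) ≤ (a + (2 * C + 1) * b) ^ (r - 1) :=
    Real.rpow_le_rpow ha (by nlinarith) (by linarith)
  have h2 : b ^ (r - 1) ≤ (a + (2 * C + 1) * b) ^ (r - 1) :=
    Real.rpow_le_rpow hb (by nlinarith) (by linarith)
  have h3 : a ^ r ≤ (a + (2 * C + 1) * b) ^ (r - 1) * a := by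
    rcases ha.eq_or_lt with rfl | ha'
    · simp [Real.zero_rpow (by linarith : r ≠ 0)]
    · rw [split a ha']; exact mul_le_mul_of_nonneg_right h1 ha
  rw [split _ hc, split _ hb']
  have h4 := mul_le_mul_of_nonneg_left (mul_le_mul_of_nonneg_right h1 hb) hC
  have h5 := mul_le_mul_of_nonneg_left (mul_le_mul_of_nonneg_right h2 hb) hC
  have h6 : 0 ≤ (a + (2 * C + 1) * b) ^ (r - 1) * b := by positivity
  nlinarith

theorem rpow_sub_two_mul_mul_le {u v c d q : ℝ} (hq : 2 ≤ q) (hu : 0 ≤ u) (hv : 0 ≤ v) (hc : 0 ≤ c)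
    (hd : 0 ≤ d) (hcm : c ≤ max u v) (hdm : d ≤ max u v) :
    u ^ (q - 2) * (c * d) ≤ u ^ q + v ^ q := by
  have hm : 0 ≤ max u v := le_max_of_le_left hu
  have h1 : u ^ (q - 2) * (c * d) ≤ max u v ^ (q - 2) * (max u v * max u v) := by
    gcongr
    · exact le_max_left u v
  refine h1.trans ?_
  have h2 : max u v ^ (q - 2) * (max u v * max u v) = max u v ^ q := by
    rcases hm.eq_or_lt with h | h
    · rw [← h, Real.zero_rpow (by linarith : q ≠ 0)]; simp
    · rw [← sq, ← Real.rpow_two, ← Real.rpow_add h]; norm_num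
  rw [h2]
  rcases max_cases u v with ⟨h, -⟩ | ⟨h, -⟩ <;> rw [h]
  · linarith [Real.rpow_nonneg hv q]
  · linarith [Real.rpow_nonneg hu q]

/-- The constant in the martingale moment inequality with exponent `q`. -/
noncomputable def martingaleConst (q : ℝ) : ℝ := 2 * (2 * smoothConst q) + 1

theorem martingaleConst_nonneg {q : ℝ} (hq : 2 ≤ q) : 0 ≤ martingaleConst q := by
  have := smoothConst_nonneg hq
  unfold martingaleConst; positivity

theorem integrable_rpow_mul_re_inner {Ω : Type*} [MeasurableSpace Ω] {P : Measure Ω} {q : ℝ}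
    (hq : 2 ≤ q) {M D : Ω → K} (hM : MemLp M (ENNReal.ofReal q) P)
    (hD : MemLp D (ENNReal.ofReal q) P) :
    Integrable (fun ω => ‖M ω‖ ^ (q - 2) * RCLike.re (inner ℂ (M ω) (D ω))) P := by
  have hq0 : ENNReal.ofReal q ≠ 0 := by simp; linarith
  have hqt : (ENNReal.ofReal q).toReal = q := ENNReal.toReal_ofReal (by linarith)
  have iM := hM.integrable_norm_rpow hq0 ENNReal.ofReal_ne_top
  have iD := hD.integrable_norm_rpow hq0 ENNReal.ofReal_ne_top
  rw [hqt] at iM iD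
  refine (iM.add iD).mono' ?_ (ae_of_all _ fun ω => ?_)
  · refine AEStronglyMeasurable.mul
      (hM.1.norm.aemeasurable.pow_const _).aestronglyMeasurable ?_
    exact RCLike.continuous_re.comp_aestronglyMeasurable (hM.1.inner hD.1)
  · rw [norm_mul, Real.norm_of_nonneg (by positivity), Real.norm_eq_abs]
    refine le_trans (mul_le_mul_of_nonneg_left ((RCLike.abs_re_le_norm _).trans
      (norm_inner_le_norm _ _)) (by positivity)) ?_
    exact rpow_sub_two_mul_mul_le hq (norm_nonneg _) (norm_nonneg _) (norm_nonneg _)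
      (norm_nonneg _) (le_max_left _ _) (le_max_right _ _)

/-- If the increment `D` is orthogonal to the duality map of `M`, then the square of the `L^q` norm
of `M + D` grows at most by a multiple of that of `D`. -/
theorem eLpNorm_add_sq_le {Ω : Type*} [MeasurableSpace Ω] {P : Measure Ω} {q : ℝ}
    (hq : 2 ≤ q) {M D : Ω → K} (hM : MemLp M (ENNReal.ofReal q) P)
    (hD : MemLp D (ENNReal.ofReal q) P)
    (horth : ∫ ω, ‖M ω‖ ^ (q - 2) * RCLike.re (inner ℂ (M ω) (D ω)) ∂P = 0) :
    eLpNorm (M + D) (ENNReal.ofReal q) P ^ 2 ≤ eLpNorm M (ENNReal.ofReal q) P ^ 2 +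
      ENNReal.ofReal (martingaleConst q) * eLpNorm D (ENNReal.ofReal q) P ^ 2 := by
  have hqpos : 0 < q := by linarith
  have hC := smoothConst_nonneg hq
  have hq0 : ENNReal.ofReal q ≠ 0 := by simp; linarith
  have hqt : (ENNReal.ofReal q).toReal = q := ENNReal.toReal_ofReal (by linarith)
  -- The norms `A` and `B` are divided by below, so the cases where one of them vanishes are settled
  -- first; when `M` vanishes, the claim needs the constant to be at least `1`.
  by_cases hM0 : eLpNorm M (ENNReal.ofReal q) P = 0
  · have : M =ᵐ[P] 0 := (eLpNorm_eq_zero_iff hM.1 hq0).1 hM0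
    have h2 : M + D =ᵐ[P] D := by filter_upwards [this] with ω h; simp [h]
    rw [hM0, eLpNorm_congr_ae h2]
    simp only [ne_eq, OfNat.ofNat_ne_zero, not_false_eq_true, zero_pow, zero_add]
    refine le_mul_of_one_le_left (by positivity) ?_
    rw [ENNReal.one_le_ofReal, martingaleConst]; linarith
  by_cases hD0 : eLpNorm D (ENNReal.ofReal q) P = 0
  · have : D =ᵐ[P] 0 := (eLpNorm_eq_zero_iff hD.1 hq0).1 hD0
    have h2 : M + D =ᵐ[P] M := by filter_upwards [this] with ω h; simp [h]
    rw [hD0, eLpNorm_congr_ae h2]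
    simp
  have iM := hM.integrable_norm_rpow hq0 ENNReal.ofReal_ne_top
  have iD := hD.integrable_norm_rpow hq0 ENNReal.ofReal_ne_top
  have iS := (hM.add hD).integrable_norm_rpow hq0 ENNReal.ofReal_ne_top
  have eM := hM.eLpNorm_eq_integral_rpow_norm hq0 ENNReal.ofReal_ne_top
  have eD := hD.eLpNorm_eq_integral_rpow_norm hq0 ENNReal.ofReal_ne_top
  have eS := (hM.add hD).eLpNorm_eq_integral_rpow_norm hq0 ENNReal.ofReal_ne_top
  rw [hqt] at iM iD iS eM eD eS
  set A := (∫ ω, ‖M ω‖ ^ q ∂P) ^ q⁻¹ with hA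
  set B := (∫ ω, ‖D ω‖ ^ q ∂P) ^ q⁻¹ with hB
  have hApos : 0 < A := by
    rw [eM] at hM0
    by_contra h; exact hM0 (ENNReal.ofReal_of_nonpos (not_lt.1 h))
  have hBpos : 0 < B := by
    rw [eD] at hD0
    by_contra h; exact hD0 (ENNReal.ofReal_of_nonpos (not_lt.1 h))
  have hAq : A ^ q = ∫ ω, ‖M ω‖ ^ q ∂P := by
    rw [hA, ← Real.rpow_mul (integral_nonneg fun ω => by positivity), inv_mul_cancel₀ hqpos.ne',
      Real.rpow_one]
  have hBq : B ^ q = ∫ ω, ‖D ω‖ ^ q ∂P := by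
    rw [hB, ← Real.rpow_mul (integral_nonneg fun ω => by positivity), inv_mul_cancel₀ hqpos.ne',
      Real.rpow_one]
  have imix : Integrable (fun ω => ‖M ω‖ ^ (q - 2) * ‖D ω‖ ^ 2) P := by
    refine (iM.add iD).mono' ?_ (ae_of_all _ fun ω => ?_)
    · exact ((hM.1.norm.aemeasurable.pow_const _).mul
        (hD.1.norm.aemeasurable.pow_const _)).aestronglyMeasurable
    · rw [Real.norm_of_nonneg (by positivity), sq]
      exact rpow_sub_two_mul_mul_le hq (norm_nonneg _) (norm_nonneg _) (norm_nonneg _)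
        (norm_nonneg _) (le_max_right _ _) (le_max_right _ _)
  -- A Hölder bound, obtained by scaling both functions to norm one and integrating a pointwise
  -- inequality; the price is the factor `2`.
  have hmix : ∫ ω, ‖M ω‖ ^ (q - 2) * ‖D ω‖ ^ 2 ∂P ≤ 2 * (A ^ (q - 2) * B ^ 2) := by
    have hpt : ∀ ω, ‖M ω‖ ^ (q - 2) * ‖D ω‖ ^ 2 ≤
        (A ^ (q - 2) * B ^ 2) * (‖M ω‖ ^ q / A ^ q + ‖D ω‖ ^ q / B ^ q) := fun ω => by
      have h := rpow_sub_two_mul_mul_le hq (u := ‖M ω‖ / A) (v := ‖D ω‖ / B) (c := ‖D ω‖ / B)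
        (d := ‖D ω‖ / B) (by positivity) (by positivity) (by positivity) (by positivity)
        (le_max_right _ _) (le_max_right _ _)
      rw [Real.div_rpow (norm_nonneg _) hApos.le, Real.div_rpow (norm_nonneg _) hApos.le,
        Real.div_rpow (norm_nonneg _) hBpos.le] at h
      have h' := mul_le_mul_of_nonneg_left h (by positivity : 0 ≤ A ^ (q - 2) * B ^ 2)
      refine le_trans (le_of_eq ?_) h'
      have : A ^ (q - 2) ≠ 0 := by positivity
      field_simp
    refine (integral_mono imix (((iM.div_const _).add (iD.div_const _)).const_mul _) hpt).trans ?_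
    have : ∫ ω, (A ^ (q - 2) * B ^ 2) * (‖M ω‖ ^ q / A ^ q + ‖D ω‖ ^ q / B ^ q) ∂P =
        (A ^ (q - 2) * B ^ 2) * (1 + 1) := by
      rw [integral_const_mul, integral_add (iM.div_const _) (iD.div_const _), integral_div,
        integral_div, ← hAq, ← hBq, div_self (by positivity), div_self (by positivity)]
    simp only [Pi.add_apply]
    rw [this]; linarith
  have hmain : ∫ ω, ‖(M + D) ω‖ ^ q ∂P ≤ (A ^ 2 + martingaleConst q * B ^ 2) ^ (q / 2) := by
    have i1 := integrable_rpow_mul_re_inner hq hM hD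
    calc ∫ ω, ‖(M + D) ω‖ ^ q ∂P
        ≤ ∫ ω, (‖M ω‖ ^ q + q * (‖M ω‖ ^ (q - 2) * RCLike.re (inner ℂ (M ω) (D ω)))) +
          smoothConst q * (‖M ω‖ ^ (q - 2) * ‖D ω‖ ^ 2 + ‖D ω‖ ^ q) ∂P :=
          integral_mono iS ((iM.add (i1.const_mul q)).add ((imix.add iD).const_mul _))
            fun ω => norm_add_rpow_le hq (M ω) (D ω)
      _ = A ^ q + smoothConst q * (∫ ω, ‖M ω‖ ^ (q - 2) * ‖D ω‖ ^ 2 ∂P + B ^ q) := by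
          have i2 : Integrable (fun ω => ‖M ω‖ ^ q +
              q * (‖M ω‖ ^ (q - 2) * RCLike.re (inner ℂ (M ω) (D ω)))) P :=
            iM.add (i1.const_mul q)
          have i3 : Integrable (fun ω => smoothConst q *
              (‖M ω‖ ^ (q - 2) * ‖D ω‖ ^ 2 + ‖D ω‖ ^ q)) P := (imix.add iD).const_mul _
          rw [integral_add i2 i3,
            integral_add iM (i1.const_mul q), integral_const_mul, horth, integral_const_mul,
            integral_add imix iD, ← hAq, ← hBq]
          ring
      _ ≤ A ^ q + (2 * smoothConst q) * (A ^ (q - 2) * B ^ 2 + B ^ q) := by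
          have := mul_le_mul_of_nonneg_left hmix hC
          have h2 : 0 ≤ smoothConst q * B ^ q := by positivity
          nlinarith
      _ = (A ^ 2) ^ (q / 2) + (2 * smoothConst q) *
          ((A ^ 2) ^ (q / 2 - 1) * B ^ 2 + (B ^ 2) ^ (q / 2)) := by
          rw [← Real.rpow_natCast A 2, ← Real.rpow_mul hApos.le, ← Real.rpow_mul hApos.le,
            ← Real.rpow_natCast B 2, ← Real.rpow_mul hBpos.le]
          have e1 : ((2 : ℕ) : ℝ) * (q / 2) = q := by push_cast; ring
          have e2 : ((2 : ℕ) : ℝ) * (q / 2 - 1) = q - 2 := by push_cast; ring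
          rw [e1, e2]
      _ ≤ _ := rpow_add_mul_le (by positivity) (by positivity) (by linarith) (by positivity)
  rw [eM, eD, eS, ← ENNReal.ofReal_pow hApos.le, ← ENNReal.ofReal_pow hBpos.le,
    ← ENNReal.ofReal_mul (martingaleConst_nonneg hq), ← ENNReal.ofReal_add (by positivity)
      (mul_nonneg (martingaleConst_nonneg hq) (by positivity)),
    ← ENNReal.ofReal_pow (Real.rpow_nonneg (integral_nonneg fun ω => by positivity) _)]
  refine ENNReal.ofReal_le_ofReal ?_
  have hpos : 0 ≤ A ^ 2 + martingaleConst q * B ^ 2 :=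
    add_nonneg (by positivity) (mul_nonneg (martingaleConst_nonneg hq) (by positivity))
  have hI : 0 ≤ ∫ ω, ‖(M + D) ω‖ ^ q ∂P := integral_nonneg fun ω => by positivity
  rw [← Real.rpow_natCast, ← Real.rpow_mul hI]
  calc (∫ ω, ‖(M + D) ω‖ ^ q ∂P) ^ (q⁻¹ * (2 : ℕ))
      ≤ ((A ^ 2 + martingaleConst q * B ^ 2) ^ (q / 2)) ^ (q⁻¹ * (2 : ℕ)) :=
        Real.rpow_le_rpow hI hmain (by positivity)
    _ = A ^ 2 + martingaleConst q * B ^ 2 := by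
        rw [← Real.rpow_mul hpos]
        have : q / 2 * (q⁻¹ * (2 : ℕ)) = 1 := by push_cast; field_simp
        rw [this, Real.rpow_one]

end Smoothness

/-! ### Conditional expectations as partial integrals over the most recent coordinates. -/

section LagExp

variable {S : Type*} [MeasurableSpace S] (μ : Measure S) [IsProbabilityMeasure μ]
  {K : Type*} [NormedAddCommGroup K]

theorem eLpNorm_comp_eq_of_identDistrib {α β γ : Type*} [MeasurableSpace α] [MeasurableSpace β]
    [MeasurableSpace γ] {P : Measure α} {Q : Measure β} {f : α → γ} {g : β → γ}
    (h : IdentDistrib f g P Q) {F : γ → K} (hF : StronglyMeasurable F) (q : ℝ≥0∞) :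
    eLpNorm (fun a => F (f a)) q P = eLpNorm (fun b => F (g b)) q Q := by
  have h1 := eLpNorm_map_measure (p := q) (μ := P) (f := f) (g := F) hF.aestronglyMeasurable
    h.aemeasurable_fst
  have h2 := eLpNorm_map_measure (p := q) (μ := Q) (f := g) (g := F) hF.aestronglyMeasurable
    h.aemeasurable_snd
  rw [h.map_eq] at h1
  exact h1.symm.trans h2

theorem integral_comp_of_measurePreserving [NormedSpace ℝ K] {α β : Type*} [MeasurableSpace α]
    [MeasurableSpace β] {P : Measure α} {Q : Measure β} {φ : α → β} (hφ : MeasurePreserving φ P Q)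
    {F : β → K} (hF : AEStronglyMeasurable F Q) : ∫ a, F (φ a) ∂P = ∫ b, F b ∂Q := by
  rw [← hφ.map_eq, integral_map hφ.aemeasurable (by rwa [hφ.map_eq])]

/-- Minkowski's (or Jensen's) inequality for partial expectations. -/
theorem eLpNorm_integral_prod_le [NormedSpace ℝ K] {α β : Type*} [MeasurableSpace α]
    [MeasurableSpace β] {ρ : Measure α} {ν : Measure β} [SFinite ρ] [IsProbabilityMeasure ν]
    {q : ℝ≥0∞} (hq : 1 ≤ q) (hqt : q ≠ ∞) {F : α × β → K} (hF : StronglyMeasurable F) :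
    eLpNorm (fun x => ∫ y, F (x, y) ∂ν) q ρ ≤ eLpNorm F q (ρ.prod ν) := by
  have hq0 : q ≠ 0 := (zero_lt_one.trans_le hq).ne'
  have hq1 : 1 ≤ q.toReal := by
    rw [← ENNReal.toReal_one]; exact ENNReal.toReal_mono hqt hq
  rw [eLpNorm_eq_lintegral_rpow_enorm_toReal hq0 hqt, eLpNorm_eq_lintegral_rpow_enorm_toReal hq0 hqt]
  refine ENNReal.rpow_le_rpow ?_ (by positivity)
  rw [lintegral_prod _ (hF.enorm.pow_const _).aemeasurable]
  refine lintegral_mono fun x => ?_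
  have hFx : AEStronglyMeasurable (fun y => F (x, y)) ν :=
    (hF.comp_measurable measurable_prodMk_left).aestronglyMeasurable
  have h := eLpNorm'_le_eLpNorm'_of_exponent_le zero_lt_one hq1 ν hFx
  simp only [eLpNorm'_eq_lintegral_enorm, ENNReal.rpow_one, div_one] at h
  calc ‖∫ y, F (x, y) ∂ν‖ₑ ^ q.toReal ≤ (∫⁻ y, ‖F (x, y)‖ₑ ∂ν) ^ q.toReal :=
        ENNReal.rpow_le_rpow (enorm_integral_le_lintegral_enorm _) (by positivity)
    _ ≤ ((∫⁻ y, ‖F (x, y)‖ₑ ^ q.toReal ∂ν) ^ (1 / q.toReal)) ^ q.toReal :=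
        ENNReal.rpow_le_rpow h (by positivity)
    _ = _ := by
        rw [← ENNReal.rpow_mul, one_div, inv_mul_cancel₀ (by positivity), ENNReal.rpow_one]

theorem enorm_integral_le_eLpNorm [NormedSpace ℝ K] {β : Type*}
    [MeasurableSpace β] {ν : Measure β} [IsProbabilityMeasure ν]
    {q : ℝ≥0∞} (hq : 1 ≤ q) {F : β → K} (hF : AEStronglyMeasurable F ν) :
    ‖∫ y, F y ∂ν‖ₑ ≤ eLpNorm F q ν := by
  refine (enorm_integral_le_lintegral_enorm _).trans ?_
  rw [← eLpNorm_one_eq_lintegral_enorm]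
  exact eLpNorm_le_eLpNorm_of_exponent_le hq hF

/-- The partial expectation over the first `n` coordinates. -/
noncomputable def lagExp [NormedSpace ℝ K] (n : ℕ) (f : (ℕ → S) → K) (x : ℕ → S) : K :=
  ∫ y, f (splice n x y) ∂seqLaw μ

variable {μ} [NormedSpace ℝ K] {f : (ℕ → S) → K} {q : ℝ≥0∞}

theorem stronglyMeasurable_comp_splice (hf : StronglyMeasurable f) (n : ℕ) :
    StronglyMeasurable fun z : (ℕ → S) × (ℕ → S) => f (splice n z.1 z.2) :=
  hf.comp_measurable (measurable_splice n)

theorem stronglyMeasurable_lagExp (hf : StronglyMeasurable f) (n : ℕ) :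
    StronglyMeasurable (lagExp μ n f) :=
  (stronglyMeasurable_comp_splice hf n).integral_prod_right'

theorem lagExp_zero [CompleteSpace K] : lagExp μ 0 f = f := by
  funext x; simp [lagExp]

theorem eLpNorm_lagExp_le (hq : 1 ≤ q) (hqt : q ≠ ∞) (hf : StronglyMeasurable f) (n : ℕ) :
    eLpNorm (lagExp μ n f) q (seqLaw μ) ≤ eLpNorm f q (seqLaw μ) := by
  refine (eLpNorm_integral_prod_le hq hqt (stronglyMeasurable_comp_splice hf n)).trans_eq ?_
  exact eLpNorm_comp_measurePreserving hf.aestronglyMeasurable (measurePreserving_splice μ n)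

theorem memLp_lagExp (hq : 1 ≤ q) (hqt : q ≠ ∞) (hf : StronglyMeasurable f)
    (hfq : MemLp f q (seqLaw μ)) (n : ℕ) : MemLp (lagExp μ n f) q (seqLaw μ) :=
  ⟨(stronglyMeasurable_lagExp hf n).aestronglyMeasurable,
    (eLpNorm_lagExp_le hq hqt hf n).trans_lt hfq.2⟩

theorem lagExp_splice {m n : ℕ} (h : n ≤ m) (x y : ℕ → S) :
    lagExp μ m f (splice n x y) = lagExp μ m f x := by
  simp only [lagExp, splice_of_le h]

theorem integrable_comp_splice (hf : Integrable f (seqLaw μ)) (n : ℕ) :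
    Integrable (fun z : (ℕ → S) × (ℕ → S) => f (splice n z.1 z.2))
      ((seqLaw μ).prod (seqLaw μ)) :=
  (measurePreserving_splice μ n).integrable_comp_of_integrable hf

theorem ae_integrable_splice (hf : Integrable f (seqLaw μ)) (n : ℕ) :
    ∀ᵐ x ∂seqLaw μ, Integrable (fun y => f (splice n x y)) (seqLaw μ) :=
  (integrable_comp_splice hf n).prod_right_ae

theorem integral_lagExp (hf : Integrable f (seqLaw μ)) (n : ℕ) :
    ∫ x, lagExp μ n f x ∂seqLaw μ = ∫ x, f x ∂seqLaw μ := by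
  rw [← integral_comp_of_measurePreserving (measurePreserving_splice μ n) hf.1,
    integral_prod _ (integrable_comp_splice hf n)]
  rfl

theorem splice_splice_of_le {m n : ℕ} (h : n ≤ m) (x y z : ℕ → S) :
    splice n (splice m x y) z = splice m x (splice n y z) := by
  funext k; simp only [splice]; split_ifs <;> first | rfl | omega

/-- The tower property: averaging over `m ≥ n` coordinates absorbs a previous averaging over `n`,
because the two splices commute. It holds only almost everywhere, since the sections of `f` need not
all be integrable. -/
theorem lagExp_lagExp {m n : ℕ} (h : n ≤ m) (hf : Integrable f (seqLaw μ)) :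
    lagExp μ m (lagExp μ n f) =ᵐ[seqLaw μ] lagExp μ m f := by
  filter_upwards [ae_integrable_splice hf m] with x hx
  have h1 : ∀ y, lagExp μ n f (splice m x y) =
      lagExp μ n (fun z => f (splice m x z)) y := fun y => by
    simp only [lagExp, splice_splice_of_le h]
  change ∫ y, lagExp μ n f (splice m x y) ∂seqLaw μ = _
  simp_rw [h1]
  exact integral_lagExp hx n

theorem lagExp_sub (hf : Integrable f (seqLaw μ)) {g : (ℕ → S) → K}
    (hg : Integrable g (seqLaw μ)) (n : ℕ) :
    lagExp μ n (f - g) =ᵐ[seqLaw μ] lagExp μ n f - lagExp μ n g := by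
  filter_upwards [ae_integrable_splice hf n, ae_integrable_splice hg n] with x h1 h2
  simp only [lagExp, Pi.sub_apply]
  exact integral_sub h1 h2

/-- The martingale difference `E[f | 𝒢_{-n}] - E[f | 𝒢_{-n-1}]`. -/
noncomputable def lagDiff (μ : Measure S) [IsProbabilityMeasure μ] (n : ℕ) (f : (ℕ → S) → K) :
    (ℕ → S) → K :=
  lagExp μ n f - lagExp μ (n + 1) f

theorem stronglyMeasurable_lagDiff (hf : StronglyMeasurable f) (n : ℕ) :
    StronglyMeasurable (lagDiff μ n f) :=
  (stronglyMeasurable_lagExp hf n).sub (stronglyMeasurable_lagExp hf (n + 1))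

theorem memLp_lagDiff (hq : 1 ≤ q) (hqt : q ≠ ∞) (hf : StronglyMeasurable f)
    (hfq : MemLp f q (seqLaw μ)) (n : ℕ) : MemLp (lagDiff μ n f) q (seqLaw μ) :=
  (memLp_lagExp hq hqt hf hfq n).sub (memLp_lagExp hq hqt hf hfq (n + 1))

theorem integrable_lagExp (hf : StronglyMeasurable f) (hfi : Integrable f (seqLaw μ)) (n : ℕ) :
    Integrable (lagExp μ n f) (seqLaw μ) :=
  memLp_one_iff_integrable.1
    (memLp_lagExp le_rfl ENNReal.one_ne_top hf (memLp_one_iff_integrable.2 hfi) n)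

theorem lagDiff_splice (n : ℕ) (x y : ℕ → S) : lagDiff μ n f (splice n x y) = lagDiff μ n f x := by
  simp only [lagDiff, Pi.sub_apply, lagExp_splice le_rfl, lagExp_splice (Nat.le_succ n)]

theorem lagExp_succ_lagDiff (hf : StronglyMeasurable f) (hfi : Integrable f (seqLaw μ)) (n : ℕ) :
    lagExp μ (n + 1) (lagDiff μ n f) =ᵐ[seqLaw μ] 0 := by
  have h1 := lagExp_sub (integrable_lagExp hf hfi n) (integrable_lagExp hf hfi (n + 1)) (n + 1)
  filter_upwards [h1, lagExp_lagExp (Nat.le_succ n) hfi, lagExp_lagExp (le_refl (n + 1)) hfi]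
    with x h1 h2 h3
  simp only [lagDiff]
  rw [h1, Pi.sub_apply, h2, h3, sub_self, Pi.zero_apply]

/-- The difference is the partial integral of `f (splice n x y) - f (splice (n + 1) x y)`.
Minkowski's inequality removes the integral, and the coupling of the two splices identifies what
remains. -/
theorem eLpNorm_lagDiff_le (hq : 1 ≤ q) (hqt : q ≠ ∞) (hf : StronglyMeasurable f)
    (hfq : MemLp f q (seqLaw μ)) (n : ℕ) :
    eLpNorm (lagDiff μ n f) q (seqLaw μ) ≤
      eLpNorm (fun z => f z.1 - f (resample n z)) q ((seqLaw μ).prod (seqLaw μ)) := by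
  have hfi : Integrable f (seqLaw μ) := hfq.integrable hq
  have h1 : lagDiff μ n f =ᵐ[seqLaw μ]
      fun x => ∫ y, (f (splice n x y) - f (splice (n + 1) x y)) ∂seqLaw μ := by
    filter_upwards [ae_integrable_splice hfi n, ae_integrable_splice hfi (n + 1)] with x h1 h2
    rw [integral_sub h1 h2]; rfl
  rw [eLpNorm_congr_ae h1]
  refine (eLpNorm_integral_prod_le hq hqt ((stronglyMeasurable_comp_splice hf n).sub
    (stronglyMeasurable_comp_splice hf (n + 1)))).trans_eq ?_
  exact eLpNorm_comp_eq_of_identDistrib (identDistrib_splice_pair μ n)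
    (F := fun z => f z.1 - f z.2)
    ((hf.comp_measurable measurable_fst).sub (hf.comp_measurable measurable_snd)) q

theorem measureDense_measurableCylinders :
    (seqLaw μ).MeasureDense (measurableCylinders fun _ : ℕ => S) :=
  Measure.MeasureDense.of_generateFrom_isSetAlgebra_finite _
    ⟨empty_mem_measurableCylinders _, fun _ h => compl_mem_measurableCylinders h,
      fun _ _ h h' => union_mem_measurableCylinders h h'⟩ generateFrom_measurableCylinders.symm

/-- Functions of finitely many coordinates are dense in `L^q`. -/
theorem exists_dependsOn_eLpNorm_sub_le (hqt : q ≠ ∞) (hfq : MemLp f q (seqLaw μ)) {η : ℝ≥0∞}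
    (hη : η ≠ 0) :
    ∃ h : (ℕ → S) → K, eLpNorm (f - h) q (seqLaw μ) ≤ η ∧ StronglyMeasurable h ∧
      MemLp h q (seqLaw μ) ∧ ∃ N : ℕ, DependsOn h (Set.Iio N) := by
  refine MemLp.induction_dense hqt (fun h => StronglyMeasurable h ∧
      MemLp h q (seqLaw μ) ∧ ∃ N : ℕ, DependsOn h (Set.Iio N)) ?_ ?_
      (fun g hg => hg.1.aestronglyMeasurable) hfq hη
  -- Measurable sets are approximated by cylinders in measure, hence their indicators in `L^q`. The
  -- base of the cylinder lies strictly below its supremum plus one.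
  · intro c s hs _ ε hε
    obtain ⟨δ, hδ, hδ'⟩ := exists_eLpNorm_indicator_le (μ := seqLaw μ) hqt c hε
    obtain ⟨t, ht, hst⟩ := (measureDense_measurableCylinders (μ := μ)).approx s hs
      (measure_ne_top _ _) δ hδ
    have htm := MeasurableSet.of_mem_measurableCylinders ht
    obtain ⟨I, A, hA, rfl⟩ := (mem_measurableCylinders t).1 ht
    refine ⟨(cylinder I A).indicator fun _ => c, ?_, stronglyMeasurable_const.indicator htm,
      memLp_indicator_const _ htm _ (Or.inr (measure_ne_top _ _)), I.sup id + 1, ?_⟩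
    · rw [eLpNorm_indicator_sub_indicator, symmDiff_comm]
      refine hδ' _ (hst.le.trans ?_)
      simp
    · intro x y hxy
      refine dependsOn_cylinder_indicator_const A c fun i hi => hxy i ?_
      exact Nat.lt_succ_of_le (Finset.le_sup (f := id) hi)
  · rintro f g ⟨hf1, hf2, N, hN⟩ ⟨hg1, hg2, M, hM⟩
    refine ⟨hf1.add hg1, hf2.add hg2, max N M, fun x y hxy => ?_⟩
    simp only [Pi.add_apply]
    rw [hN fun i hi => hxy i (mem_Iio.2 (lt_max_of_lt_left (mem_Iio.1 hi))),
      hM fun i hi => hxy i (mem_Iio.2 (lt_max_of_lt_right (mem_Iio.1 hi)))]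

theorem lagExp_of_dependsOn {N : ℕ} (h : DependsOn f (Set.Iio N)) (x : ℕ → S) :
    lagExp μ N f x = ∫ y, f y ∂seqLaw μ := by
  refine integral_congr_ae (ae_of_all _ fun y => h fun i hi => ?_)
  simp only [splice, Set.mem_Iio.1 hi, if_true]

/-- Backward martingale convergence together with the zero–one law, by approximation: for a function
of the first `N` coordinates `lagExp` is constant from `N` on, and `lagExp` contracts `L^q`, so each
of the two errors costs at most `η / 2`. -/
theorem eLpNorm_lagExp_sub_integral_le (hq : 1 ≤ q) (hqt : q ≠ ∞) (hf : StronglyMeasurable f)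
    (hfq : MemLp f q (seqLaw μ)) {η : ℝ≥0∞} (hη : η ≠ 0) :
    ∃ N : ℕ, ∀ n ≥ N,
      eLpNorm (fun x => lagExp μ n f x - ∫ y, f y ∂seqLaw μ) q (seqLaw μ) ≤ η := by
  obtain ⟨h, hle, hm, hhq, N, hN⟩ := exists_dependsOn_eLpNorm_sub_le hqt hfq
    (ENNReal.half_pos hη).ne'
  refine ⟨N, fun n hn => ?_⟩
  have hfi := hfq.integrable hq
  have hhi := hhq.integrable hq
  have hN' : DependsOn h (Set.Iio n) := fun x y hxy => hN fun i hi => hxy i (lt_of_lt_of_le hi hn)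
  have h1 : (fun x => lagExp μ n f x - ∫ y, f y ∂seqLaw μ) =ᵐ[seqLaw μ]
      lagExp μ n (f - h) - fun _ => ∫ y, (f - h) y ∂seqLaw μ := by
    filter_upwards [lagExp_sub hfi hhi n] with x hx
    simp only [Pi.sub_apply] at hx ⊢
    rw [hx, lagExp_of_dependsOn hN', integral_sub hfi hhi]
    abel
  rw [eLpNorm_congr_ae h1]
  refine (eLpNorm_sub_le (stronglyMeasurable_lagExp (hf.sub hm) n).aestronglyMeasurable
    aestronglyMeasurable_const hq).trans ?_
  rw [← ENNReal.add_halves η]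
  refine add_le_add ((eLpNorm_lagExp_le hq hqt (hf.sub hm) n).trans hle) ?_
  rw [eLpNorm_const _ (zero_lt_one.trans_le hq).ne' (NeZero.ne _)]
  simp only [measure_univ, ENNReal.one_rpow, mul_one]
  exact (enorm_integral_le_eLpNorm hq (hf.sub hm).aestronglyMeasurable).trans hle

end LagExp

/-! ### An Efron–Stein type moment inequality. -/

section MomentInequality

variable {S : Type*} [MeasurableSpace S] {μ : Measure S} [IsProbabilityMeasure μ]
  {K : Type*} [NormedAddCommGroup K] [InnerProductSpace ℂ K] [CompleteSpace K]

/-- As `M` does not depend on the first `m` coordinates, it leaves the partial integral over them,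
and the partial integral of `D` vanishes. -/
theorem integral_rpow_mul_re_inner_eq_zero {q : ℝ} (hq : 2 ≤ q) {M D : (ℕ → S) → K} {m : ℕ}
    (hM : MemLp M (ENNReal.ofReal q) (seqLaw μ)) (hD : MemLp D (ENNReal.ofReal q) (seqLaw μ))
    (hMm : ∀ x y, M (splice m x y) = M x) (hD0 : lagExp μ m D =ᵐ[seqLaw μ] 0) :
    ∫ x, ‖M x‖ ^ (q - 2) * RCLike.re (inner ℂ (M x) (D x)) ∂seqLaw μ = 0 := by
  have hDi : Integrable D (seqLaw μ) :=
    hD.integrable (by rw [ENNReal.one_le_ofReal]; linarith)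
  rw [← integral_lagExp (integrable_rpow_mul_re_inner hq hM hD) m]
  refine integral_eq_zero_of_ae ?_
  filter_upwards [hD0, ae_integrable_splice hDi m] with x hx hxi
  simp only [lagExp, hMm]
  rw [integral_const_mul, integral_re (𝕜 := ℂ) (hxi.const_inner (M x)),
    integral_inner hxi]
  rw [show ∫ y, D (splice m x y) ∂seqLaw μ = 0 from hx]
  simp

/-- A moment inequality for functions of independent variables in a Hilbert space. -/
theorem eLpNorm_sub_integral_sq_le {q : ℝ} (hq : 2 ≤ q) {f : (ℕ → S) → K}
    (hf : StronglyMeasurable f) (hfq : MemLp f (ENNReal.ofReal q) (seqLaw μ)) :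
    eLpNorm (fun x => f x - ∫ y, f y ∂seqLaw μ) (ENNReal.ofReal q) (seqLaw μ) ^ 2 ≤
      ENNReal.ofReal (martingaleConst q) * ∑' n, eLpNorm (fun z => f z.1 - f (resample n z))
        (ENNReal.ofReal q) ((seqLaw μ).prod (seqLaw μ)) ^ 2 := by
  set Q := ENNReal.ofReal q with hQ
  have hQ1 : 1 ≤ Q := by rw [hQ, ENNReal.one_le_ofReal]; linarith
  have hQt : Q ≠ ∞ := ENNReal.ofReal_ne_top
  set c := ∫ y, f y ∂seqLaw μ with hc
  set R := ENNReal.ofReal (martingaleConst q) * ∑' n, eLpNorm (fun z => f z.1 - f (resample n z))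
        Q ((seqLaw μ).prod (seqLaw μ)) ^ 2 with hR
  -- Here `lagExp n` plays the role of `M + D`, with `M` the centred `lagExp (n + 1)` and `D` the
  -- martingale difference `lagDiff n`.
  have step : ∀ n, eLpNorm (fun x => lagExp μ n f x - c) Q (seqLaw μ) ^ 2 ≤
      eLpNorm (fun x => lagExp μ (n + 1) f x - c) Q (seqLaw μ) ^ 2 +
        ENNReal.ofReal (martingaleConst q) * eLpNorm (lagDiff μ n f) Q (seqLaw μ) ^ 2 := fun n => by
    have hM : MemLp (fun x => lagExp μ (n + 1) f x - c) Q (seqLaw μ) :=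
      (memLp_lagExp hQ1 hQt hf hfq (n + 1)).sub (memLp_const c)
    have hD := memLp_lagDiff hQ1 hQt hf hfq n
    have h := eLpNorm_add_sq_le hq hM hD
      (integral_rpow_mul_re_inner_eq_zero hq (m := n + 1) hM hD
        (fun x y => by rw [lagExp_splice le_rfl])
        (lagExp_succ_lagDiff hf (hfq.integrable hQ1) n))
    have e : (fun x => lagExp μ n f x - c) =
        (fun x => lagExp μ (n + 1) f x - c) + lagDiff μ n f := by
      funext x; simp only [lagDiff, Pi.add_apply, Pi.sub_apply]; abel
    rw [e]; exact h
  have iter : ∀ N, eLpNorm (fun x => f x - c) Q (seqLaw μ) ^ 2 ≤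
      eLpNorm (fun x => lagExp μ N f x - c) Q (seqLaw μ) ^ 2 +
        ENNReal.ofReal (martingaleConst q) *
          ∑ n ∈ Finset.range N, eLpNorm (lagDiff μ n f) Q (seqLaw μ) ^ 2 := fun N => by
    induction N with
    | zero => simp [lagExp_zero]
    | succ N ih =>
      refine ih.trans ((add_le_add_left (step N) _).trans_eq ?_)
      rw [Finset.sum_range_succ, mul_add, add_assoc]
      congr 1
      exact add_comm _ _
  have bound : ∀ N, eLpNorm (fun x => f x - c) Q (seqLaw μ) ^ 2 ≤
      eLpNorm (fun x => lagExp μ N f x - c) Q (seqLaw μ) ^ 2 + R := fun N => by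
    refine (iter N).trans (add_le_add_right (mul_le_mul_right ?_ _) _)
    refine (Finset.sum_le_sum fun n _ => ?_).trans (ENNReal.sum_le_tsum (Finset.range N))
    exact pow_le_pow_left' (eLpNorm_lagDiff_le hQ1 hQt hf hfq n) 2
  have lim : ∀ η : NNReal, 0 < η → eLpNorm (fun x => f x - c) Q (seqLaw μ) ^ 2 ≤
      R + (η : ℝ≥0∞) := fun η hη => by
    -- The remainder enters squared, so its norm is made smaller than the square root of `η`.
    set δ : ℝ≥0∞ := ((NNReal.sqrt η : NNReal) : ℝ≥0∞)
    have hδ : δ ≠ 0 := by simpa [δ] using hη.ne'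
    obtain ⟨N, hN⟩ := eLpNorm_lagExp_sub_integral_le hQ1 hQt hf hfq hδ
    refine (bound N).trans ?_
    rw [add_comm]
    refine add_le_add_right ((pow_le_pow_left' (hN N le_rfl) 2).trans_eq ?_) _
    simp only [δ, ← ENNReal.coe_pow, NNReal.sq_sqrt]
  exact ENNReal.le_of_forall_pos_le_add fun η hη _ => lim η hη

end MomentInequality

/-! ### Schur's test. -/

section Schur

/-- The Cauchy–Schwarz inequality with respect to the weights `d i`. -/
theorem sum_mul_sq_le {ι : Type*} (s : Finset ι) (α d : ι → ℝ≥0∞) :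
    (∑ i ∈ s, α i * d i) ^ 2 ≤ (∑ i ∈ s, d i) * ∑ i ∈ s, α i ^ 2 * d i := by
  have h := ENNReal.inner_le_weight_mul_Lp_of_nonneg s (p := 2) (by norm_num) d α
  have e : (1 : ℝ) - 2⁻¹ = 2⁻¹ := by norm_num
  rw [e] at h
  have h2 := pow_le_pow_left' h 2
  rw [mul_pow, ← ENNReal.rpow_natCast, ← ENNReal.rpow_natCast (_ ^ _), ← ENNReal.rpow_natCast (_ ^ _),
    ← ENNReal.rpow_mul, ← ENNReal.rpow_mul] at h2
  norm_num at h2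
  calc (∑ i ∈ s, α i * d i) ^ 2 = (∑ i ∈ s, d i * α i) ^ 2 := by simp_rw [mul_comm]
    _ ≤ _ := h2
    _ = _ := by simp_rw [mul_comm (d _)]

/-- Schur's test for nonnegative kernels. -/
theorem tsum_sum_mul_sq_le {ι κ : Type*} (s : Finset ι) (α : ι → ℝ≥0∞) (d : κ → ι → ℝ≥0∞)
    {Θ : ℝ≥0∞} (h1 : ∀ n, ∑ i ∈ s, d n i ≤ Θ) (h2 : ∀ i, ∑' n, d n i ≤ Θ) :
    ∑' n, (∑ i ∈ s, α i * d n i) ^ 2 ≤ Θ ^ 2 * ∑ i ∈ s, α i ^ 2 :=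
  calc ∑' n, (∑ i ∈ s, α i * d n i) ^ 2 ≤ ∑' n, Θ * ∑ i ∈ s, α i ^ 2 * d n i :=
        ENNReal.tsum_le_tsum fun n => (sum_mul_sq_le s α (d n)).trans (mul_le_mul_left (h1 n) _)
    _ = Θ * ∑ i ∈ s, α i ^ 2 * ∑' n, d n i := by
        rw [ENNReal.tsum_mul_left, Summable.tsum_finsetSum fun _ _ => ENNReal.summable]
        simp_rw [ENNReal.tsum_mul_left]
    _ ≤ Θ * ∑ i ∈ s, α i ^ 2 * Θ := by
        gcongr with i
        exact h2 i
    _ = Θ ^ 2 * ∑ i ∈ s, α i ^ 2 := by rw [← Finset.sum_mul]; ring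

end Schur

/-! ### Moment bounds for linear and quadratic forms of the process. -/

section Forms

variable {S : Type*} [MeasurableSpace S] {μ : Measure S} [IsProbabilityMeasure μ]
  {H : Type*} [NormedAddCommGroup H] [InnerProductSpace ℂ H] [CompleteSpace H]
  {K : Type*} [NormedAddCommGroup K] [InnerProductSpace ℂ K] [CompleteSpace K]

/-- The `L^q` distance between `g` and its version with the coordinate number `m` resampled. -/
noncomputable def resampleDist (μ : Measure S) [IsProbabilityMeasure μ] (g : (ℕ → S) → H)
    (q : ℝ≥0∞) (m : ℕ) : ℝ≥0∞ :=
  eLpNorm (fun z => g z.1 - g (resample m z)) q ((seqLaw μ).prod (seqLaw μ))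

theorem resampleDist_lagShift_of_lt (g : (ℕ → S) → H) (q : ℝ≥0∞) {n i : ℕ} (h : n < i) :
    resampleDist μ (fun x => g (lagShift i x)) q n = 0 := by
  simp [resampleDist, lagShift_resample_of_lt h]

theorem resampleDist_lagShift {g : (ℕ → S) → H} (hg : StronglyMeasurable g) (q : ℝ≥0∞) (m i : ℕ) :
    resampleDist μ (fun x => g (lagShift i x)) q (m + i) = resampleDist μ g q m := by
  have hmp := (measurePreserving_lagShift μ i).prod (measurePreserving_lagShift μ i)
  have hsm : StronglyMeasurable fun z : (ℕ → S) × (ℕ → S) => g z.1 - g (resample m z) :=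
    (hg.comp_measurable measurable_fst).sub (hg.comp_measurable (measurable_resample m))
  rw [resampleDist, resampleDist,
    ← eLpNorm_comp_measurePreserving hsm.aestronglyMeasurable hmp]
  congr 1
  funext z
  simp [lagShift_resample]

theorem tsum_resampleDist_lagShift {g : (ℕ → S) → H} (hg : StronglyMeasurable g) (q : ℝ≥0∞)
    (i : ℕ) :
    ∑' n, resampleDist μ (fun x => g (lagShift i x)) q n = ∑' m, resampleDist μ g q m := by
  rw [← Summable.sum_add_tsum_nat_add' (k := i) ENNReal.summable]
  simp_rw [resampleDist_lagShift hg]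
  rw [Finset.sum_eq_zero fun n hn => resampleDist_lagShift_of_lt g q (Finset.mem_range.1 hn),
    zero_add]

/-- Coordinate `n` sits at position `n - i` of the sequence shifted by `i`, so every resampling
distance of `g` occurs at most once in the sum. This is the row condition in Schur's test;
`tsum_resampleDist_lagShift` is the column condition. -/
theorem sum_resampleDist_lagShift_le {g : (ℕ → S) → H} (hg : StronglyMeasurable g) (q : ℝ≥0∞)
    (s : Finset ℕ) (n : ℕ) :
    ∑ i ∈ s, resampleDist μ (fun x => g (lagShift i x)) q n ≤ ∑' m, resampleDist μ g q m := by
  have h1 : ∑ i ∈ s, resampleDist μ (fun x => g (lagShift i x)) q n =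
      ∑ i ∈ s.filter (· ≤ n), resampleDist μ g q (n - i) := by
    rw [Finset.sum_filter]
    refine Finset.sum_congr rfl fun i _ => ?_
    split_ifs with h
    · conv_lhs => rw [← Nat.sub_add_cancel h]
      exact resampleDist_lagShift hg q (n - i) i
    · exact resampleDist_lagShift_of_lt g q (not_le.1 h)
  have h2 : Set.InjOn (fun i => n - i) (s.filter (· ≤ n) : Finset ℕ) := by
    intro a ha b hb hab
    simp only [Finset.coe_filter, Set.mem_ofPred_eq] at ha hb hab
    omega
  rw [h1, ← Finset.sum_image (f := fun m => resampleDist μ g q m) h2]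
  exact ENNReal.sum_le_tsum _

theorem stronglyMeasurable_comp_lagShift {g : (ℕ → S) → H} (hg : StronglyMeasurable g) (i : ℕ) :
    StronglyMeasurable fun x => g (lagShift i x) :=
  hg.comp_measurable (measurable_lagShift i)

theorem memLp_comp_lagShift {g : (ℕ → S) → H} {q : ℝ≥0∞} (hg : MemLp g q (seqLaw μ)) (i : ℕ) :
    MemLp (fun x => g (lagShift i x)) q (seqLaw μ) :=
  hg.comp_measurePreserving (measurePreserving_lagShift μ i)

theorem stronglyMeasurable_linearForm {g : (ℕ → S) → H} (hg : StronglyMeasurable g)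
    (α : ℕ → ℂ) (T : ℕ) :
    StronglyMeasurable fun x => ∑ i ∈ Finset.range T, α i • g (lagShift i x) :=
  Finset.stronglyMeasurable_fun_sum _ fun i _ => (stronglyMeasurable_comp_lagShift hg i).const_smul _

theorem memLp_linearForm {g : (ℕ → S) → H} {q : ℝ≥0∞} (hgq : MemLp g q (seqLaw μ))
    (α : ℕ → ℂ) (T : ℕ) :
    MemLp (fun x => ∑ i ∈ Finset.range T, α i • g (lagShift i x)) q (seqLaw μ) :=
  memLp_finsetSum _ fun i _ => (memLp_comp_lagShift hgq i).const_smul _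

/-- Resampling coordinate `n` moves the form by at most `∑ |α_i| d(n, i)`, where `d(n, i)` is the
effect on the `i`-th shift. The moment inequality sums the squares over `n`, and Schur's test bounds
the sum. -/
theorem eLpNorm_linearForm_sq_le {q : ℝ} (hq : 2 ≤ q) {g : (ℕ → S) → H}
    (hg : StronglyMeasurable g) (hgq : MemLp g (ENNReal.ofReal q) (seqLaw μ))
    (hg0 : ∫ x, g x ∂seqLaw μ = 0) (α : ℕ → ℂ) (T : ℕ) :
    eLpNorm (fun x => ∑ i ∈ Finset.range T, α i • g (lagShift i x)) (ENNReal.ofReal q)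
        (seqLaw μ) ^ 2 ≤
      ENNReal.ofReal (martingaleConst q) * ((∑' m, resampleDist μ g (ENNReal.ofReal q) m) ^ 2 *
        ∑ i ∈ Finset.range T, ‖α i‖ₑ ^ 2) := by
  have hQ1 : 1 ≤ ENNReal.ofReal q := by rw [ENNReal.one_le_ofReal]; linarith
  have hsm := stronglyMeasurable_linearForm hg α T
  have hLp := memLp_linearForm hgq α T
  have h := eLpNorm_sub_integral_sq_le hq hsm hLp
  have h0 : ∫ x, ∑ i ∈ Finset.range T, α i • g (lagShift i x) ∂seqLaw μ = 0 := by
    have hi : ∀ i ∈ Finset.range T, Integrable (fun x => α i • g (lagShift i x)) (seqLaw μ) :=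
      fun i _ => ((memLp_comp_lagShift hgq i).const_smul (α i)).integrable hQ1
    rw [integral_finsetSum _ hi]
    refine Finset.sum_eq_zero fun i _ => ?_
    rw [integral_smul, integral_comp_of_measurePreserving (measurePreserving_lagShift μ i)
      hg.aestronglyMeasurable, hg0, smul_zero]
  simp only [h0, sub_zero] at h
  refine h.trans (mul_le_mul_right ?_ _)
  refine le_trans (ENNReal.tsum_le_tsum fun n => pow_le_pow_left' ?_ 2)
    (tsum_sum_mul_sq_le (Finset.range T) (fun i => ‖α i‖ₑ)
      (fun n i => resampleDist μ (fun x => g (lagShift i x)) (ENNReal.ofReal q) n)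
      (fun n => sum_resampleDist_lagShift_le hg _ _ n)
      (fun i => (tsum_resampleDist_lagShift hg _ i).le))
  have e : (fun z : (ℕ → S) × (ℕ → S) => ∑ i ∈ Finset.range T, α i • g (lagShift i z.1) -
      ∑ i ∈ Finset.range T, α i • g (lagShift i (resample n z))) =
      ∑ i ∈ Finset.range T, α i • fun z : (ℕ → S) × (ℕ → S) =>
        g (lagShift i z.1) - g (lagShift i (resample n z)) := by
    funext z
    simp only [Finset.sum_apply, Pi.smul_apply, smul_sub, Finset.sum_sub_distrib]
  rw [e]
  refine (eLpNorm_sum_le (fun i _ => ?_) hQ1).trans (Finset.sum_le_sum fun i _ => ?_)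
  · have hi := stronglyMeasurable_comp_lagShift hg i
    exact (((hi.comp_measurable measurable_fst).sub
      (hi.comp_measurable (measurable_resample n))).const_smul _).aestronglyMeasurable
  · rw [eLpNorm_const_smul]; rfl

theorem holderTriple_two_mul {p : ℝ} (hp : 0 < p) :
    ENNReal.HolderTriple (ENNReal.ofReal (2 * p)) (ENNReal.ofReal (2 * p)) (ENNReal.ofReal p) := by
  refine ⟨?_⟩
  rw [← ENNReal.ofReal_inv_of_pos (by positivity), ← ENNReal.ofReal_inv_of_pos hp,
    ← ENNReal.ofReal_add (by positivity) (by positivity)]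
  congr 1
  field_simp
  norm_num

theorem eLpNorm_bilin_le {Ω : Type*} [MeasurableSpace Ω] {P : Measure Ω} {p : ℝ} (hp : 0 < p)
    {B : H →L[ℝ] H →L[ℝ] K} (hB : ∀ x y, ‖B x y‖ ≤ ‖x‖ * ‖y‖) {u v : Ω → H}
    (hu : AEStronglyMeasurable u P) (hv : AEStronglyMeasurable v P) :
    eLpNorm (fun ω => B (u ω) (v ω)) (ENNReal.ofReal p) P ≤
      eLpNorm u (ENNReal.ofReal (2 * p)) P * eLpNorm v (ENNReal.ofReal (2 * p)) P := by
  have := holderTriple_two_mul hp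
  have h := eLpNorm_le_eLpNorm_mul_eLpNorm'_of_norm (p := ENNReal.ofReal (2 * p))
    (q := ENNReal.ofReal (2 * p)) (r := ENNReal.ofReal p) hu hv (fun x y => B x y) 1
    (ae_of_all _ fun ω => by simpa using hB (u ω) (v ω))
  simpa using h

theorem stronglyMeasurable_bilin {Ω : Type*} [MeasurableSpace Ω]
    (B : H →L[ℝ] H →L[ℝ] K) {u v : Ω → H} (hu : StronglyMeasurable u) (hv : StronglyMeasurable v) :
    StronglyMeasurable fun ω => B (u ω) (v ω) :=
  (by fun_prop : Continuous fun z : H × H => B z.1 z.2).comp_stronglyMeasurable (hu.prodMk hv)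

theorem memLp_bilin {Ω : Type*} [MeasurableSpace Ω] {P : Measure Ω} {p : ℝ} (hp : 0 < p)
    {B : H →L[ℝ] H →L[ℝ] K} (hB : ∀ x y, ‖B x y‖ ≤ ‖x‖ * ‖y‖) {u v : Ω → H}
    (hu : MemLp u (ENNReal.ofReal (2 * p)) P) (hv : MemLp v (ENNReal.ofReal (2 * p)) P) :
    MemLp (fun ω => B (u ω) (v ω)) (ENNReal.ofReal p) P :=
  ⟨B.aestronglyMeasurable_comp₂ hu.1 hv.1,
    (eLpNorm_bilin_le hp hB hu.1 hv.1).trans_lt (ENNReal.mul_lt_top hu.2 hv.2)⟩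

/-- The quadratic form `∑ᵢⱼ aᵢⱼ B(g(σⁱ x), g(σʲ x))`. -/
noncomputable def quadForm (B : H →L[ℝ] H →L[ℝ] K) (a : ℕ → ℕ → ℂ) (T : ℕ) (g : (ℕ → S) → H)
    (x : ℕ → S) : K :=
  ∑ i ∈ Finset.range T, ∑ j ∈ Finset.range T, a i j • B (g (lagShift i x)) (g (lagShift j x))

/-- The two arguments of `B` are exchanged one after the other. Each resulting term pairs a single
increment with a whole linear form, along a row at `x` or a column at `y`, so that cancellation in
these linear forms is not lost. The conjugate on `a i j` compensates the antilinearity in the second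
argument. -/
theorem quadForm_sub (B : H →L[ℝ] H →L[ℝ] K) (hB1 : ∀ (c : ℂ) x y, B (c • x) y = c • B x y)
    (hB2 : ∀ (c : ℂ) x y, B x (c • y) = (starRingEnd ℂ) c • B x y)
    (a : ℕ → ℕ → ℂ) (T : ℕ) (g : (ℕ → S) → H) (x y : ℕ → S) :
    quadForm B a T g x - quadForm B a T g y =
      (∑ i ∈ Finset.range T, B (g (lagShift i x) - g (lagShift i y))
        (∑ j ∈ Finset.range T, (starRingEnd ℂ) (a i j) • g (lagShift j x))) +
      ∑ j ∈ Finset.range T, B (∑ i ∈ Finset.range T, a i j • g (lagShift i y))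
        (g (lagShift j x) - g (lagShift j y)) := by
  have h1 : ∀ i, B (g (lagShift i x) - g (lagShift i y))
      (∑ j ∈ Finset.range T, (starRingEnd ℂ) (a i j) • g (lagShift j x)) =
      ∑ j ∈ Finset.range T, (a i j • B (g (lagShift i x)) (g (lagShift j x)) -
        a i j • B (g (lagShift i y)) (g (lagShift j x))) := fun i => by
    rw [map_sum]
    refine Finset.sum_congr rfl fun j _ => ?_
    rw [hB2, Complex.conj_conj, map_sub, _root_.sub_apply, smul_sub]
  have h2 : ∀ j, B (∑ i ∈ Finset.range T, a i j • g (lagShift i y))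
      (g (lagShift j x) - g (lagShift j y)) =
      ∑ i ∈ Finset.range T, (a i j • B (g (lagShift i y)) (g (lagShift j x)) -
        a i j • B (g (lagShift i y)) (g (lagShift j y))) := fun j => by
    rw [map_sum, _root_.sum_apply]
    refine Finset.sum_congr rfl fun i _ => ?_
    rw [hB1, map_sub, smul_sub]
  simp only [h1, h2, quadForm]
  rw [Finset.sum_comm (f := fun j i => a i j • B (g (lagShift i y)) (g (lagShift j x)) -
        a i j • B (g (lagShift i y)) (g (lagShift j y)))]
  simp only [Finset.sum_sub_distrib]
  abel

theorem stronglyMeasurable_quadForm (B : H →L[ℝ] H →L[ℝ] K) (a : ℕ → ℕ → ℂ) (T : ℕ)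
    {g : (ℕ → S) → H} (hg : StronglyMeasurable g) : StronglyMeasurable (quadForm B a T g) :=
  Finset.stronglyMeasurable_fun_sum _ fun i _ => Finset.stronglyMeasurable_fun_sum _ fun j _ =>
    (stronglyMeasurable_bilin B (stronglyMeasurable_comp_lagShift hg i)
      (stronglyMeasurable_comp_lagShift hg j)).const_smul _

theorem memLp_quadForm {p : ℝ} (hp : 0 < p) {B : H →L[ℝ] H →L[ℝ] K}
    (hB : ∀ x y, ‖B x y‖ ≤ ‖x‖ * ‖y‖) (a : ℕ → ℕ → ℂ) (T : ℕ)
    {g : (ℕ → S) → H} (hgq : MemLp g (ENNReal.ofReal (2 * p)) (seqLaw μ)) :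
    MemLp (quadForm B a T g) (ENNReal.ofReal p) (seqLaw μ) :=
  memLp_finsetSum _ fun i _ => memLp_finsetSum _ fun j _ =>
    (memLp_bilin hp hB (memLp_comp_lagShift hgq i) (memLp_comp_lagShift hgq j)).const_smul _

/-- Moment bound for the centered quadratic form. -/
theorem eLpNorm_quadForm_sub_integral_sq_le {p : ℝ} (hp : 2 ≤ p) {B : H →L[ℝ] H →L[ℝ] K}
    (hB : ∀ x y, ‖B x y‖ ≤ ‖x‖ * ‖y‖) (hB1 : ∀ (c : ℂ) x y, B (c • x) y = c • B x y)
    (hB2 : ∀ (c : ℂ) x y, B x (c • y) = (starRingEnd ℂ) c • B x y)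
    {g : (ℕ → S) → H} (hg : StronglyMeasurable g)
    (hgq : MemLp g (ENNReal.ofReal (2 * p)) (seqLaw μ)) (hg0 : ∫ x, g x ∂seqLaw μ = 0)
    (a : ℕ → ℕ → ℂ) (T : ℕ) {A : ℝ≥0∞}
    (hrow : ∀ i ∈ Finset.range T, ∑ j ∈ Finset.range T, ‖a i j‖ₑ ^ 2 ≤ A)
    (hcol : ∀ j ∈ Finset.range T, ∑ i ∈ Finset.range T, ‖a i j‖ₑ ^ 2 ≤ A) :
    eLpNorm (fun x => quadForm B a T g x - ∫ y, quadForm B a T g y ∂seqLaw μ)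
        (ENNReal.ofReal p) (seqLaw μ) ^ 2 ≤
      ENNReal.ofReal (4 * martingaleConst p * martingaleConst (2 * p)) *
        (∑' m, resampleDist μ g (ENNReal.ofReal (2 * p)) m) ^ 4 * (A * T) := by
  set Q := ENNReal.ofReal (2 * p) with hQ
  set Θ := ∑' m, resampleDist μ g Q m with hΘ
  have hp0 : 0 < p := by linarith
  have hQ1 : 1 ≤ ENNReal.ofReal p := by rw [ENNReal.one_le_ofReal]; linarith
  have hconst : 0 ≤ martingaleConst p := martingaleConst_nonneg hp
  -- `Λ` is a common `L^{2p}` bound for all the row and column linear forms; its square is the bound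
  -- from `eLpNorm_linearForm_sq_le`.
  set Λ : ℝ≥0∞ := (ENNReal.ofReal (martingaleConst (2 * p)) * (Θ ^ 2 * A)) ^ (1 / 2 : ℝ) with hΛ
  have hΛ2 : Λ ^ 2 = ENNReal.ofReal (martingaleConst (2 * p)) * (Θ ^ 2 * A) := by
    rw [hΛ, ← ENNReal.rpow_natCast, ← ENNReal.rpow_mul]; norm_num
  have lin : ∀ α : ℕ → ℂ, ∑ i ∈ Finset.range T, ‖α i‖ₑ ^ 2 ≤ A →
      eLpNorm (fun x => ∑ i ∈ Finset.range T, α i • g (lagShift i x)) Q (seqLaw μ) ≤ Λ := by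
    intro α hα
    rw [← ENNReal.rpow_le_rpow_iff (z := 2) (by norm_num), ENNReal.rpow_two, ENNReal.rpow_two, hΛ2]
    refine (eLpNorm_linearForm_sq_le (by linarith) hg hgq hg0 α T).trans ?_
    gcongr
  have hsm := stronglyMeasurable_quadForm B a T hg
  have h := eLpNorm_sub_integral_sq_le hp hsm (memLp_quadForm hp0 hB a T hgq)
  have key : ∀ n, eLpNorm (fun z => quadForm B a T g z.1 - quadForm B a T g (resample n z))
      (ENNReal.ofReal p) ((seqLaw μ).prod (seqLaw μ)) ≤
      2 * Λ * ∑ i ∈ Finset.range T, resampleDist μ (fun x => g (lagShift i x)) Q n := by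
    intro n
    have mfst : MeasurePreserving (Prod.fst : (ℕ → S) × (ℕ → S) → ℕ → S)
      ((seqLaw μ).prod (seqLaw μ)) (seqLaw μ) := measurePreserving_fst
    have mres := measurePreserving_resample μ n
    have mdiff : ∀ i, StronglyMeasurable fun z : (ℕ → S) × (ℕ → S) =>
        g (lagShift i z.1) - g (lagShift i (resample n z)) := fun i => by
      have hi := stronglyMeasurable_comp_lagShift hg i
      exact (hi.comp_measurable measurable_fst).sub (hi.comp_measurable (measurable_resample n))
    have mlin : ∀ α : ℕ → ℂ, StronglyMeasurable fun z : (ℕ → S) × (ℕ → S) =>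
        ∑ i ∈ Finset.range T, α i • g (lagShift i z.1) := fun α =>
      (stronglyMeasurable_linearForm hg α T).comp_measurable measurable_fst
    have mlin' : ∀ α : ℕ → ℂ, StronglyMeasurable fun z : (ℕ → S) × (ℕ → S) =>
        ∑ i ∈ Finset.range T, α i • g (lagShift i (resample n z)) := fun α =>
      (stronglyMeasurable_linearForm hg α T).comp_measurable (measurable_resample n)
    have e : (fun z : (ℕ → S) × (ℕ → S) =>
        quadForm B a T g z.1 - quadForm B a T g (resample n z)) =
        (∑ i ∈ Finset.range T, fun z : (ℕ → S) × (ℕ → S) =>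
          B (g (lagShift i z.1) - g (lagShift i (resample n z)))
            (∑ j ∈ Finset.range T, (starRingEnd ℂ) (a i j) • g (lagShift j z.1))) +
        ∑ j ∈ Finset.range T, fun z : (ℕ → S) × (ℕ → S) =>
          B (∑ i ∈ Finset.range T, a i j • g (lagShift i (resample n z)))
            (g (lagShift j z.1) - g (lagShift j (resample n z))) := by
      funext z
      simp only [Pi.add_apply, Finset.sum_apply]
      exact quadForm_sub B hB1 hB2 a T g z.1 (resample n z)
    have m1 : ∀ i, StronglyMeasurable fun z : (ℕ → S) × (ℕ → S) =>
          B (g (lagShift i z.1) - g (lagShift i (resample n z)))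
            (∑ j ∈ Finset.range T, (starRingEnd ℂ) (a i j) • g (lagShift j z.1)) := fun i =>
      stronglyMeasurable_bilin B (mdiff i) (mlin _)
    have m2 : ∀ j, StronglyMeasurable fun z : (ℕ → S) × (ℕ → S) =>
          B (∑ i ∈ Finset.range T, a i j • g (lagShift i (resample n z)))
            (g (lagShift j z.1) - g (lagShift j (resample n z))) := fun j =>
      stronglyMeasurable_bilin B (mlin' fun i => a i j) (mdiff j)
    rw [e]
    refine (eLpNorm_add_le (Finset.aestronglyMeasurable_sum _ fun i _ => (m1 i).aestronglyMeasurable)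
      (Finset.aestronglyMeasurable_sum _ fun i _ => (m2 i).aestronglyMeasurable) hQ1).trans ?_
    have b1 : eLpNorm (∑ i ∈ Finset.range T, fun z : (ℕ → S) × (ℕ → S) =>
          B (g (lagShift i z.1) - g (lagShift i (resample n z)))
            (∑ j ∈ Finset.range T, (starRingEnd ℂ) (a i j) • g (lagShift j z.1)))
          (ENNReal.ofReal p) ((seqLaw μ).prod (seqLaw μ)) ≤
        Λ * ∑ i ∈ Finset.range T, resampleDist μ (fun x => g (lagShift i x)) Q n := by
      refine (eLpNorm_sum_le (fun i _ => (m1 i).aestronglyMeasurable) hQ1).trans ?_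
      rw [Finset.mul_sum]
      refine Finset.sum_le_sum fun i hi => ?_
      refine (eLpNorm_bilin_le hp0 hB (mdiff i).aestronglyMeasurable
        (mlin _).aestronglyMeasurable).trans ?_
      rw [mul_comm]
      refine mul_le_mul' ?_ le_rfl
      refine le_trans (le_of_eq ?_) (lin (fun j => (starRingEnd ℂ) (a i j)) ?_)
      · exact eLpNorm_comp_measurePreserving
          (stronglyMeasurable_linearForm hg _ T).aestronglyMeasurable mfst
      · simpa only [RCLike.enorm_conj] using hrow i hi
    have b2 : eLpNorm (∑ j ∈ Finset.range T, fun z : (ℕ → S) × (ℕ → S) =>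
          B (∑ i ∈ Finset.range T, a i j • g (lagShift i (resample n z)))
            (g (lagShift j z.1) - g (lagShift j (resample n z))))
          (ENNReal.ofReal p) ((seqLaw μ).prod (seqLaw μ)) ≤
        Λ * ∑ i ∈ Finset.range T, resampleDist μ (fun x => g (lagShift i x)) Q n := by
      refine (eLpNorm_sum_le (fun i _ => (m2 i).aestronglyMeasurable) hQ1).trans ?_
      rw [Finset.mul_sum]
      refine Finset.sum_le_sum fun j hj => ?_
      refine (eLpNorm_bilin_le hp0 hB (mlin' fun i => a i j).aestronglyMeasurable
        (mdiff j).aestronglyMeasurable).trans ?_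
      refine mul_le_mul' ?_ le_rfl
      refine le_trans (le_of_eq ?_) (lin (fun i => a i j) (hcol j hj))
      exact eLpNorm_comp_measurePreserving
          (stronglyMeasurable_linearForm hg _ T).aestronglyMeasurable mres
    refine (add_le_add b1 b2).trans_eq ?_
    ring
  refine h.trans ?_
  -- Schur's test with all coefficients equal to `1` is the source of the factor `T`.
  have hschur := tsum_sum_mul_sq_le (Finset.range T) (fun _ => 1)
      (fun n i => resampleDist μ (fun x => g (lagShift i x)) Q n)
      (fun n => sum_resampleDist_lagShift_le hg _ _ n)
      (fun i => (tsum_resampleDist_lagShift hg _ i).le)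
  simp only [one_mul, one_pow, Finset.sum_const, Finset.card_range, nsmul_eq_mul, mul_one] at hschur
  calc ENNReal.ofReal (martingaleConst p) * ∑' n, eLpNorm (fun z => quadForm B a T g z.1 -
        quadForm B a T g (resample n z)) (ENNReal.ofReal p) ((seqLaw μ).prod (seqLaw μ)) ^ 2
      ≤ ENNReal.ofReal (martingaleConst p) * ∑' n, (2 * Λ) ^ 2 *
        (∑ i ∈ Finset.range T, resampleDist μ (fun x => g (lagShift i x)) Q n) ^ 2 := by
        gcongr with n
        rw [← mul_pow]
        exact pow_le_pow_left' (key n) 2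
    _ ≤ ENNReal.ofReal (martingaleConst p) * ((2 * Λ) ^ 2 * (Θ ^ 2 * T)) := by
        rw [ENNReal.tsum_mul_left]
        gcongr
    _ = _ := by
        rw [mul_pow, hΛ2, ENNReal.ofReal_mul (by positivity), ENNReal.ofReal_mul (by norm_num)]
        norm_num
        ring

end Forms

/-! ### Transfer from the probability space to sequences, and the dependence coefficients. -/

section Dependence

variable {Ω S : Type*} [MeasurableSpace Ω] [MeasurableSpace S] {P : Measure Ω}
  [IsProbabilityMeasure P] {ε ε' : ℤ → Ω → S}

/-- The sequence `(ε_t, ε_{t-1}, …)`. -/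
def past (ε : ℤ → Ω → S) (t : ℤ) (ω : Ω) : ℕ → S := fun k => ε (t - k) ω

theorem pastSigma_eq_comap (η : ℤ → Ω → S) (t : ℤ) :
    pastSigma η t = MeasurableSpace.comap (past η t) MeasurableSpace.pi := by
  refine le_antisymm (iSup₂_le fun s hs => ?_) ?_
  · have e : η s = (fun x : ℕ → S => x (t - s).toNat) ∘ past η t := by
      funext ω
      simp only [Function.comp, past]
      congr 1
      rw [Int.toNat_of_nonneg (by omega)]
      ring
    rw [e, ← MeasurableSpace.comap_comp]
    exact MeasurableSpace.comap_mono (measurable_iff_comap_le.1 (measurable_pi_apply _))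
  · rw [MeasurableSpace.pi, MeasurableSpace.comap_iSup]
    refine iSup_le fun k => ?_
    rw [MeasurableSpace.comap_comp]
    exact le_iSup₂_of_le (t - k) (by omega) le_rfl

theorem IsIIDWithCopy.isProbabilityMeasure (hε : IsIIDWithCopy ε ε' P) :
    IsProbabilityMeasure (P.map (ε 0)) :=
  Measure.isProbabilityMeasure_map (hε.measurable 0).aemeasurable

theorem IsIIDWithCopy.measurePreserving (hε : IsIIDWithCopy ε ε' P) :
    MeasurePreserving (fun ω t => ε t ω) P (Measure.infinitePi fun _ : ℤ => P.map (ε 0)) := by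
  refine ⟨measurable_pi_iff.2 hε.measurable, ?_⟩
  rw [hε.indep.map_fun_eq_infinitePi_map hε.measurable]
  congr 1
  funext t
  exact (hε.identDistrib t).map_eq

theorem IsIIDWithCopy.measurePreserving_copy (hε : IsIIDWithCopy ε ε' P) :
    MeasurePreserving (fun ω t => ε' t ω) P (Measure.infinitePi fun _ : ℤ => P.map (ε 0)) :=
  ⟨measurable_pi_iff.2 hε.measurable_copy, hε.copy_law.map_eq.trans hε.measurePreserving.map_eq⟩

theorem IsIIDWithCopy.measurePreserving_sum (hε : IsIIDWithCopy ε ε' P) :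
    MeasurePreserving (fun ω => (Sum.elim (fun t => ε t ω) (fun t => ε' t ω) : ℤ ⊕ ℤ → S)) P
      (Measure.infinitePi fun _ => P.map (ε 0)) := by
  have := hε.isProbabilityMeasure
  have h : MeasurePreserving (fun ω => ((fun t => ε t ω), (fun t => ε' t ω))) P
      ((Measure.infinitePi fun _ : ℤ => P.map (ε 0)).prod
        (Measure.infinitePi fun _ : ℤ => P.map (ε 0))) := by
    refine ⟨hε.measurePreserving.measurable.prodMk hε.measurePreserving_copy.measurable, ?_⟩
    rw [(indepFun_iff_map_prod_eq_prod_map_map hε.measurePreserving.aemeasurable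
      hε.measurePreserving_copy.aemeasurable).1 hε.copy_indep, hε.measurePreserving.map_eq,
      hε.measurePreserving_copy.map_eq]
  exact (measurePreserving_sumElim (P.map (ε 0))).comp h

theorem IsIIDWithCopy.measurePreserving_past (hε : IsIIDWithCopy ε ε' P)
    [IsProbabilityMeasure (P.map (ε 0))] (t : ℤ) :
    MeasurePreserving (past ε t) P (seqLaw (P.map (ε 0))) :=
  (measurePreserving_reindex (P.map (ε 0)) (f := fun k : ℕ => t - (k : ℤ))
    (fun a b h => by simpa using h)).comp hε.measurePreserving

theorem IsIIDWithCopy.measurePreserving_option (hε : IsIIDWithCopy ε ε' P)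
    [IsProbabilityMeasure (P.map (ε 0))] (m : ℕ) :
    MeasurePreserving (fun ω (j : Option ℕ) => j.elim (ε' 0 ω) (past ε m ω)) P
      (Measure.infinitePi fun _ => P.map (ε 0)) := by
  have he : Function.Injective
      (fun j : Option ℕ => j.elim (Sum.inr 0 : ℤ ⊕ ℤ) fun k => Sum.inl ((m : ℤ) - k)) := by
    rintro (_ | a) (_ | b) h <;> simp_all
  convert (measurePreserving_reindex (P.map (ε 0)) he).comp hε.measurePreserving_sum using 1
  funext ω j
  cases j <;> rfl

/-- In the past of time `m`, the innovation at time `0` has lag `m`; coupling at time `0` is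
therefore resampling of coordinate `m`. -/
theorem IsIIDWithCopy.identDistrib_coupled (hε : IsIIDWithCopy ε ε' P)
    [IsProbabilityMeasure (P.map (ε 0))] (m : ℕ) :
    IdentDistrib (fun ω => (past ε m ω, past (coupled ε ε' {0}) m ω))
      (fun z => (z.1, resample m z)) P
      ((seqLaw (P.map (ε 0))).prod (seqLaw (P.map (ε 0)))) := by
  refine map_pair_eq (P.map (ε 0)) (n := m) (hε.measurePreserving_option m)
    (measurePreserving_option_resample (P.map (ε 0)) m) (fun ω => ?_) (fun z => ?_)
  · refine Prod.ext rfl ?_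
    funext k
    have h0 : ((m : ℤ) - k = 0) ↔ k = m := by omega
    simp only [past, coupled, resamplePair, Option.elim, mem_singleton_iff, h0]
    split_ifs with h
    · rw [h, sub_self]
    · rfl
  · refine Prod.ext ?_ ?_ <;> funext k <;> simp only [resamplePair, resample, Option.elim]
    grind

variable {H : Type*} [NormedAddCommGroup H] [InnerProductSpace ℂ H] [CompleteSpace H]
  {g : (ℕ → S) → H}

theorem IsIIDWithCopy.memLp_iff (hε : IsIIDWithCopy ε ε' P)
    [IsProbabilityMeasure (P.map (ε 0))] (hg : StronglyMeasurable g)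
    (q : ℝ≥0∞) (t : ℤ) :
    MemLp (causalProcess g ε t) q P ↔ MemLp g q (seqLaw (P.map (ε 0))) := by
  rw [← (hε.measurePreserving_past t).map_eq]
  exact (memLp_map_measure_iff (f := past ε t) hg.aestronglyMeasurable
    (hε.measurePreserving_past t).aemeasurable).symm

theorem IsIIDWithCopy.integral_causalProcess (hε : IsIIDWithCopy ε ε' P)
    [IsProbabilityMeasure (P.map (ε 0))]
    (hg : StronglyMeasurable g) (t : ℤ) :
    ∫ ω, causalProcess g ε t ω ∂P = ∫ x, g x ∂seqLaw (P.map (ε 0)) :=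
  integral_comp_of_measurePreserving (hε.measurePreserving_past t) hg.aestronglyMeasurable

/-- The conditional expectation is some function `ψ` of the coupled past `x'`; nothing else about it
is needed. Let `x''` be a third version with another independent value at the same coordinate. Then
`g x - ψ x'` and `g x'' - ψ x'` have the same norm, `ψ x'` cancels in their difference, and `g x - g
x''` has the law of the resampling increment. The triangle inequality gives the factor `2`. -/
theorem IsIIDWithCopy.resampleDist_le (hε : IsIIDWithCopy ε ε' P)
    [IsProbabilityMeasure (P.map (ε 0))]
    (hg : StronglyMeasurable g) {q : ℝ} (hq : 1 ≤ q) (m : ℕ) :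
    resampleDist (P.map (ε 0)) g (ENNReal.ofReal q) m ≤
      2 * depCoeff ε ε' P q (causalProcess g ε) m := by
  set μ := P.map (ε 0) with hμ
  set Q := ENNReal.ofReal q with hQ
  have hQ1 : 1 ≤ Q := by rwa [hQ, ENNReal.one_le_ofReal]
  obtain ⟨ψ, hψ, hψe⟩ : ∃ ψ : (ℕ → S) → H, StronglyMeasurable ψ ∧
      P[causalProcess g ε m | pastSigma (coupled ε ε' {0}) m] =
        ψ ∘ past (coupled ε ε' {0}) m := by
    have h := stronglyMeasurable_condExp (f := causalProcess g ε m)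
      (m := pastSigma (coupled ε ε' {0}) m) (μ := P)
    have h2 : StronglyMeasurable[MeasurableSpace.comap (past (coupled ε ε' {0}) m)
        MeasurableSpace.pi] (P[causalProcess g ε m | pastSigma (coupled ε ε' {0}) m]) := by
      rw [← pastSigma_eq_comap]; exact h
    exact h2.exists_eq_measurable_comp
  set F : (ℕ → S) × (ℕ → S) → H := fun z => g z.1 - ψ z.2 with hF
  have hFm : StronglyMeasurable F :=
    (hg.comp_measurable measurable_fst).sub (hψ.comp_measurable measurable_snd)
  have hν : depCoeff ε ε' P q (causalProcess g ε) m =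
      eLpNorm (fun z => F (z.1, resample m z)) Q ((seqLaw μ).prod (seqLaw μ)) := by
    rw [← eLpNorm_comp_eq_of_identDistrib (hε.identDistrib_coupled m) hFm, depCoeff, hψe]
    rfl
  have hswap := eLpNorm_comp_eq_of_identDistrib (identDistrib_resample_swap μ m) hFm Q
  have hsucc := eLpNorm_comp_eq_of_identDistrib (identDistrib_resample_succ μ m)
    (F := fun z => g z.1 - g z.2)
    ((hg.comp_measurable measurable_fst).sub (hg.comp_measurable measurable_snd)) Q
  rw [resampleDist, ← hsucc, hν, two_mul]
  nth_rewrite 2 [← hswap]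
  have m1 : StronglyMeasurable fun z : (ℕ → S) × (ℕ → S) => F (z.1, resample m z) :=
    hFm.comp_measurable (measurable_fst.prodMk (measurable_resample m))
  have mr : Measurable fun z : (ℕ → S) × (ℕ → S) =>
      (fun k => if k = m then z.2 (m + 1) else z.1 k : ℕ → S) := by
    refine measurable_pi_iff.2 fun k => ?_
    by_cases hk : k = m
    · simp only [hk, if_true]; fun_prop
    · simp only [hk, if_false]; fun_prop
  have m2 : StronglyMeasurable fun z : (ℕ → S) × (ℕ → S) =>
      F ((fun k => if k = m then z.2 (m + 1) else z.1 k : ℕ → S), resample m z) :=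
    hFm.comp_measurable (mr.prodMk (measurable_resample m))
  refine le_trans (le_of_eq ?_) (eLpNorm_sub_le m1.aestronglyMeasurable m2.aestronglyMeasurable hQ1)
  congr 1
  funext z
  simp only [hF, Pi.sub_apply]
  abel

end Dependence

/-! ### Autocovariances and martingale differences. -/

section Covariance

variable {S : Type*} [MeasurableSpace S] {μ : Measure S} [IsProbabilityMeasure μ]
  {H : Type*} [NormedAddCommGroup H] [InnerProductSpace ℂ H] [CompleteSpace H]
  {K : Type*} [NormedAddCommGroup K] [InnerProductSpace ℂ K] [CompleteSpace K]
  {B : H →L[ℝ] H →L[ℝ] K} {g : (ℕ → S) → H}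

theorem integrable_bilin {Ω : Type*} [MeasurableSpace Ω] {P : Measure Ω}
    (hB : ∀ x y, ‖B x y‖ ≤ ‖x‖ * ‖y‖) {u v : Ω → H} (hu : MemLp u 2 P) (hv : MemLp v 2 P) :
    Integrable (fun ω => B (u ω) (v ω)) P := by
  have h := memLp_bilin (p := 1) one_pos hB (u := u) (v := v) (P := P)
    (by simpa using hu) (by simpa using hv)
  rw [ENNReal.ofReal_one] at h
  exact memLp_one_iff_integrable.1 h

theorem enorm_integral_bilin_le {Ω : Type*} [MeasurableSpace Ω] {P : Measure Ω}
    [IsProbabilityMeasure P] (hB : ∀ x y, ‖B x y‖ ≤ ‖x‖ * ‖y‖) {u v : Ω → H}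
    (hu : MemLp u 2 P) (hv : MemLp v 2 P) :
    ‖∫ ω, B (u ω) (v ω) ∂P‖ₑ ≤ eLpNorm u 2 P * eLpNorm v 2 P := by
  refine (enorm_integral_le_eLpNorm le_rfl (integrable_bilin hB hu hv).1).trans ?_
  have h := eLpNorm_bilin_le (p := 1) one_pos hB hu.1 hv.1
  simpa using h

theorem integral_bilin_eq_lagExp_left (hB : ∀ x y, ‖B x y‖ ≤ ‖x‖ * ‖y‖) {u V : (ℕ → S) → H} {m : ℕ}
    (hu : MemLp u 2 (seqLaw μ)) (hV : MemLp V 2 (seqLaw μ))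
    (hVm : ∀ x y, V (splice m x y) = V x) :
    ∫ x, B (u x) (V x) ∂seqLaw μ = ∫ x, B (lagExp μ m u x) (V x) ∂seqLaw μ := by
  rw [← integral_lagExp (integrable_bilin hB hu hV) m]
  refine integral_congr_ae ?_
  filter_upwards [ae_integrable_splice (hu.integrable one_le_two) m] with x hx
  simp only [lagExp, hVm]
  exact (B.flip (V x)).integral_comp_comm hx

theorem integral_bilin_eq_lagExp_right (hB : ∀ x y, ‖B x y‖ ≤ ‖x‖ * ‖y‖) {W v : (ℕ → S) → H}
    {m : ℕ} (hW : MemLp W 2 (seqLaw μ)) (hv : MemLp v 2 (seqLaw μ))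
    (hWm : ∀ x y, W (splice m x y) = W x) :
    ∫ x, B (W x) (v x) ∂seqLaw μ = ∫ x, B (W x) (lagExp μ m v x) ∂seqLaw μ :=
  integral_bilin_eq_lagExp_left (B := B.flip) (fun x y => by
    rw [ContinuousLinearMap.flip_apply, mul_comm]; exact hB y x) hv hW hWm

theorem lagExp_add_comp_lagShift {f : (ℕ → S) → H} (hf : StronglyMeasurable f) (n h : ℕ)
    (x : ℕ → S) :
    lagExp μ (n + h) (fun x => f (lagShift h x)) x = lagExp μ n f (lagShift h x) := by
  simp only [lagExp, lagShift_splice]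
  exact integral_comp_of_measurePreserving (measurePreserving_lagShift μ h)
    (F := fun y => f (splice n (lagShift h x) y))
    (hf.comp_measurable ((measurable_splice n).comp measurable_prodMk_left)).aestronglyMeasurable

/-- The shifted difference does not involve the first `n + h` coordinates, so `g` may be averaged
over them. Averaging over one more coordinate annihilates the shifted difference, so the part
`lagExp (n + h + 1)` of `g` contributes nothing. -/
theorem integral_bilin_lagDiff (hB : ∀ x y, ‖B x y‖ ≤ ‖x‖ * ‖y‖) (hg : StronglyMeasurable g)
    (hg2 : MemLp g 2 (seqLaw μ)) (n h : ℕ) :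
    ∫ x, B (g x) (lagDiff μ n g (lagShift h x)) ∂seqLaw μ =
      ∫ x, B (lagDiff μ (n + h) g x) (lagDiff μ n g (lagShift h x)) ∂seqLaw μ := by
  have h2t : (2 : ℝ≥0∞) ≠ ∞ := ENNReal.ofNat_ne_top
  have hV : MemLp (fun x => lagDiff μ n g (lagShift h x)) 2 (seqLaw μ) :=
    memLp_comp_lagShift (memLp_lagDiff one_le_two h2t hg hg2 n) h
  have hD := memLp_lagDiff one_le_two h2t hg hg2 (n + h)
  have hL := memLp_lagExp one_le_two h2t hg hg2 (n + h + 1)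
  have hzero : ∫ x, B (lagExp μ (n + h + 1) g x) (lagDiff μ n g (lagShift h x)) ∂seqLaw μ = 0 := by
    rw [integral_bilin_eq_lagExp_right hB (m := n + h + 1) hL hV
      fun x y => lagExp_splice le_rfl x y]
    refine integral_eq_zero_of_ae ?_
    have h0 := (measurePreserving_lagShift μ h).quasiMeasurePreserving.ae
      (lagExp_succ_lagDiff hg (hg2.integrable one_le_two) n)
    filter_upwards [h0] with x hx
    rw [show n + h + 1 = (n + 1) + h by omega,
      lagExp_add_comp_lagShift (stronglyMeasurable_lagDiff hg n), hx]
    simp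
  rw [integral_bilin_eq_lagExp_left hB (m := n + h) hg2 hV fun x y => by
    rw [lagShift_splice, lagDiff_splice]]
  have e : ∀ x, B (lagExp μ (n + h) g x) (lagDiff μ n g (lagShift h x)) =
      B (lagDiff μ (n + h) g x) (lagDiff μ n g (lagShift h x)) +
      B (lagExp μ (n + h + 1) g x) (lagDiff μ n g (lagShift h x)) := fun x => by
    rw [← _root_.add_apply, ← map_add]
    simp only [lagDiff, Pi.sub_apply, sub_add_cancel]
  simp_rw [e]
  rw [integral_add (integrable_bilin hB hD hV) (integrable_bilin hB hL hV), hzero, add_zero]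

/-- The norm of the martingale difference `E[X_n | 𝒢_0] - E[X_n | 𝒢_{-1}]` in `L²`. -/
noncomputable def projNorm (μ : Measure S) [IsProbabilityMeasure μ] (g : (ℕ → S) → H) (n : ℕ) :
    ℝ≥0∞ :=
  eLpNorm (lagDiff μ n g) 2 (seqLaw μ)

theorem lagExp_add_sum_lagDiff (N : ℕ) (x : ℕ → S) :
    lagExp μ N g x + ∑ n ∈ Finset.range N, lagDiff μ n g x = g x := by
  induction N with
  | zero => simp [lagExp_zero]
  | succ N ih =>
    rw [Finset.sum_range_succ, ← ih]
    simp only [lagDiff, Pi.sub_apply]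
    abel

/-- The shifted factor is telescoped into martingale differences, each of which meets only the
matching difference of the other factor. The remainder `lagExp N g` tends to zero in `L²` because
`g` is centred. -/
theorem enorm_integral_bilin_lagShift_le (hB : ∀ x y, ‖B x y‖ ≤ ‖x‖ * ‖y‖)
    (hg : StronglyMeasurable g) (hg2 : MemLp g 2 (seqLaw μ)) (hg0 : ∫ x, g x ∂seqLaw μ = 0)
    (h : ℕ) :
    ‖∫ x, B (g x) (g (lagShift h x)) ∂seqLaw μ‖ₑ ≤
      ∑' n, projNorm μ g (n + h) * projNorm μ g n := by
  have h2t : (2 : ℝ≥0∞) ≠ ∞ := ENNReal.ofNat_ne_top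
  have hDs : ∀ n, MemLp (fun x => lagDiff μ n g (lagShift h x)) 2 (seqLaw μ) := fun n =>
    memLp_comp_lagShift (memLp_lagDiff one_le_two h2t hg hg2 n) h
  have hLs : ∀ n, MemLp (fun x => lagExp μ n g (lagShift h x)) 2 (seqLaw μ) := fun n =>
    memLp_comp_lagShift (memLp_lagExp one_le_two h2t hg hg2 n) h
  have hterm : ∀ n, ‖∫ x, B (g x) (lagDiff μ n g (lagShift h x)) ∂seqLaw μ‖ₑ ≤
      projNorm μ g (n + h) * projNorm μ g n := fun n => by
    rw [integral_bilin_lagDiff hB hg hg2]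
    refine (enorm_integral_bilin_le hB (memLp_lagDiff one_le_two h2t hg hg2 (n + h))
      (hDs n)).trans_eq ?_
    congr 1
    exact eLpNorm_comp_measurePreserving (stronglyMeasurable_lagDiff hg n).aestronglyMeasurable
      (measurePreserving_lagShift μ h)
  have hbound : ∀ N, ‖∫ x, B (g x) (g (lagShift h x)) ∂seqLaw μ‖ₑ ≤
      eLpNorm g 2 (seqLaw μ) * eLpNorm (lagExp μ N g) 2 (seqLaw μ) +
        ∑' n, projNorm μ g (n + h) * projNorm μ g n := fun N => by
    have e : ∀ x, B (g x) (g (lagShift h x)) = B (g x) (lagExp μ N g (lagShift h x)) +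
        ∑ n ∈ Finset.range N, B (g x) (lagDiff μ n g (lagShift h x)) := fun x => by
      rw [← map_sum, ← map_add, lagExp_add_sum_lagDiff]
    simp_rw [e]
    rw [integral_add (integrable_bilin hB hg2 (hLs N))
      (integrable_finsetSum _ fun n _ => integrable_bilin hB hg2 (hDs n)),
      integral_finsetSum _ fun n _ => integrable_bilin hB hg2 (hDs n)]
    refine (enorm_add_le _ _).trans (add_le_add ?_ ?_)
    · refine (enorm_integral_bilin_le hB hg2 (hLs N)).trans_eq ?_
      congr 1
      exact eLpNorm_comp_measurePreserving (stronglyMeasurable_lagExp hg N).aestronglyMeasurable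
        (measurePreserving_lagShift μ h)
    · refine (enorm_sum_le _ _).trans ((Finset.sum_le_sum fun n _ => hterm n).trans ?_)
      exact ENNReal.sum_le_tsum _
  refine ENNReal.le_of_forall_pos_le_add fun η hη _ => ?_
  set G := eLpNorm g 2 (seqLaw μ) with hG
  -- Division by `G + 1` also covers `G = 0`.
  have hδ : (η : ℝ≥0∞) / (G + 1) ≠ 0 :=
    ENNReal.div_ne_zero.2 ⟨by simpa using hη.ne', by simpa [hG] using hg2.2.ne⟩
  obtain ⟨N, hN⟩ := eLpNorm_lagExp_sub_integral_le one_le_two h2t hg hg2 hδ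
  have hN' := hN N le_rfl
  simp only [hg0, sub_zero] at hN'
  refine (hbound N).trans ?_
  rw [add_comm]
  refine add_le_add le_rfl ?_
  calc G * eLpNorm (lagExp μ N g) 2 (seqLaw μ) ≤ (G + 1) * (η / (G + 1)) :=
        mul_le_mul' le_self_add hN'
    _ ≤ η := ENNReal.mul_div_le

theorem projNorm_le_resampleDist (hg : StronglyMeasurable g) {q : ℝ} (hq : 2 ≤ q)
    (hgq : MemLp g (ENNReal.ofReal q) (seqLaw μ)) (n : ℕ) :
    projNorm μ g n ≤ resampleDist μ g (ENNReal.ofReal q) n := by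
  have hq2 : 2 ≤ ENNReal.ofReal q := by
    rw [← ENNReal.ofReal_ofNat]; exact ENNReal.ofReal_le_ofReal hq
  refine (eLpNorm_le_eLpNorm_of_exponent_le hq2
    (stronglyMeasurable_lagDiff hg n).aestronglyMeasurable).trans ?_
  exact eLpNorm_lagDiff_le (one_le_two.trans hq2) ENNReal.ofReal_ne_top hg hgq n

end Covariance

/-! ### Weighted sums of correlation sequences. -/

section Convolution

theorem tsum_int_natAbs_le (F : ℕ → ℝ≥0∞) : ∑' h : ℤ, F h.natAbs ≤ 2 * ∑' n, F n := by
  rw [tsum_of_nat_of_neg_add_one ENNReal.summable ENNReal.summable, two_mul]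
  refine add_le_add le_rfl ?_
  have : ∀ n : ℕ, F (-((n : ℤ) + 1)).natAbs = F (n + 1) := fun n => by congr 1
  simp_rw [this]
  exact ENNReal.tsum_comp_le_tsum_of_injective (add_left_injective 1) F

/-- After exchanging the sums, the weight `c m` is raised to `c (n + m)`, so that it belongs to the
index of the first factor. The weights used are `1` and `k`. -/
theorem tsum_mul_conv_le (ρ c : ℕ → ℝ≥0∞) (hc : ∀ m n, c m ≤ c (n + m)) :
    ∑' m, c m * ∑' n, ρ (n + m) * ρ n ≤ (∑' k, c k * ρ k) * ∑' n, ρ n := by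
  simp_rw [← ENNReal.tsum_mul_left]
  rw [ENNReal.tsum_comm]
  refine ENNReal.tsum_le_tsum fun n => ?_
  simp_rw [← mul_assoc]
  rw [ENNReal.tsum_mul_right]
  refine mul_le_mul' ?_ le_rfl
  refine (ENNReal.tsum_le_tsum fun m => mul_le_mul' (hc m n) le_rfl).trans ?_
  exact ENNReal.tsum_comp_le_tsum_of_injective (f := fun m => n + m) (add_right_injective n)
    fun k => c k * ρ k

end Convolution

/-! ### Conditional expectations and covariances of the causal process. -/

section CausalCovariance

variable {Ω S : Type*} [MeasurableSpace Ω] [MeasurableSpace S] {P : Measure Ω}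
  [IsProbabilityMeasure P] {ε ε' : ℤ → Ω → S}
  {H : Type*} [NormedAddCommGroup H] [InnerProductSpace ℂ H] [CompleteSpace H]
  {K : Type*} [NormedAddCommGroup K] [InnerProductSpace ℂ K] [CompleteSpace K]
  {B : H →L[ℝ] H →L[ℝ] K} {g : (ℕ → S) → H}

theorem lagShift_past (t : ℤ) (n : ℕ) (ω : Ω) : lagShift n (past ε t ω) = past ε (t - n) ω := by
  funext k
  simp only [lagShift, past]
  congr 1
  push_cast
  ring

/-- The sequence `x` preceded by `n` copies of its first term. -/
def pad (n : ℕ) (x : ℕ → S) : ℕ → S := fun k => x (k - n)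

/-- Used to write `lagExp n g` as a function of the shifted sequence alone, which gives
measurability with respect to the earlier past; the padded entries are overwritten. -/
theorem splice_pad_lagShift (n : ℕ) (x y : ℕ → S) :
    splice n (pad n (lagShift n x)) y = splice n x y := by
  funext k
  simp only [splice, pad, lagShift]
  split_ifs with h
  · rfl
  · rw [Nat.sub_add_cancel (not_lt.1 h)]

theorem IsIIDWithCopy.measurable_past (hε : IsIIDWithCopy ε ε' P) (t : ℤ) :
    Measurable (past ε t) :=
  measurable_pi_iff.2 fun _ => hε.measurable _

/-- An event of the past at `t - n` is the preimage of a set of shifted sequences, and splicing the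
first `n` terms does not affect the shift. Its indicator thus passes through the partial integral,
which is the defining property of conditional expectation. -/
theorem IsIIDWithCopy.condExp_eq (hε : IsIIDWithCopy ε ε' P) [IsProbabilityMeasure (P.map (ε 0))]
    (hg : StronglyMeasurable g) (hgi : Integrable g (seqLaw (P.map (ε 0)))) (t : ℤ) (n : ℕ) :
    P[causalProcess g ε t | pastSigma ε (t - n)] =ᵐ[P]
      fun ω => lagExp (P.map (ε 0)) n g (past ε t ω) := by
  set μ := P.map (ε 0)
  have hmp := hε.measurePreserving_past t
  have hm : pastSigma ε (t - n) = MeasurableSpace.comap (past ε (t - n)) MeasurableSpace.pi :=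
    pastSigma_eq_comap ε (t - n)
  have hle : pastSigma ε (t - n) ≤ ‹MeasurableSpace Ω› := by
    rw [hm]; exact (hε.measurable_past _).comap_le
  have hLi : Integrable (lagExp μ n g) (seqLaw μ) := integrable_lagExp hg hgi n
  have hLi' : Integrable (fun ω => lagExp μ n g (past ε t ω)) P :=
    hmp.integrable_comp_of_integrable hLi
  refine (ae_eq_condExp_of_forall_setIntegral_eq hle
    (hmp.integrable_comp_of_integrable hgi) (fun s _ _ => hLi'.integrableOn) ?_ ?_).symm
  · intro s hs _
    rw [hm] at hs
    obtain ⟨A, hA, rfl⟩ := hs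
    have hAm : MeasurableSet (lagShift n ⁻¹' A) := measurable_lagShift n hA
    have e : past ε (t - n) ⁻¹' A = past ε t ⁻¹' (lagShift n ⁻¹' A) := by
      ext ω; simp only [mem_preimage, lagShift_past]
    have key : ∫ x in lagShift n ⁻¹' A, lagExp μ n g x ∂seqLaw μ =
        ∫ x in lagShift n ⁻¹' A, g x ∂seqLaw μ := by
      rw [← integral_indicator hAm, ← integral_indicator hAm,
        ← integral_lagExp (hgi.indicator hAm) n]
      congr 1
      funext x
      have hx : ∀ y, lagShift n (splice n x y) = lagShift n x := fun y => by
        have := lagShift_splice n 0 x y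
        simpa using this
      by_cases hxA : lagShift n x ∈ A
      · rw [indicator_of_mem (by exact hxA)]
        simp only [lagExp]
        congr 1
        funext y
        rw [indicator_of_mem (by rw [mem_preimage, hx]; exact hxA)]
      · rw [indicator_of_notMem (by exact hxA)]
        simp only [lagExp]
        rw [integral_eq_zero_of_ae]
        refine ae_of_all _ fun y => indicator_of_notMem ?_ _
        rw [mem_preimage, hx]; exact hxA
    rw [e]
    have h1 := setIntegral_map (μ := P) (g := past ε t) (f := lagExp μ n g) hAm
      (by rw [hmp.map_eq]; exact hLi.1) hmp.aemeasurable
    have h2 := setIntegral_map (μ := P) (g := past ε t) (f := g) hAm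
      (by rw [hmp.map_eq]; exact hgi.1) hmp.aemeasurable
    rw [hmp.map_eq] at h1 h2
    rw [← h1, key, h2]
    rfl
  · have e : (fun ω => lagExp μ n g (past ε t ω)) =
        (fun x => lagExp μ n g (pad n x)) ∘ past ε (t - n) := by
      funext ω
      simp only [Function.comp, ← lagShift_past, lagExp, splice_pad_lagShift]
    have hpad : Measurable (pad n : (ℕ → S) → ℕ → S) :=
      measurable_pi_iff.2 fun _ => measurable_pi_apply _
    rw [e, hm]
    exact (((stronglyMeasurable_lagExp hg n).comp_measurable hpad).comp_measurable
      (comap_measurable _)).aestronglyMeasurable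

theorem IsIIDWithCopy.eLpNorm_proj (hε : IsIIDWithCopy ε ε' P)
    [IsProbabilityMeasure (P.map (ε 0))] (hg : StronglyMeasurable g)
    (hgi : Integrable g (seqLaw (P.map (ε 0)))) (n : ℕ) :
    eLpNorm (proj ε P 0 (causalProcess g ε n)) 2 P = projNorm (P.map (ε 0)) g n := by
  have h1 := hε.condExp_eq hg hgi n n
  have h2 := hε.condExp_eq hg hgi n (n + 1)
  rw [sub_self] at h1
  rw [show (n : ℤ) - ((n + 1 : ℕ) : ℤ) = 0 - 1 by push_cast; ring] at h2
  rw [projNorm, ← eLpNorm_comp_measurePreserving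
    (stronglyMeasurable_lagDiff hg n).aestronglyMeasurable (hε.measurePreserving_past n)]
  refine eLpNorm_congr_ae ?_
  filter_upwards [h1, h2] with ω h1 h2
  simp only [proj, Pi.sub_apply, h1, h2, Function.comp, lagDiff]

/-- Stationarity. Both times have to be expressed through the two-sided sequence, whose law is
invariant under shifts by any integer. -/
theorem IsIIDWithCopy.integral_bilin_shift (hε : IsIIDWithCopy ε ε' P) (hg : StronglyMeasurable g)
    (s t : ℤ) :
    ∫ ω, B (causalProcess g ε s ω) (causalProcess g ε t ω) ∂P =
      ∫ ω, B (causalProcess g ε (s - t) ω) (causalProcess g ε 0 ω) ∂P := by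
  have := hε.isProbabilityMeasure
  have hmp : ∀ r : ℤ, MeasurePreserving (fun ω j => ε (j + r) ω) P
      (Measure.infinitePi fun _ : ℤ => P.map (ε 0)) := fun r =>
    (measurePreserving_reindex (P.map (ε 0)) (f := fun j : ℤ => j + r)
      (add_left_injective r)).comp hε.measurePreserving
  have hF : StronglyMeasurable fun z : ℤ → S =>
      B (g fun k : ℕ => z (s - t - k)) (g fun k : ℕ => z (0 - k)) :=
    stronglyMeasurable_bilin B
      (hg.comp_measurable (measurable_pi_iff.2 fun _ => measurable_pi_apply _))
      (hg.comp_measurable (measurable_pi_iff.2 fun _ => measurable_pi_apply _))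
  have h1 := integral_comp_of_measurePreserving (hmp t) hF.aestronglyMeasurable
  have h2 := integral_comp_of_measurePreserving (hmp 0) hF.aestronglyMeasurable
  rw [← h2] at h1
  have e1 : ∀ k : ℕ, s - t - (k : ℤ) + t = s - k := fun k => by ring
  have e2 : ∀ k : ℕ, 0 - (k : ℤ) + t = t - k := fun k => by ring
  simp only [e1, e2, add_zero] at h1
  exact h1

theorem IsIIDWithCopy.enorm_integral_bilin_le (hε : IsIIDWithCopy ε ε' P)
    [IsProbabilityMeasure (P.map (ε 0))] (hB : ∀ x y, ‖B x y‖ ≤ ‖x‖ * ‖y‖)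
    (hg : StronglyMeasurable g) (hg2 : MemLp g 2 (seqLaw (P.map (ε 0))))
    (hg0 : ∫ x, g x ∂seqLaw (P.map (ε 0)) = 0) (h : ℤ) :
    ‖∫ ω, B (causalProcess g ε h ω) (causalProcess g ε 0 ω) ∂P‖ₑ ≤
      ∑' n, projNorm (P.map (ε 0)) g (n + h.natAbs) * projNorm (P.map (ε 0)) g n := by
  have hsm : ∀ m : ℕ, StronglyMeasurable fun x : ℕ → S => B (g x) (g (lagShift m x)) := fun m =>
    stronglyMeasurable_bilin B hg (stronglyMeasurable_comp_lagShift hg m)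
  have hsm' : ∀ m : ℕ, StronglyMeasurable fun x : ℕ → S => B.flip (g x) (g (lagShift m x)) :=
    fun m => stronglyMeasurable_bilin B.flip hg (stronglyMeasurable_comp_lagShift hg m)
  rcases Int.natAbs_eq h with hh | hh
  · have e := integral_comp_of_measurePreserving (hε.measurePreserving_past h)
      (hsm h.natAbs).aestronglyMeasurable
    have hz : ∀ ω, lagShift h.natAbs (past ε h ω) = past ε 0 ω := fun ω => by
      rw [lagShift_past]; congr 1; omega
    simp only [hz] at e
    refine le_trans (le_of_eq ?_) (enorm_integral_bilin_lagShift_le hB hg hg2 hg0 h.natAbs)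
    rw [← e]
    rfl
  -- At negative lags the later variable is the second one, so the one-sided estimate is applied to
  -- the flipped form.
  · have e := integral_comp_of_measurePreserving (hε.measurePreserving_past 0)
      (hsm' h.natAbs).aestronglyMeasurable
    have hz : ∀ ω, lagShift h.natAbs (past ε 0 ω) = past ε h ω := fun ω => by
      rw [lagShift_past]; congr 1; omega
    simp only [hz] at e
    refine le_trans (le_of_eq ?_) (enorm_integral_bilin_lagShift_le (B := B.flip)
      (fun x y => by rw [ContinuousLinearMap.flip_apply, mul_comm]; exact hB y x)
      hg hg2 hg0 h.natAbs)
    rw [← e]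
    rfl

end CausalCovariance

/-! ### Hilbert–Schmidt operators as a Hilbert space of families. -/

section HilbertSchmidtSpace

variable {H : Type*} [NormedAddCommGroup H] [InnerProductSpace ℂ H] [CompleteSpace H]

/-- The Hilbert space of square summable families `(k i)` in `H`, in which a Hilbert–Schmidt
operator `A` is represented by the family `(A (e i))`. -/
def HSSpace (H : Type*) [NormedAddCommGroup H] [InnerProductSpace ℂ H] [CompleteSpace H] : Type _ :=
  lp (fun _ : onbIndex H => H) 2

noncomputable instance : NormedAddCommGroup (HSSpace H) :=
  inferInstanceAs (NormedAddCommGroup (lp (fun _ : onbIndex H => H) 2))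

noncomputable instance : InnerProductSpace ℂ (HSSpace H) :=
  inferInstanceAs (InnerProductSpace ℂ (lp (fun _ : onbIndex H => H) 2))

instance : CompleteSpace (HSSpace H) :=
  inferInstanceAs (CompleteSpace (lp (fun _ : onbIndex H => H) 2))

/-- The coordinates of an element of `HSSpace H`. -/
noncomputable def hsCoord (i : onbIndex H) : HSSpace H →L[ℂ] H :=
  LinearMap.mkContinuous
    { toFun := fun k : lp (fun _ : onbIndex H => H) 2 => k i
      map_add' := fun _ _ => rfl
      map_smul' := fun _ _ => rfl } 1 fun k => by
    rw [one_mul]; exact lp.norm_apply_le_norm two_ne_zero _ i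

theorem hsCoord_ext {k l : HSSpace H} (h : ∀ i, hsCoord i k = hsCoord i l) : k = l :=
  lp.ext (funext h)

theorem enorm_sq_eq_tsum (k : HSSpace H) : ‖k‖ₑ ^ 2 = ∑' i, ‖hsCoord i k‖ₑ ^ 2 := by
  have h : HasSum (fun i => ‖hsCoord i k‖ ^ 2) (‖k‖ ^ 2) := by
    have h0 := lp.hasSum_norm (p := 2) (by norm_num) (k : lp (fun _ : onbIndex H => H) 2)
    simp only [ENNReal.toReal_ofNat, Real.rpow_ofNat] at h0
    exact h0
  have h4 : ∀ i, ‖hsCoord i k‖ₑ ^ 2 = ENNReal.ofReal (‖hsCoord i k‖ ^ 2) := fun i => by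
    rw [ENNReal.ofReal_pow (norm_nonneg _), ofReal_norm]
  rw [tsum_congr h4, ← ENNReal.ofReal_tsum_of_nonneg (fun i => by positivity) h.summable,
    h.tsum_eq, ENNReal.ofReal_pow (norm_nonneg _), ofReal_norm]

theorem summable_norm_inner_smul_sq (x y : H) :
    Summable fun i : onbIndex H => ‖inner ℂ y (onb H i) • x‖ ^ (2 : ℝ≥0∞).toReal := by
  have h : Summable fun i : onbIndex H => ‖inner ℂ (onb H i) y‖ ^ 2 := by
    have := (onb H).summable_inner_mul_inner y y
    refine (Complex.hasSum_re this.hasSum).summable.congr fun i => ?_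
    rw [← inner_conj_symm y (onb H i), ← Complex.normSq_eq_conj_mul_self, Complex.ofReal_re,
      Complex.normSq_eq_norm_sq]
  refine (h.mul_right (‖x‖ ^ 2)).congr fun i => ?_
  rw [norm_smul, norm_inner_symm]
  simp [mul_pow]

/-- The element of `HSSpace H` representing the rank one operator `x ⊗ y`. -/
noncomputable def hsTensorFun (x y : H) : HSSpace H :=
  (⟨fun i => inner ℂ y (onb H i) • x, memℓp_gen (summable_norm_inner_smul_sq x y)⟩ :
    lp (fun _ : onbIndex H => H) 2)

theorem hsCoord_hsTensorFun (x y : H) (i : onbIndex H) :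
    hsCoord i (hsTensorFun x y) = inner ℂ y (onb H i) • x := rfl

theorem norm_hsTensorFun (x y : H) : ‖hsTensorFun x y‖ = ‖x‖ * ‖y‖ := by
  have h : ‖hsTensorFun x y‖ₑ ^ 2 = (‖x‖ₑ * ‖y‖ₑ) ^ 2 := by
    rw [enorm_sq_eq_tsum]
    simp_rw [hsCoord_hsTensorFun, enorm_smul, mul_pow]
    rw [ENNReal.tsum_mul_right, ← tsum_enorm_inner_sq (onb H) y, mul_comm]
    congr 1
    refine tsum_congr fun i => ?_
    rw [← inner_conj_symm, RCLike.enorm_conj]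
  have h2 : ‖hsTensorFun x y‖ₑ = ‖x‖ₑ * ‖y‖ₑ := (ENNReal.pow_right_strictMono two_ne_zero).injective h
  have h3 := congrArg ENNReal.toReal h2
  simpa using h3

theorem hsTensorFun_smul_left (c : ℂ) (x y : H) :
    hsTensorFun (c • x) y = c • hsTensorFun x y :=
  hsCoord_ext fun i => by
    rw [map_smul, hsCoord_hsTensorFun, hsCoord_hsTensorFun, smul_comm]

theorem hsTensorFun_smul_right (c : ℂ) (x y : H) :
    hsTensorFun x (c • y) = (starRingEnd ℂ) c • hsTensorFun x y :=
  hsCoord_ext fun i => by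
    rw [map_smul, hsCoord_hsTensorFun, hsCoord_hsTensorFun, inner_smul_left, mul_smul]

/-- The tensor product `(x, y) ↦ x ⊗ y` as a real bilinear map. -/
noncomputable def hsTensor (H : Type*) [NormedAddCommGroup H] [InnerProductSpace ℂ H]
    [CompleteSpace H] : H →L[ℝ] H →L[ℝ] HSSpace H :=
  LinearMap.mkContinuous₂ (LinearMap.mk₂ ℝ hsTensorFun
    (fun x x' y => hsCoord_ext fun i => by
      rw [map_add]; simp only [hsCoord_hsTensorFun, smul_add])
    (fun c x y => by
      rw [RCLike.real_smul_eq_coe_smul (K := ℂ), RCLike.real_smul_eq_coe_smul (K := ℂ),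
        hsTensorFun_smul_left])
    (fun x y y' => hsCoord_ext fun i => by
      rw [map_add]; simp only [hsCoord_hsTensorFun, inner_add_left, add_smul])
    (fun c x y => by
      rw [RCLike.real_smul_eq_coe_smul (K := ℂ), RCLike.real_smul_eq_coe_smul (K := ℂ),
        hsTensorFun_smul_right, RCLike.conj_ofReal])) 1
    fun x y => by rw [one_mul]; exact (norm_hsTensorFun x y).le

theorem hsTensor_apply (x y : H) : hsTensor H x y = hsTensorFun x y := rfl

theorem norm_hsTensor_le (x y : H) : ‖hsTensor H x y‖ ≤ ‖x‖ * ‖y‖ :=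
  (norm_hsTensorFun x y).le

theorem hsTensor_smul_left (c : ℂ) (x y : H) : hsTensor H (c • x) y = c • hsTensor H x y :=
  hsTensorFun_smul_left c x y

theorem hsTensor_smul_right (c : ℂ) (x y : H) :
    hsTensor H x (c • y) = (starRingEnd ℂ) c • hsTensor H x y :=
  hsTensorFun_smul_right c x y

/-- The operator `A` is represented by the family `k`. -/
def Represents (A : H →L[ℂ] H) (k : HSSpace H) : Prop := ∀ i, hsCoord i k = A (onb H i)

namespace Represents

variable {A A' : H →L[ℂ] H} {k k' : HSSpace H}

theorem hsNorm_eq (h : Represents A k) : hsNorm A = ‖k‖ₑ := by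
  have h2 : ∑' i, ‖A (onb H i)‖ₑ ^ 2 = ‖k‖ₑ ^ 2 := by
    rw [enorm_sq_eq_tsum]; exact tsum_congr fun i => by rw [h i]
  rw [hsNorm, h2, ← ENNReal.rpow_natCast, ← ENNReal.rpow_mul]
  norm_num

/-- Parseval's identity applied to the adjoint at `u` has coefficients `⟨A e_i, u⟩`, to which
Cauchy–Schwarz applies. The bound makes series of operators converge whenever the representing
families are absolutely summable. -/
theorem norm_le (h : Represents A k) : ‖A‖ ≤ ‖k‖ := by
  rw [← LinearIsometryEquiv.norm_map ContinuousLinearMap.adjoint A]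
  refine ContinuousLinearMap.opNorm_le_bound _ (norm_nonneg _) fun u => ?_
  have h1 : ‖ContinuousLinearMap.adjoint A u‖ₑ ^ 2 ≤ (‖k‖ₑ * ‖u‖ₑ) ^ 2 := by
    rw [← tsum_enorm_inner_sq (onb H), mul_pow, enorm_sq_eq_tsum, ← ENNReal.tsum_mul_right]
    refine ENNReal.tsum_le_tsum fun i => ?_
    rw [ContinuousLinearMap.adjoint_inner_right, ← h i, ← mul_pow]
    refine pow_le_pow_left' ?_ 2
    rw [← ofReal_norm, ← ofReal_norm, ← ofReal_norm, ← ENNReal.ofReal_mul (norm_nonneg _)]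
    exact ENNReal.ofReal_le_ofReal (norm_inner_le_norm _ _)
  have h2 := (ENNReal.pow_right_strictMono two_ne_zero).le_iff_le.1 h1
  rw [← ofReal_norm, ← ofReal_norm, ← ofReal_norm, ← ENNReal.ofReal_mul (norm_nonneg _)] at h2
  exact (ENNReal.ofReal_le_ofReal_iff (by positivity)).1 h2

theorem sub (h : Represents A k) (h' : Represents A' k') : Represents (A - A') (k - k') :=
  fun i => by rw [map_sub, h i, h' i]; rfl

theorem smul (c : ℂ) (h : Represents A k) : Represents (c • A) (c • k) :=
  fun i => by rw [map_smul, h i]; rfl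

theorem sum {ι : Type*} (s : Finset ι) {A : ι → H →L[ℂ] H} {k : ι → HSSpace H}
    (h : ∀ j, Represents (A j) (k j)) : Represents (∑ j ∈ s, A j) (∑ j ∈ s, k j) :=
  fun i => by
    rw [map_sum, _root_.sum_apply]
    exact Finset.sum_congr rfl fun j _ => h j i

theorem rankOne (x y : H) : Represents (InnerProductSpace.rankOne ℂ x y) (hsTensor H x y) :=
  fun i => by rw [hsTensor_apply, hsCoord_hsTensorFun, InnerProductSpace.rankOne_apply]

theorem integral {Ω : Type*} [MeasurableSpace Ω] {P : Measure Ω} {A : Ω → H →L[ℂ] H}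
    {k : Ω → HSSpace H} (hA : Integrable A P) (hk : Integrable k P)
    (h : ∀ ω, Represents (A ω) (k ω)) : Represents (∫ ω, A ω ∂P) (∫ ω, k ω ∂P) := fun i => by
  rw [← (hsCoord i).integral_comp_comm hk, ContinuousLinearMap.integral_apply hA]
  exact integral_congr_ae (ae_of_all _ fun ω => h ω i)

theorem tsum {ι : Type*} {A : ι → H →L[ℂ] H} {k : ι → HSSpace H}
    (hk : Summable fun j => ‖k j‖) (h : ∀ j, Represents (A j) (k j)) :
    Represents (∑' j, A j) (∑' j, k j) := fun i => by
  have hA : Summable A := Summable.of_norm_bounded hk fun j => (h j).norm_le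
  have h1 := hk.of_norm.hasSum.mapL (hsCoord i)
  have h2 := hA.hasSum.mapL (ContinuousLinearMap.apply ℂ H (onb H i))
  refine h1.unique ?_
  convert h2 using 1
  · funext j
    exact h j i
  · rfl

end Represents

end HilbertSchmidtSpace

/-! ### The bias of the lag window estimator. -/

section Bias

/-- The times `1, …, T` correspond to the lags `0, …, T - 1` behind time `T`. -/
theorem sum_Icc_eq_sum_range {M : Type*} [AddCommMonoid M] (T : ℕ) (F : ℤ → M) :
    ∑ s ∈ Finset.Icc (1 : ℤ) T, F s = ∑ i ∈ Finset.range T, F (T - i) := by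
  refine Finset.sum_nbij' (fun s => (T - s).toNat) (fun i => (T : ℤ) - i) ?_ ?_ ?_ ?_ ?_
  · intro s hs
    simp only [Finset.mem_Icc, Finset.mem_range] at *
    omega
  · intro i hi
    simp only [Finset.mem_Icc, Finset.mem_range] at *
    omega
  · intro s hs
    simp only [Finset.mem_Icc] at *
    omega
  · intro i hi
    simp
  · intro s hs
    simp only [Finset.mem_Icc] at *
    congr 1
    omega

/-- The number of pairs `(s, t)` in `{1, …, T}²` with `s - t = h`. -/
noncomputable def pairCount (T : ℕ) (h : ℤ) : ℕ :=
  ((Finset.Icc (1 : ℤ) T).filter fun s => s - h ∈ Finset.Icc (1 : ℤ) T).card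

theorem pairCount_le (T : ℕ) (h : ℤ) : pairCount T h ≤ T := by
  refine (Finset.card_filter_le _ _).trans ?_
  simp

theorem le_pairCount_add (T : ℕ) (h : ℤ) : T ≤ pairCount T h + h.natAbs := by
  have h1 := Finset.card_filter_add_card_filter_not (s := Finset.Icc (1 : ℤ) T)
    (fun s => s - h ∈ Finset.Icc (1 : ℤ) T)
  have h2 : ((Finset.Icc (1 : ℤ) T).filter fun s => ¬ s - h ∈ Finset.Icc (1 : ℤ) T).card ≤
      h.natAbs := by
    rcases le_total 0 h with hh | hh
    · refine (Finset.card_le_card (t := Finset.Icc 1 h) fun s hs => ?_).trans ?_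
      · simp only [Finset.mem_filter, Finset.mem_Icc, not_and, not_le] at *
        omega
      · simp only [Int.card_Icc]; omega
    · refine (Finset.card_le_card (t := Finset.Icc (T + h + 1) T) fun s hs => ?_).trans ?_
      · simp only [Finset.mem_filter, Finset.mem_Icc, not_and, not_le] at *
        omega
      · simp only [Int.card_Icc]; omega
  have h3 : (Finset.Icc (1 : ℤ) T).card = T := by simp
  rw [pairCount]
  omega

theorem sum_sum_sub_eq_tsum {M : Type*} [NormedAddCommGroup M] (T : ℕ) (F : ℤ → M) :
    ∑ s ∈ Finset.Icc (1 : ℤ) T, ∑ t ∈ Finset.Icc (1 : ℤ) T, F (s - t) =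
      ∑' h : ℤ, pairCount T h • F h := by
  have h1 : ∀ s : ℤ, HasSum (fun h => if s - h ∈ Finset.Icc (1 : ℤ) T then F h else 0)
      (∑ t ∈ Finset.Icc (1 : ℤ) T, F (s - t)) := fun s => by
    rw [← (Equiv.subLeft s).hasSum_iff]
    have h2 := hasSum_sum_of_ne_finset_zero (L := .unconditional ℤ)
      (f := fun t => if t ∈ Finset.Icc (1 : ℤ) T then F (s - t) else 0) (s := Finset.Icc (1 : ℤ) T)
      (fun t ht => if_neg ht)
    rw [Finset.sum_congr rfl fun t ht => if_pos ht] at h2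
    convert h2 using 1
    funext t
    simp [Function.comp]
  rw [← (hasSum_sum fun s _ => h1 s).tsum_eq]
  refine tsum_congr fun h => ?_
  rw [← Finset.sum_filter, Finset.sum_const, pairCount]

/-- The bound for the bias of the lag window estimator with autocovariances of norm `r h`. -/
noncomputable def biasBound (w : ℝ → ℝ) (r : ℤ → ℝ) (b : ℝ) (T : ℕ) : ℝ :=
  ∑' h : ℤ, (|w (b * h) - 1| + min 1 (|(h : ℝ)| / T)) * r h

theorem summable_biasBound {w : ℝ → ℝ} {W : ℝ} (hW : ∀ x, |w x| ≤ W) {r : ℤ → ℝ}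
    (hr : Summable r) (hr0 : ∀ h, 0 ≤ r h) (b : ℝ) (T : ℕ) :
    Summable fun h : ℤ => (|w (b * h) - 1| + min 1 (|(h : ℝ)| / T)) * r h := by
  refine Summable.of_nonneg_of_le (fun h => mul_nonneg (by positivity) (hr0 h)) (fun h => ?_)
    (hr.mul_left (W + 2))
  refine mul_le_mul_of_nonneg_right ?_ (hr0 h)
  have h1 : |w (b * h) - 1| ≤ W + 1 := (abs_sub _ _).trans (by simpa using hW _)
  have h2 : min 1 (|(h : ℝ)| / T) ≤ 1 := min_le_left _ _
  linarith

/-- Let `ν` be the number of pairs at lag `h` divided by `T`. The coefficient of `c h` in the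
difference is `νw - 1 = ν(w - 1) - (1 - ν)` up to a factor of modulus one, with `0 ≤ ν ≤ 1` and `1 -
ν ≤ min 1 (|h| / T)`. The bound does not involve `lam`. -/
theorem norm_bias_le {M : Type*} [NormedAddCommGroup M] [InnerProductSpace ℂ M] [CompleteSpace M]
    {w : ℝ → ℝ} (heven : ∀ x, w (-x) = w x) {W : ℝ} (hW : ∀ x, |w x| ≤ W) {c : ℤ → M}
    (hc : Summable fun h => ‖c h‖) (b lam : ℝ) {T : ℕ} (hT : 1 ≤ T) :
    ‖(1 / (T : ℂ)) • (∑ s ∈ Finset.Icc (1 : ℤ) T, ∑ t ∈ Finset.Icc (1 : ℤ) T,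
      ((w (b * ((t : ℝ) - s)) : ℂ) * Complex.exp (Complex.I * lam * ((t : ℂ) - s))) • c (s - t)) -
      ∑' h : ℤ, Complex.exp (-(Complex.I * lam * h)) • c h‖ ≤
      biasBound w (fun h => ‖c h‖) b T := by
  have hT0 : (0 : ℝ) < T := by exact_mod_cast hT
  have hexp : ∀ h : ℤ, ‖Complex.exp (-(Complex.I * lam * h))‖ = 1 := fun h => by
    rw [Complex.norm_exp]; simp
  set e : ℤ → ℂ := fun h => Complex.exp (-(Complex.I * lam * h)) with he
  have h1 : ∑ s ∈ Finset.Icc (1 : ℤ) T, ∑ t ∈ Finset.Icc (1 : ℤ) T,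
      ((w (b * ((t : ℝ) - s)) : ℂ) * Complex.exp (Complex.I * lam * ((t : ℂ) - s))) • c (s - t) =
      ∑' h : ℤ, pairCount T h • (((w (b * h) : ℂ) * e h) • c h) := by
    rw [← sum_sum_sub_eq_tsum]
    refine Finset.sum_congr rfl fun s _ => Finset.sum_congr rfl fun t _ => ?_
    congr 2
    · rw [← heven]
      congr 2
      push_cast; ring
    · simp only [he]
      congr 1
      push_cast; ring
  have hb : ∀ h : ℤ, ‖((pairCount T h / T * w (b * h) - 1 : ℝ) : ℂ) • e h • c h‖ ≤
      (|w (b * h) - 1| + min 1 (|(h : ℝ)| / T)) * ‖c h‖ := fun h => by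
    rw [norm_smul, norm_smul, hexp, one_mul, Complex.norm_real, Real.norm_eq_abs]
    refine mul_le_mul_of_nonneg_right ?_ (norm_nonneg _)
    set ν : ℝ := pairCount T h / T with hν
    have hν0 : 0 ≤ ν := by positivity
    have hν1 : ν ≤ 1 := by
      rw [hν, div_le_one hT0]; exact_mod_cast pairCount_le T h
    have hν2 : 1 - ν ≤ |(h : ℝ)| / T := by
      rw [hν, le_div_iff₀ hT0, sub_mul, div_mul_cancel₀ _ hT0.ne', one_mul, sub_le_iff_le_add]
      have := le_pairCount_add T h
      have h2 : (T : ℝ) ≤ pairCount T h + h.natAbs := by exact_mod_cast this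
      rw [Nat.cast_natAbs, Int.cast_abs] at h2
      linarith
    have h3 : 1 - ν ≤ min 1 (|(h : ℝ)| / T) := le_min (by linarith) hν2
    have e1 : ν * w (b * h) - 1 = ν * (w (b * h) - 1) - (1 - ν) := by ring
    rw [e1]
    refine (abs_sub _ _).trans (add_le_add ?_ ?_)
    · rw [abs_mul, abs_of_nonneg hν0]
      exact mul_le_of_le_one_left (abs_nonneg _) hν1
    · rw [abs_of_nonneg (by linarith)]; exact h3
  have hsum := summable_biasBound hW hc (fun h => norm_nonneg _) b T
  have hs2 : Summable fun h : ℤ => e h • c h :=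
    Summable.of_norm_bounded hc fun h => by rw [norm_smul, hexp, one_mul]
  have hs3 : Summable fun h : ℤ => ((pairCount T h / T * w (b * h) - 1 : ℝ) : ℂ) • e h • c h :=
    Summable.of_norm_bounded hsum hb
  have h4 : ∀ h : ℤ, (1 / (T : ℂ)) • pairCount T h • (((w (b * h) : ℂ) * e h) • c h) =
      ((pairCount T h / T * w (b * h) - 1 : ℝ) : ℂ) • e h • c h + e h • c h := fun h => by
    rw [← Nat.cast_smul_eq_nsmul ℂ, smul_smul, smul_smul, smul_smul, ← add_smul]
    congr 1
    push_cast; ring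
  have h5 : (1 / (T : ℂ)) • ∑' h : ℤ, pairCount T h • (((w (b * h) : ℂ) * e h) • c h) -
      ∑' h : ℤ, e h • c h =
      ∑' h : ℤ, ((pairCount T h / T * w (b * h) - 1 : ℝ) : ℂ) • e h • c h := by
    rw [← tsum_const_smul'', tsum_congr h4, hs3.tsum_add hs2, add_sub_cancel_right]
  rw [h1, h5]
  exact tsum_of_norm_bounded hsum.hasSum hb

theorem tendsto_biasBound {w : ℝ → ℝ} {W : ℝ} (hW : ∀ x, |w x| ≤ W) (h0 : w 0 = 1)
    (hw : Tendsto w (𝓝[≠] 0) (𝓝 1)) {r : ℤ → ℝ} (hr : Summable r) (hr0 : ∀ h, 0 ≤ r h)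
    {b : ℕ → ℝ} (hb : Tendsto b atTop (𝓝 0)) :
    Tendsto (fun T : ℕ => biasBound w r (b T) T) atTop (𝓝 0) := by
  have hcont : ContinuousAt w 0 := by
    rw [continuousAt_iff_punctured_nhds, h0]; exact hw
  have key := tendsto_tsum_of_dominated_convergence (𝓕 := atTop)
    (f := fun (T : ℕ) (h : ℤ) => (|w (b T * h) - 1| + min 1 (|(h : ℝ)| / T)) * r h)
    (g := fun _ => (0 : ℝ)) (bound := fun h => (W + 2) * r h) (hr.mul_left _) ?_ ?_
  · simpa [biasBound] using key
  · intro h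
    have h1 : Tendsto (fun T : ℕ => b T * h) atTop (𝓝 0) := by simpa using hb.mul_const (h : ℝ)
    have h2 : Tendsto (fun T : ℕ => w (b T * h)) atTop (𝓝 1) := by
      have := hcont.tendsto.comp h1
      rwa [h0] at this
    have h3 : Tendsto (fun T : ℕ => |w (b T * h) - 1|) atTop (𝓝 0) := by
      simpa using (h2.sub_const 1).abs
    have h4 : Tendsto (fun T : ℕ => min 1 (|(h : ℝ)| / T)) atTop (𝓝 0) := by
      have := (tendsto_const_nhds (x := (1 : ℝ))).min
        (tendsto_const_div_atTop_nhds_zero_nat |(h : ℝ)|)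
      simpa using this
    simpa using (h3.add h4).mul_const (r h)
  · refine Eventually.of_forall fun T h => ?_
    have h1 : |w (b T * h) - 1| ≤ W + 1 := (abs_sub _ _).trans (by simpa using hW _)
    have h2 : min 1 (|(h : ℝ)| / T) ≤ 1 := min_le_left _ _
    have h3 : 0 ≤ min 1 (|(h : ℝ)| / T) := by positivity
    rw [Real.norm_of_nonneg (mul_nonneg (by positivity) (hr0 h))]
    exact mul_le_mul_of_nonneg_right (by linarith) (hr0 h)

/-- Away from zero the bound on `w` itself gives a linear estimate, so the local rate holds
globally. -/
theorem abs_sub_one_le_of_isBigO {w : ℝ → ℝ} {W : ℝ} (hW : ∀ x, |w x| ≤ W)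
    (hO : (fun x => w x - 1) =O[𝓝 0] fun x => x) :
    ∃ L, 0 ≤ L ∧ ∀ x, |w x - 1| ≤ L * |x| := by
  obtain ⟨c, hc⟩ := hO.bound
  obtain ⟨δ, hδ, hball⟩ := Metric.eventually_nhds_iff.1 hc
  have hW0 : 0 ≤ W := (abs_nonneg _).trans (hW 0)
  refine ⟨max c ((W + 1) / δ), le_max_of_le_right (by positivity), fun x => ?_⟩
  rcases lt_or_ge |x| δ with hx | hx
  · have := hball (y := x) (by simpa using hx)
    rw [Real.norm_eq_abs, Real.norm_eq_abs] at this
    exact this.trans (mul_le_mul_of_nonneg_right (le_max_left _ _) (abs_nonneg _))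
  · calc |w x - 1| ≤ W + 1 := (abs_sub _ _).trans (by simpa using hW x)
      _ = (W + 1) / δ * δ := by field_simp
      _ ≤ max c ((W + 1) / δ) * |x| := by
        gcongr
        exact le_max_right _ _

theorem biasBound_le {w : ℝ → ℝ} {W : ℝ} (hW : ∀ x, |w x| ≤ W) {L : ℝ}
    (hL : ∀ x, |w x - 1| ≤ L * |x|) {r : ℤ → ℝ} (hr : Summable r) (hr0 : ∀ h, 0 ≤ r h)
    (hr1 : Summable fun h : ℤ => |(h : ℝ)| * r h) {b : ℝ} (hb : 0 ≤ b) (T : ℕ) :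
    biasBound w r b T ≤ (L * b + 1 / T) * ∑' h : ℤ, |(h : ℝ)| * r h := by
  rw [← tsum_mul_left]
  refine (summable_biasBound hW hr hr0 b T).tsum_le_tsum (fun h => ?_) (hr1.mul_left _)
  rw [← mul_assoc]
  refine mul_le_mul_of_nonneg_right ?_ (hr0 h)
  have h1 := hL (b * h)
  rw [abs_mul, abs_of_nonneg hb] at h1
  have h2 : min 1 (|(h : ℝ)| / T) ≤ |(h : ℝ)| / T := min_le_right _ _
  calc _ ≤ L * (b * |(h : ℝ)|) + |(h : ℝ)| / T := add_le_add h1 h2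
    _ = _ := by ring

end Bias

/-! ### Bias and variance bound for the estimator. -/

section Estimator

variable {Ω S : Type*} [MeasurableSpace Ω] [MeasurableSpace S] {P : Measure Ω}
  [IsProbabilityMeasure P] {ε ε' : ℤ → Ω → S}
  {H : Type*} [NormedAddCommGroup H] [InnerProductSpace ℂ H] [CompleteSpace H]
  {g : (ℕ → S) → H}

/-- The lag-`h` covariance as an element of `HSSpace H`. -/
noncomputable def hsCov (P : Measure Ω) (X : ℤ → Ω → H) (h : ℤ) : HSSpace H :=
  ∫ ω, hsTensor H (X h ω) (X 0 ω) ∂P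

/-- The sum of squared weights of a lag window with bandwidth `b`. -/
noncomputable def weightSum (w : ℝ → ℝ) (b : ℝ) : ℝ≥0∞ :=
  ∑' h : ℤ, ENNReal.ofReal (w (b * h) ^ 2)

theorem continuous_rankOne :
    Continuous fun z : H × H => (InnerProductSpace.rankOne ℂ z.1 z.2 : H →L[ℂ] H) := by
  have h : Continuous fun z : H × H =>
      ContinuousLinearMap.smulRightL ℂ H H (innerSL ℂ z.2) z.1 := by
    fun_prop
  exact h

theorem integrable_rankOne {u v : Ω → H} (hu : MemLp u 2 P) (hv : MemLp v 2 P) :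
    Integrable (fun ω => (InnerProductSpace.rankOne ℂ (u ω) (v ω) : H →L[ℂ] H)) P := by
  have hm : AEStronglyMeasurable
      (fun ω => (InnerProductSpace.rankOne ℂ (u ω) (v ω) : H →L[ℂ] H)) P :=
    continuous_rankOne.comp_aestronglyMeasurable (f := fun ω => (u ω, v ω)) (hu.1.prodMk hv.1)
  have hi : Integrable (fun ω => ‖u ω‖ * ‖v ω‖) P := hu.norm.integrable_mul hv.norm
  exact hi.mono' hm (ae_of_all _ fun ω => (InnerProductSpace.norm_rankOne _ _).le)

theorem represents_lagCov {X : ℤ → Ω → H} (hX : ∀ t, MemLp (X t) 2 P) (h : ℤ) :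
    Represents (lagCov P X h) (hsCov P X h) :=
  Represents.integral (integrable_rankOne (hX h) (hX 0))
    (integrable_bilin norm_hsTensor_le (hX h) (hX 0)) fun _ => Represents.rankOne _ _

theorem hsLpNorm_eq_eLpNorm {p : ℝ} (hp : 0 < p) {Y : Ω → H →L[ℂ] H} {k : Ω → HSSpace H}
    (h : ∀ ω, Represents (Y ω) (k ω)) : hsLpNorm p Y P = eLpNorm k (ENNReal.ofReal p) P := by
  rw [eLpNorm_eq_lintegral_rpow_enorm_toReal (by simpa using hp) ENNReal.ofReal_ne_top,
    ENNReal.toReal_ofReal hp.le, hsLpNorm]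
  simp_rw [(h _).hsNorm_eq]

/-- Along a row or a column of the coefficient matrix each lag occurs at most once; this supplies
the constant `A` in the bound for quadratic forms. -/
theorem sum_weight_sq_le (w : ℝ → ℝ) (b : ℝ) {φ : ℕ → ℤ} (hφ : Function.Injective φ) (T : ℕ) :
    ∑ j ∈ Finset.range T, ENNReal.ofReal (w (b * φ j) ^ 2) ≤ weightSum w b :=
  (ENNReal.sum_le_tsum _).trans
    (ENNReal.tsum_comp_le_tsum_of_injective hφ fun h : ℤ => ENNReal.ofReal (w (b * h) ^ 2))

theorem enorm_weight_sq (x y : ℝ) :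
    ‖(x : ℂ) * Complex.exp (Complex.I * y)‖ₑ ^ 2 = ENNReal.ofReal (x ^ 2) := by
  have : ‖(x : ℂ) * Complex.exp (Complex.I * y)‖ = |x| := by
    rw [norm_mul, mul_comm Complex.I, Complex.norm_exp_ofReal_mul_I, mul_one, Complex.norm_real,
      Real.norm_eq_abs]
  rw [← ofReal_norm, this, ← ENNReal.ofReal_pow (abs_nonneg _), sq_abs]

theorem IsIIDWithCopy.memLp_two (hε : IsIIDWithCopy ε ε' P)
    [IsProbabilityMeasure (P.map (ε 0))] {p : ℝ} (hp : 2 ≤ p) (hg : StronglyMeasurable g)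
    (hgq : MemLp g (ENNReal.ofReal (2 * p)) (seqLaw (P.map (ε 0)))) (t : ℤ) :
    MemLp (causalProcess g ε t) 2 P :=
  ((hε.memLp_iff hg _ t).2 hgq).mono_exponent (by
    rw [← ENNReal.ofReal_ofNat]; exact ENNReal.ofReal_le_ofReal (by linarith))

/-- The double sum in the lag window estimator, as a random element of `HSSpace H`. -/
noncomputable def lagForm (a : ℤ → ℤ → ℂ) (X : ℤ → Ω → H) (T : ℕ) (ω : Ω) : HSSpace H :=
  ∑ s ∈ Finset.Icc (1 : ℤ) T, ∑ t ∈ Finset.Icc (1 : ℤ) T, a s t • hsTensor H (X s ω) (X t ω)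

/-- The expectation of `lagForm` for a stationary process. -/
noncomputable def lagFormMean (P : Measure Ω) (a : ℤ → ℤ → ℂ) (X : ℤ → Ω → H) (T : ℕ) :
    HSSpace H :=
  ∑ s ∈ Finset.Icc (1 : ℤ) T, ∑ t ∈ Finset.Icc (1 : ℤ) T, a s t • hsCov P X (s - t)

theorem lagForm_eq_quadForm (a : ℤ → ℤ → ℂ) (T : ℕ) (ω : Ω) :
    lagForm a (causalProcess g ε) T ω =
      quadForm (hsTensor H) (fun i j => a (T - i) (T - j)) T g (past ε T ω) := by
  rw [lagForm, quadForm, sum_Icc_eq_sum_range]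
  refine Finset.sum_congr rfl fun i _ => ?_
  rw [sum_Icc_eq_sum_range]
  refine Finset.sum_congr rfl fun j _ => ?_
  rw [lagShift_past, lagShift_past]
  rfl

theorem IsIIDWithCopy.integral_lagForm (hε : IsIIDWithCopy ε ε' P) (hg : StronglyMeasurable g)
    (hX2 : ∀ t, MemLp (causalProcess g ε t) 2 P) (a : ℤ → ℤ → ℂ) (T : ℕ) :
    ∫ ω, lagForm a (causalProcess g ε) T ω ∂P = lagFormMean P a (causalProcess g ε) T := by
  have hi : ∀ s t, Integrable (fun ω => a s t • hsTensor H (causalProcess g ε s ω)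
      (causalProcess g ε t ω)) P := fun s t =>
    Integrable.smul (a s t) (integrable_bilin norm_hsTensor_le (hX2 s) (hX2 t))
  simp only [lagForm, lagFormMean]
  rw [integral_finsetSum _ fun s _ => integrable_finsetSum _ fun t _ => hi s t]
  refine Finset.sum_congr rfl fun s _ => ?_
  rw [integral_finsetSum _ fun t _ => hi s t]
  refine Finset.sum_congr rfl fun t _ => ?_
  rw [integral_smul, hε.integral_bilin_shift hg, hsCov]

theorem IsIIDWithCopy.stronglyMeasurable_lagForm (hε : IsIIDWithCopy ε ε' P)
    (hg : StronglyMeasurable g) (a : ℤ → ℤ → ℂ) (T : ℕ) :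
    StronglyMeasurable (lagForm a (causalProcess g ε) T) := by
  rw [funext (lagForm_eq_quadForm a T)]
  exact (stronglyMeasurable_quadForm _ _ _ hg).comp_measurable (hε.measurable_past T)

theorem IsIIDWithCopy.eLpNorm_lagForm_sub_sq_le (hε : IsIIDWithCopy ε ε' P)
    [IsProbabilityMeasure (P.map (ε 0))] {p : ℝ} (hp : 2 ≤ p) (hg : StronglyMeasurable g)
    (hgq : MemLp g (ENNReal.ofReal (2 * p)) (seqLaw (P.map (ε 0))))
    (hg0 : ∫ x, g x ∂seqLaw (P.map (ε 0)) = 0) {w : ℝ → ℝ} {b : ℝ} {a : ℤ → ℤ → ℂ}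
    (ha : ∀ s t : ℤ, ‖a s t‖ₑ ^ 2 = ENNReal.ofReal (w (b * ((t - s : ℤ) : ℝ)) ^ 2)) (T : ℕ) :
    eLpNorm (fun ω => lagForm a (causalProcess g ε) T ω - lagFormMean P a (causalProcess g ε) T)
        (ENNReal.ofReal p) P ^ 2 ≤
      ENNReal.ofReal (4 * martingaleConst p * martingaleConst (2 * p)) *
        (∑' m, resampleDist (P.map (ε 0)) g (ENNReal.ofReal (2 * p)) m) ^ 4 *
          (weightSum w b * T) := by
  have hmp := hε.measurePreserving_past (T : ℤ)
  have hqm : StronglyMeasurable (quadForm (hsTensor H) (fun i j => a (T - i) (T - j)) T g) :=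
    stronglyMeasurable_quadForm _ _ _ hg
  have hrow : ∀ i ∈ Finset.range T,
      ∑ j ∈ Finset.range T, ‖a (T - i) (T - j)‖ₑ ^ 2 ≤ weightSum w b := by
    intro i _
    simp only [ha]
    exact sum_weight_sq_le w b (φ := fun j : ℕ => (T - j : ℤ) - (T - i))
      (fun x y h => by simpa using h) T
  have hcol : ∀ j ∈ Finset.range T,
      ∑ i ∈ Finset.range T, ‖a (T - i) (T - j)‖ₑ ^ 2 ≤ weightSum w b := by
    intro j _
    simp only [ha]
    exact sum_weight_sq_le w b (φ := fun i : ℕ => (T - j : ℤ) - (T - i))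
      (fun x y h => by simpa using h) T
  refine le_trans (le_of_eq ?_) (eLpNorm_quadForm_sub_integral_sq_le hp norm_hsTensor_le
    hsTensor_smul_left hsTensor_smul_right hg hgq hg0 (fun i j => a (T - i) (T - j)) T hrow hcol)
  have hEQ := integral_comp_of_measurePreserving hmp hqm.aestronglyMeasurable
  simp_rw [← lagForm_eq_quadForm] at hEQ
  rw [hε.integral_lagForm hg (hε.memLp_two hp hg hgq)] at hEQ
  rw [← hEQ]
  have hDm := hqm.sub (stronglyMeasurable_const (b := lagFormMean P a (causalProcess g ε) T))
  congr 1
  refine Eq.trans ?_ (eLpNorm_comp_measurePreserving hDm.aestronglyMeasurable hmp)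
  congr 1
  funext ω
  simp only [Function.comp, lagForm_eq_quadForm]

theorem represents_lagWindowEst_sub {X : ℤ → Ω → H} (hX : ∀ t, MemLp (X t) 2 P)
    (hcov : Summable fun h => ‖hsCov P X h‖) (w : ℝ → ℝ) (b lam : ℝ) (T : ℕ) (ω : Ω) :
    Represents (lagWindowEst w b X T lam ω - specDensity P X lam)
      ((1 / (2 * Real.pi * T : ℂ)) • lagForm (fun s t : ℤ => (w (b * ((t : ℝ) - s)) : ℂ) *
        Complex.exp (Complex.I * lam * ((t : ℂ) - s))) X T ω -
      (1 / (2 * Real.pi : ℂ)) • ∑' h : ℤ, Complex.exp (-(Complex.I * lam * h)) • hsCov P X h) := by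
  refine Represents.sub (Represents.smul _ (Represents.sum _ fun s => Represents.sum _ fun t =>
    Represents.smul _ (Represents.rankOne _ _))) (Represents.smul _ (Represents.tsum ?_ fun h =>
    Represents.smul _ (represents_lagCov hX h)))
  refine hcov.congr fun h => ?_
  rw [norm_smul, Complex.norm_exp]
  simp

theorem add_sq_le_two_mul (x y : ℝ≥0∞) : (x + y) ^ 2 ≤ 2 * x ^ 2 + 2 * y ^ 2 := by
  have h := ENNReal.rpow_add_le_mul_rpow_add_rpow x y (p := 2) (by norm_num)
  norm_num at h
  rwa [mul_add] at h

/-- The estimator is split at its mean. The factor `T` from the quadratic form and the squared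
normalisation leave `weightSum / T`, and the factors `1/(2π)` are bounded by `1`. -/
theorem IsIIDWithCopy.hsLpNorm_sq_le (hε : IsIIDWithCopy ε ε' P)
    [IsProbabilityMeasure (P.map (ε 0))] {p : ℝ} (hp : 2 ≤ p) (hg : StronglyMeasurable g)
    (hgq : MemLp g (ENNReal.ofReal (2 * p)) (seqLaw (P.map (ε 0))))
    (hg0 : ∫ x, g x ∂seqLaw (P.map (ε 0)) = 0)
    (hcov : Summable fun h => ‖hsCov P (causalProcess g ε) h‖)
    {w : ℝ → ℝ} (heven : ∀ x, w (-x) = w x) {W : ℝ} (hW : ∀ x, |w x| ≤ W)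
    (b lam : ℝ) {T : ℕ} (hT : 1 ≤ T) :
    hsLpNorm p (fun ω => lagWindowEst w b (causalProcess g ε) T lam ω -
        specDensity P (causalProcess g ε) lam) P ^ 2 ≤
      2 * (ENNReal.ofReal (4 * martingaleConst p * martingaleConst (2 * p)) *
        (∑' m, resampleDist (P.map (ε 0)) g (ENNReal.ofReal (2 * p)) m) ^ 4 *
          (weightSum w b / T)) +
      2 * ENNReal.ofReal
        (biasBound w (fun h => ‖hsCov P (causalProcess g ε) h‖) b T) ^ 2 := by
  have hX2 := hε.memLp_two hp hg hgq
  have hp0 : 0 < p := by linarith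
  have hQ1 : 1 ≤ ENNReal.ofReal p := by rw [ENNReal.one_le_ofReal]; linarith
  have hT0 : (0 : ℝ) < T := by exact_mod_cast hT
  rw [hsLpNorm_eq_eLpNorm hp0 (represents_lagWindowEst_sub hX2 hcov w b lam T)]
  have hbias := norm_bias_le heven hW hcov b lam hT
  obtain ⟨a, ha⟩ : ∃ a : ℤ → ℤ → ℂ, a = fun s t : ℤ =>
    (w (b * ((t : ℝ) - s)) : ℂ) * Complex.exp (Complex.I * lam * ((t : ℂ) - s)) := ⟨_, rfl⟩
  have hnorm : ∀ s t : ℤ, ‖a s t‖ₑ ^ 2 = ENNReal.ofReal (w (b * ((t - s : ℤ) : ℝ)) ^ 2) :=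
      fun s t => by
    rw [← enorm_weight_sq _ (lam * ((t : ℝ) - s)), ha]
    push_cast
    rw [mul_assoc]
  have hvar := hε.eLpNorm_lagForm_sub_sq_le hp hg hgq hg0 hnorm T
  have hQm := hε.stronglyMeasurable_lagForm hg a T
  have hbias' : ‖(1 / (T : ℂ)) • lagFormMean P a (causalProcess g ε) T -
      ∑' h : ℤ, Complex.exp (-(Complex.I * lam * h)) • hsCov P (causalProcess g ε) h‖ ≤
      biasBound w (fun h => ‖hsCov P (causalProcess g ε) h‖) b T := by
    rw [lagFormMean, ha]; exact hbias
  rw [← ha]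
  generalize hF : ∑' h : ℤ, Complex.exp (-(Complex.I * lam * h)) •
    hsCov P (causalProcess g ε) h = F at hbias' ⊢
  generalize hE : lagFormMean P a (causalProcess g ε) T = E at hbias' hvar
  generalize hQ : lagForm a (causalProcess g ε) T = Q at hQm hvar ⊢
  generalize biasBound w (fun h => ‖hsCov P (causalProcess g ε) h‖) b T = β at hbias' ⊢
  have hsplit : (fun ω => (1 / (2 * Real.pi * T : ℂ)) • Q ω - (1 / (2 * Real.pi : ℂ)) • F) =
      (1 / (2 * Real.pi * T : ℂ)) • (fun ω => Q ω - E) +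
        fun _ => (1 / (2 * Real.pi : ℂ)) • ((1 / (T : ℂ)) • E - F) := by
    funext ω
    simp only [Pi.add_apply, Pi.smul_apply, smul_sub, smul_smul]
    rw [show (1 / (2 * Real.pi : ℂ)) * (1 / (T : ℂ)) = 1 / (2 * Real.pi * T : ℂ) by
      rw [div_mul_div_comm, one_mul]]
    abel
  have hDa : AEStronglyMeasurable (fun ω => Q ω - E) P :=
    (hQm.sub stronglyMeasurable_const).aestronglyMeasurable
  have hpi : (1 : ℝ) ≤ 2 * Real.pi := by linarith [Real.pi_gt_three]
  have hc1 : ‖(1 / (2 * Real.pi * T : ℂ))‖ₑ ≤ (T : ℝ≥0∞)⁻¹ := by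
    rw [← ofReal_norm, ← ENNReal.ofReal_natCast, ← ENNReal.ofReal_inv_of_pos hT0]
    refine ENNReal.ofReal_le_ofReal ?_
    rw [norm_div, norm_mul, norm_mul, norm_one, Complex.norm_real, Complex.norm_natCast,
      Real.norm_of_nonneg Real.pi_pos.le, Complex.norm_ofNat, one_div]
    exact inv_anti₀ hT0 (le_mul_of_one_le_left hT0.le hpi)
  have hc2 : ‖(1 / (2 * Real.pi : ℂ)) • ((1 / (T : ℂ)) • E - F)‖ₑ ≤ ENNReal.ofReal β := by
    rw [← ofReal_norm]
    refine ENNReal.ofReal_le_ofReal (le_trans ?_ hbias')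
    rw [norm_smul, norm_div, norm_mul, norm_one, Complex.norm_real,
      Real.norm_of_nonneg Real.pi_pos.le, Complex.norm_ofNat]
    refine mul_le_of_le_one_left (norm_nonneg _) ?_
    rw [div_le_one (by linarith)]
    exact hpi
  rw [hsplit]
  have htri := eLpNorm_add_le (hDa.const_smul (1 / (2 * Real.pi * T : ℂ)))
    (aestronglyMeasurable_const (μ := P) (b := (1 / (2 * Real.pi : ℂ)) • ((1 / (T : ℂ)) • E - F)))
    hQ1
  rw [eLpNorm_const_smul, eLpNorm_const _ (zero_lt_one.trans_le hQ1).ne' (NeZero.ne _),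
    measure_univ, ENNReal.one_rpow, mul_one] at htri
  have htri2 := htri.trans (add_le_add (mul_le_mul' hc1 le_rfl) hc2)
  refine (pow_le_pow_left' htri2 2).trans ((add_sq_le_two_mul _ _).trans
    (add_le_add (mul_le_mul' le_rfl ?_) le_rfl))
  rw [mul_pow]
  refine (mul_le_mul' le_rfl hvar).trans (le_of_eq ?_)
  have hTne : (T : ℝ≥0∞) ≠ 0 := by
    simp only [ne_eq, Nat.cast_eq_zero]; omega
  have hTtop : (T : ℝ≥0∞) ≠ ∞ := ENNReal.natCast_ne_top T
  rw [ENNReal.div_eq_inv_mul]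
  calc _ = ENNReal.ofReal (4 * martingaleConst p * martingaleConst (2 * p)) *
        (∑' m, resampleDist (P.map (ε 0)) g (ENNReal.ofReal (2 * p)) m) ^ 4 *
          ((T : ℝ≥0∞)⁻¹ * weightSum w b) * ((T : ℝ≥0∞)⁻¹ * T) := by ring
    _ = _ := by rw [ENNReal.inv_mul_cancel hTne hTtop, mul_one]

end Estimator

/-! ### Summability of covariances and rates in the bandwidth. -/

section Rates

variable {Ω S : Type*} [MeasurableSpace Ω] [MeasurableSpace S] {P : Measure Ω}
  [IsProbabilityMeasure P] {ε ε' : ℤ → Ω → S}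
  {H : Type*} [NormedAddCommGroup H] [InnerProductSpace ℂ H] [CompleteSpace H]
  {g : (ℕ → S) → H}

theorem IsIIDWithCopy.tsum_mul_enorm_hsCov_le (hε : IsIIDWithCopy ε ε' P)
    [IsProbabilityMeasure (P.map (ε 0))] (hg : StronglyMeasurable g)
    (hg2 : MemLp g 2 (seqLaw (P.map (ε 0)))) (hg0 : ∫ x, g x ∂seqLaw (P.map (ε 0)) = 0)
    {c : ℕ → ℝ≥0∞} (hc : Monotone c) :
    ∑' h : ℤ, c h.natAbs * ‖hsCov P (causalProcess g ε) h‖ₑ ≤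
      2 * ((∑' k, c k * projNorm (P.map (ε 0)) g k) * ∑' n, projNorm (P.map (ε 0)) g n) :=
  calc ∑' h : ℤ, c h.natAbs * ‖hsCov P (causalProcess g ε) h‖ₑ
      ≤ ∑' h : ℤ, c h.natAbs * ∑' n, projNorm (P.map (ε 0)) g (n + h.natAbs) *
          projNorm (P.map (ε 0)) g n :=
        ENNReal.tsum_le_tsum fun h => mul_le_mul' le_rfl
          (hε.enorm_integral_bilin_le norm_hsTensor_le hg hg2 hg0 h)
    _ ≤ 2 * ∑' m, c m * ∑' n, projNorm (P.map (ε 0)) g (n + m) * projNorm (P.map (ε 0)) g n :=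
        tsum_int_natAbs_le fun m =>
          c m * ∑' n, projNorm (P.map (ε 0)) g (n + m) * projNorm (P.map (ε 0)) g n
    _ ≤ _ := mul_le_mul' le_rfl
        (tsum_mul_conv_le _ c fun m n => hc (Nat.le_add_left m n))

theorem weightSum_div_eq (w : ℝ → ℝ) {b : ℝ} (hb : 0 < b) {T : ℕ} (hT : 1 ≤ T) :
    weightSum w b / T = ENNReal.ofReal b * weightSum w b * ENNReal.ofReal (1 / (b * T)) := by
  have hT' : (0 : ℝ) < T := by exact_mod_cast hT
  rw [one_div, mul_inv, ENNReal.ofReal_mul (inv_nonneg.2 hb.le), ENNReal.ofReal_inv_of_pos hb,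
    ENNReal.ofReal_inv_of_pos hT', ENNReal.ofReal_natCast, div_eq_mul_inv,
    mul_comm (ENNReal.ofReal b), mul_assoc (weightSum w b), ← mul_assoc (ENNReal.ofReal b),
    ENNReal.mul_inv_cancel (by simpa using hb) ENNReal.ofReal_ne_top, one_mul]

theorem eventually_pos_of_tendsto_mul_natCast {b : ℕ → ℝ}
    (hb : Tendsto (fun T : ℕ => b T * T) atTop atTop) : ∀ᶠ T : ℕ in atTop, 0 < b T := by
  filter_upwards [hb.eventually_gt_atTop 0] with T hT
  exact pos_of_mul_pos_left hT T.cast_nonneg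

theorem IsLagWindow.tendsto_mul_weightSum {w : ℝ → ℝ} (hw : IsLagWindow w) {b : ℕ → ℝ}
    (hb : Tendsto b atTop (𝓝 0)) (hbT : Tendsto (fun T : ℕ => b T * T) atTop atTop) :
    Tendsto (fun T => ENNReal.ofReal (b T) * weightSum w (b T)) atTop
      (𝓝 (∫⁻ x, ENNReal.ofReal (w x ^ 2))) :=
  hw.riemann.comp (tendsto_nhdsWithin_iff.2 ⟨hb, eventually_pos_of_tendsto_mul_natCast hbT⟩)

theorem IsLagWindow.tendsto_weightSum_div {w : ℝ → ℝ} (hw : IsLagWindow w) {b : ℕ → ℝ}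
    (hb : Tendsto b atTop (𝓝 0)) (hbT : Tendsto (fun T : ℕ => b T * T) atTop atTop) :
    Tendsto (fun T : ℕ => weightSum w (b T) / T) atTop (𝓝 0) := by
  have h1 : Tendsto (fun T : ℕ => ENNReal.ofReal (1 / (b T * T))) atTop (𝓝 0) := by
    simpa using ENNReal.tendsto_ofReal (tendsto_inv_atTop_zero.comp hbT)
  have h2 := ENNReal.Tendsto.mul (hw.tendsto_mul_weightSum hb hbT) (Or.inr ENNReal.zero_ne_top) h1
    (Or.inr hw.sq_finite.ne)
  rw [mul_zero] at h2
  refine h2.congr' ?_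
  filter_upwards [eventually_pos_of_tendsto_mul_natCast hbT, eventually_ge_atTop 1] with T hT hT1
  exact (weightSum_div_eq w hT hT1).symm

theorem tendsto_error_bound {V B : ℕ → ℝ≥0∞} {A : ℝ≥0∞} (hA : A ≠ ∞)
    (hV : Tendsto V atTop (𝓝 0)) (hB : Tendsto B atTop (𝓝 0)) :
    Tendsto (fun T => 2 * (A * V T) + 2 * B T ^ 2) atTop (𝓝 0) := by
  have h1 := ENNReal.Tendsto.const_mul (a := 2)
    (ENNReal.Tendsto.const_mul (a := A) hV (Or.inr hA)) (Or.inr ENNReal.ofNat_ne_top)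
  have h2 := ENNReal.Tendsto.const_mul (a := 2) (ENNReal.Tendsto.pow (n := 2) hB)
    (Or.inr ENNReal.ofNat_ne_top)
  simpa using h1.add h2

/-- The term `1 / T²` coming from the incomplete pairs is absorbed into `1 / (bT)`, since `b ≤ 1 ≤
T`. -/
theorem sq_bias_rate_le {L M b β : ℝ} {T : ℕ} (hb : 0 < b) (hb1 : b ≤ 1) (hT : 1 ≤ T)
    (hβ0 : 0 ≤ β) (hβ : β ≤ (L * b + 1 / T) * M) :
    β ^ 2 ≤ 2 * M ^ 2 * (L ^ 2 + 1) * (1 / (b * T) + b ^ 2) := by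
  have hT' : (1 : ℝ) ≤ T := by exact_mod_cast hT
  have hT0 : (0 : ℝ) < T := by linarith
  have h1 : (1 / T : ℝ) ^ 2 ≤ 1 / (b * T) := by
    rw [div_pow, one_pow]
    exact one_div_le_one_div_of_le (by positivity) (by nlinarith)
  have h2 : 0 ≤ 1 / (b * T) := by positivity
  have h3 : (L * b + 1 / T) ^ 2 ≤ 2 * (L ^ 2 + 1) * (1 / (b * T) + b ^ 2) := by
    have h4 : (L * b + 1 / T) ^ 2 ≤ 2 * (L * b) ^ 2 + 2 * (1 / T : ℝ) ^ 2 := by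
      nlinarith [sq_nonneg (L * b - 1 / T)]
    have h5 : 0 ≤ L ^ 2 * (1 / (b * T)) := by positivity
    nlinarith [sq_nonneg b]
  calc β ^ 2 ≤ ((L * b + 1 / T) * M) ^ 2 := pow_le_pow_left₀ hβ0 hβ 2
    _ = (L * b + 1 / T) ^ 2 * M ^ 2 := mul_pow _ _ _
    _ ≤ 2 * (L ^ 2 + 1) * (1 / (b * T) + b ^ 2) * M ^ 2 :=
        mul_le_mul_of_nonneg_right h3 (sq_nonneg M)
    _ = _ := by ring

theorem biasBound_nonneg {r : ℤ → ℝ} (hr0 : ∀ h, 0 ≤ r h) (w : ℝ → ℝ) (b : ℝ) (T : ℕ) :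
    0 ≤ biasBound w r b T :=
  tsum_nonneg fun h => mul_nonneg (by positivity) (hr0 h)

theorem summable_toReal_mul_norm {E : Type*} [NormedAddCommGroup E] {c : ℤ → ℝ≥0∞} {f : ℤ → E}
    (hf : ∑' h, c h * ‖f h‖ₑ ≠ ∞) : Summable fun h => (c h).toReal * ‖f h‖ := by
  simpa [ENNReal.toReal_mul] using ENNReal.summable_toReal hf

theorem IsLagWindow.exists_error_rate {w : ℝ → ℝ} (hw : IsLagWindow w)
    (hO : (fun x => w x - 1) =O[𝓝 0] fun x => x) {r : ℤ → ℝ} (hr : Summable r)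
    (hr0 : ∀ h, 0 ≤ r h) (hr1 : Summable fun h : ℤ => |(h : ℝ)| * r h) {A : ℝ≥0∞} (hA : A ≠ ∞)
    {b : ℕ → ℝ} (hb : Tendsto b atTop (𝓝 0))
    (hbT : Tendsto (fun T : ℕ => b T * T) atTop atTop) :
    ∃ C : ℝ, ∀ᶠ T : ℕ in atTop,
      2 * (A * (weightSum w (b T) / T)) + 2 * ENNReal.ofReal (biasBound w r (b T) T) ^ 2 ≤
        ENNReal.ofReal (C * (1 / (b T * T) + b T ^ 2)) := by
  obtain ⟨W, hW⟩ := hw.bounded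
  obtain ⟨L, -, hL⟩ := abs_sub_one_le_of_isBigO hW hO
  set κ := ∫⁻ x, ENNReal.ofReal (w x ^ 2) with hκ
  have hκ1 : κ + 1 ≠ ∞ := ENNReal.add_ne_top.2 ⟨hw.sq_finite.ne, ENNReal.one_ne_top⟩
  set M := ∑' h : ℤ, |(h : ℝ)| * r h
  have hAκ : 2 * (A * (κ + 1)) ≠ ∞ :=
    ENNReal.mul_ne_top ENNReal.ofNat_ne_top (ENNReal.mul_ne_top hA hκ1)
  -- The first summand uses that `b ∑ w²(bh)` tends to `κ` and so is eventually at most `κ + 1`; the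
  -- second is twice the constant from `sq_bias_rate_le`.
  refine ⟨(2 * (A * (κ + 1))).toReal + 2 * (2 * M ^ 2 * (L ^ 2 + 1)), ?_⟩
  filter_upwards [eventually_pos_of_tendsto_mul_natCast hbT, eventually_ge_atTop 1,
    hb.eventually_le_const one_pos, (hw.tendsto_mul_weightSum hb hbT).eventually_le_const
      (ENNReal.lt_add_right hw.sq_finite.ne one_ne_zero)] with T hbp hT hb1 hκT
  have hT0 : (0 : ℝ) < T := by exact_mod_cast hT
  have hq : 0 ≤ 1 / (b T * T) := by positivity
  have hs : 0 ≤ 1 / (b T * T) + b T ^ 2 := by positivity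
  rw [add_mul, ENNReal.ofReal_add (by positivity) (by positivity)]
  refine add_le_add ?_ ?_
  · rw [weightSum_div_eq w hbp hT, ENNReal.ofReal_mul ENNReal.toReal_nonneg,
      ENNReal.ofReal_toReal hAκ, ← mul_assoc A, ← mul_assoc]
    gcongr
    exact le_add_of_nonneg_right (sq_nonneg _)
  · rw [mul_assoc, ENNReal.ofReal_mul zero_le_two, ENNReal.ofReal_ofNat,
      ← ENNReal.ofReal_pow (biasBound_nonneg hr0 w _ _)]
    refine mul_le_mul' le_rfl (ENNReal.ofReal_le_ofReal ?_)
    exact sq_bias_rate_le hbp hb1 hT (biasBound_nonneg hr0 w _ _)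
      (biasBound_le hW hL hr hr0 hr1 hbp.le T)

end Rates

end SpectralDensity

/-! ### Proof of the theorem. -/

open SpectralDensity

theorem theorem4p1 {Ω S H : Type*} [MeasurableSpace Ω] [MeasurableSpace S]
    [NormedAddCommGroup H] [InnerProductSpace ℂ H] [CompleteSpace H]
    [TopologicalSpace.SeparableSpace H] [MeasurableSpace H] [BorelSpace H]
    (P : Measure Ω) [IsProbabilityMeasure P]
    (ε ε' : ℤ → Ω → S) (hε : SpectralDensity.IsIIDWithCopy ε ε' P)
    (g : (ℕ → S) → H) (hg : Measurable g)
    (X : ℤ → Ω → H) (hX : X = SpectralDensity.causalProcess g ε)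
    (p : ℝ) (hp : 2 ≤ p)
    (hdep : SpectralDensity.DependenceCondition ε ε' P (2 * p) X)
    (w : ℝ → ℝ) (hw : SpectralDensity.IsLagWindow w) :
    -- the series defining the spectral density operator converges absolutely in `S₂(H)`
    (∑' h : ℤ, SpectralDensity.hsNorm (SpectralDensity.lagCov P X h) < ∞) ∧
    -- (i) uniform consistency
    (∀ b : ℕ → ℝ, Tendsto b atTop (𝓝 0) → Tendsto (fun T : ℕ => b T * T) atTop atTop →
      Tendsto (fun T : ℕ => ⨆ lam ∈ Icc (0 : ℝ) Real.pi,
        SpectralDensity.hsLpNorm p (fun ω =>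
          SpectralDensity.lagWindowEst w (b T) X T lam ω
            - SpectralDensity.specDensity P X lam) P ^ 2) atTop (𝓝 0)) ∧
    -- (ii) uniform rate
    (Summable (fun h : ℤ =>
        (h : ℝ) * (eLpNorm (SpectralDensity.proj ε P 0 (X h)) 2 P).toReal) →
      (fun x => w x - 1) =O[𝓝 0] (fun x => x) →
      ∀ b : ℕ → ℝ, Tendsto b atTop (𝓝 0) → Tendsto (fun T : ℕ => b T * T) atTop atTop →
      ∃ C : ℝ, ∀ᶠ T : ℕ in atTop, ∀ lam ∈ Icc (0 : ℝ) Real.pi,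
        SpectralDensity.hsLpNorm p (fun ω =>
          SpectralDensity.lagWindowEst w (b T) X T lam ω
            - SpectralDensity.specDensity P X lam) P ^ 2
          ≤ ENNReal.ofReal (C * (1 / (b T * T) + b T ^ 2))) := by
  subst hX
  -- Separability is what makes the Borel measurable `g` strongly measurable.
  have hsc : SecondCountableTopology H := UniformSpace.secondCountable_of_separable H
  have hμ := hε.isProbabilityMeasure
  have hgs : StronglyMeasurable g := hg.stronglyMeasurable
  have hgq := (hε.memLp_iff hgs _ 0).1 (hdep.memLp 0)
  have hg0 : ∫ x, g x ∂seqLaw (P.map (ε 0)) = 0 := by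
    rw [← hε.integral_causalProcess hgs 0]; exact hdep.centered 0
  have hg2 : MemLp g 2 (seqLaw (P.map (ε 0))) :=
    (hε.memLp_iff hgs 2 0).1 (hε.memLp_two hp hgs hgq 0)
  have hΘ : ∑' m, resampleDist (P.map (ε 0)) g (ENNReal.ofReal (2 * p)) m ≠ ∞ := by
    refine ne_top_of_le_ne_top (ENNReal.mul_ne_top (a := 2) ENNReal.ofNat_ne_top hdep.summable.ne)
      ((ENNReal.tsum_le_tsum fun m => hε.resampleDist_le hgs (by linarith) m).trans ?_)
    rw [ENNReal.tsum_mul_left]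
  have hρ : ∑' n, projNorm (P.map (ε 0)) g n ≠ ∞ :=
    ne_top_of_le_ne_top hΘ
      (ENNReal.tsum_le_tsum fun n => projNorm_le_resampleDist hgs (by linarith) hgq n)
  have hcov : ∑' h : ℤ, ‖hsCov P (causalProcess g ε) h‖ₑ ≠ ∞ := by
    have h1 := hε.tsum_mul_enorm_hsCov_le hgs hg2 hg0 (c := fun _ => 1) monotone_const
    simp only [one_mul] at h1
    exact ne_top_of_le_ne_top
      (ENNReal.mul_ne_top ENNReal.ofNat_ne_top (ENNReal.mul_ne_top hρ hρ)) h1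
  have hr : Summable fun h => ‖hsCov P (causalProcess g ε) h‖ := by
    simpa using summable_toReal_mul_norm (c := fun _ => 1) (by simpa using hcov)
  have hA : ENNReal.ofReal (4 * martingaleConst p * martingaleConst (2 * p)) *
      (∑' m, resampleDist (P.map (ε 0)) g (ENNReal.ofReal (2 * p)) m) ^ 4 ≠ ∞ :=
    ENNReal.mul_ne_top ENNReal.ofReal_ne_top (ENNReal.pow_ne_top hΘ)
  obtain ⟨W, hW⟩ := hw.bounded
  refine ⟨?_, fun b hb hbT => ?_, fun hproj hO b hb hbT => ?_⟩
  · simp_rw [(represents_lagCov (hε.memLp_two hp hgs hgq) _).hsNorm_eq]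
    exact hcov.lt_top
  · refine tendsto_of_tendsto_of_tendsto_of_le_of_le' tendsto_const_nhds
      (tendsto_error_bound hA (hw.tendsto_weightSum_div hb hbT) (B := fun T =>
        ENNReal.ofReal (biasBound w (fun h => ‖hsCov P (causalProcess g ε) h‖) (b T) T)) ?_)
      (Eventually.of_forall fun _ => zero_le) ?_
    · simpa using ENNReal.tendsto_ofReal
        (tendsto_biasBound hW hw.zero hw.tendsto_one hr (fun _ => norm_nonneg _) hb)
    · filter_upwards [eventually_ge_atTop 1] with T hT
      exact iSup₂_le fun lam _ =>
        hε.hsLpNorm_sq_le hp hgs hgq hg0 hr hw.even hW (b T) lam hT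
  · have hρ1 : ∑' k : ℕ, (k : ℝ≥0∞) * projNorm (P.map (ε 0)) g k ≠ ∞ := by
      -- Summability over `ℤ` is unconditional and so passes to the nonnegative lags, the only ones
      -- needed.
      have h1 := hproj.comp_injective Nat.cast_injective
      -- No infinite value is hidden by `toReal`, because every norm here is finite by `hρ`.
      have h2 : ∀ k : ℕ, (k : ℝ≥0∞) * projNorm (P.map (ε 0)) g k =
          ENNReal.ofReal ((k : ℝ) *
            (eLpNorm (proj ε P 0 (causalProcess g ε k)) 2 P).toReal) := fun k => by
        rw [ENNReal.ofReal_mul k.cast_nonneg, ENNReal.ofReal_natCast,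
          hε.eLpNorm_proj hgs (hg2.integrable one_le_two) k,
          ENNReal.ofReal_toReal (ENNReal.ne_top_of_tsum_ne_top hρ k)]
      simp_rw [h2]
      rw [← ENNReal.ofReal_tsum_of_nonneg (fun k => by positivity)
        (by simpa [Function.comp_def] using h1)]
      exact ENNReal.ofReal_ne_top
    have hr1 : Summable fun h : ℤ => |(h : ℝ)| * ‖hsCov P (causalProcess g ε) h‖ := by
      have h1 := hε.tsum_mul_enorm_hsCov_le hgs hg2 hg0 (c := fun n => (n : ℝ≥0∞)) Nat.mono_cast
      have h2 := summable_toReal_mul_norm (ne_top_of_le_ne_top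
        (ENNReal.mul_ne_top ENNReal.ofNat_ne_top (ENNReal.mul_ne_top hρ1 hρ)) h1)
      simpa [Nat.cast_natAbs] using h2
    obtain ⟨C, hC⟩ := hw.exists_error_rate hO hr (fun _ => norm_nonneg _) hr1 hA hb hbT
    refine ⟨C, ?_⟩
    filter_upwards [hC, eventually_ge_atTop 1] with T hCT hT lam _
    exact (hε.hsLpNorm_sq_le hp hgs hgq hg0 hr hw.even hW (b T) lam hT).trans hCT
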